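/- **Setting.** Let $a^*(F),a(F)$, $F\in L^2(\mathbb R^3)$, be the creation and annihilation operators on the bosonic Fock space over $L^2(\mathbb R^3)$ (momentum space), with $[a(F),a^*(G)]=\langle F,G\rangle=\int \overline{F}G\,d^3k$, and let $\Omega$ be the vacuum. The massless scalar free field is $$\phi(f)=\tfrac1{\sqrt2}\big(a^*(F)+a(F)\big),\qquad F(k)=|k|^{-1/2}\tilde f(|k|,k),\qquad \tilde f(k^0,k)=(2\pi)^{-3/2}\int e^{i(k^0t-k\cdot x)}f(t,x)\,dt\,d^3x .$$ Admissible $f$ are either real functions $f\in C_c^\infty(\mathbb R^4)$, or sharp-time functions $f(t,x)=\delta(t-\tau)\eta(x)$ with $\tau\in\mathbb R$ and $\eta\in C_c^\infty(\mathbb R^3)$ real, whose support is contained in the spacelike complement $\{|t|<|x|\}$ of $0$ or in the open future lightcone $V_+=\{|x|<t\}$. For $R>0$ put $\phi_R(f)=R^{-3}\int\phi(x)f(x/R)\,d^4x$, i.e. $\phi_R(f)=\phi(f_R)$ with $f_R(x)=R^{-3}f(x/R)$. For $i=1,2,\dots$ let $\varepsilon_i=2^{-(i-1)}$, $b_i=1/i$,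 $1/\hat b_i=(b_i^2-1)/(b_i^2+1)$, and, for $r\in\mathbb R$, $\tau_i=\varepsilon_i^{-1}\varepsilon_i^{r}$. With the real orthonormal spherical harmonics $Y_{\ell m}$ let $$\zeta^{(r)}_{i\ell m}(k)=e^{-i|k|\tau_i}\,(\log 2)^{-1/2}\,|k|^{-3/2}\chi_{[\varepsilon_{i+1},\varepsilon_i]}(|k|)\,Y_{\ell m}(k/|k|),$$ $$\Psi^{(r)}_n=\prod_{1\le i\le n,\;0\le\ell\le i,\;-\ell\le m\le\ell}\exp\Big(-\frac1{2\hat b_i}\,a^*(\zeta^{(r)}_{i\ell m})^2\Big)\Omega ,$$ and $$\omega_r(\phi_R(f)^2)=\lim_{n\to\infty}\frac{\langle\Psi^{(r)}_n,\phi_R(f)^2\Psi^{(r)}_n\rangle}{\langle\Psi^{(r)}_n,\Psi^{(r)}_n\rangle}.$$ **Theorem.** The $\Psi^{(r)}_n$ are nonzero vectors of the Fock space. For every admissible $f$ the following hold. 1. For all $r\in\mathbb R$ and $R>0$ the limit defining $\omega_r(\phi_R(f)^2)$ exists and is finite. 2. For all $R>0$, $\langle\Omega,\phi_R(f)^2\Omega\rangle=\int\frac{d^3k}{2|k|}|\tilde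 f(|k|,k)|^2<\infty$. 3. If $r<0$, then $\displaystyle\lim_{R\to\infty}\omega_r(\phi_R(f)^2)=\int\frac{d^3k}{2|k|}\,|\tilde f(|k|,k)|^2$. 4. If $r\ge0$ and $k\mapsto\operatorname{Re}\tilde f(|k|,k)$ is not identically zero, then there is a sequence $R_n\to\infty$ with $\omega_r(\phi_{R_n}(f)^2)\to\infty$. -/

import Mathlib

open Filter Topology MeasureTheory
open scoped ENNReal

noncomputable section

namespace InfraredPhase

/-- Physical space. -/
abbrev Space := EuclideanSpace ℝ (Fin 3)

/-- Momentum space. -/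
abbrev Momentum := EuclideanSpace ℝ (Fin 3)

/-- Minkowski spacetime, with points `(t, x)`; the speed of light is `1`. -/
abbrev Spacetime := ℝ × Space

/-- The open future lightcone with tip at zero. -/
def forwardCone : Set Spacetime := {p | ‖p.2‖ < p.1}

/-- The (open) spacelike complement of zero. -/
def spacelikeComplement : Set Spacetime := {p | |p.1| < ‖p.2‖}

/-! ### Fock space of the massless scalar field -/

/-- A sequence `(Ψ N)` of `N`-particle momentum-space wave functions. The bosonic Fock space over
`L²(ℝ³)` consists of the symmetric square-integrable ones, with the norm `normSq` below. -/
abbrev FockVector := (N : ℕ) → (Fin N → Momentum) → ℂ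

/-- The Fock vacuum `Ω = (1, 0, 0, …)`. -/
def vacuum : FockVector := fun N _ => if N = 0 then 1 else 0

/-- The creation operator:
`(a*(F)Ψ)_N (k₁, …, k_N) = N^{-1/2} ∑ⱼ F(kⱼ) Ψ_{N-1}(k₁, …, k_N without kⱼ)`. -/
def creation (F : Momentum → ℂ) (Ψ : FockVector) : FockVector
  | 0 => fun _ => 0
  | N + 1 => fun k =>
      ((1 / Real.sqrt (N + 1 : ℝ) : ℝ) : ℂ) *
        ∑ j : Fin (N + 1), F (k j) * Ψ N (j.removeNth k)

/-- The annihilation operator: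
`(a(F)Ψ)_N (k₁, …, k_N) = (N+1)^{1/2} ∫ conj F(q) Ψ_{N+1}(q, k₁, …, k_N) d³q`. -/
def annihilation (F : Momentum → ℂ) (Ψ : FockVector) : FockVector := fun N k =>
  ((Real.sqrt (N + 1 : ℝ) : ℝ) : ℂ) *
    ∫ q : Momentum, (starRingEnd ℂ) (F q) * Ψ (N + 1) (Fin.cons q k : Fin (N + 1) → Momentum)

/-- The Segal field operator `2^{-1/2} (a*(F) + a(F))`. -/
def segalField (F : Momentum → ℂ) (Ψ : FockVector) : FockVector :=
  ((1 / Real.sqrt 2 : ℝ) : ℂ) • (creation F Ψ + annihilation F Ψ)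

/-- The square `⟨Ψ, Ψ⟩ = ∑_N ∫ |Ψ_N|²` of the Fock space norm. -/
def normSq (Ψ : FockVector) : ℝ≥0∞ :=
  ∑' N : ℕ, ∫⁻ k : Fin N → Momentum, ‖Ψ N k‖ₑ ^ 2

/-- The expectation `⟨Ψ, A² Ψ⟩ / ⟨Ψ, Ψ⟩ = ‖A Ψ‖² / ‖Ψ‖²` of the square of the
symmetric operator `A` in the vector state given by `Ψ`. -/
def expectationSq (Ψ : FockVector) (A : FockVector → FockVector) : ℝ≥0∞ :=
  normSq (A Ψ) / normSq Ψ

/-! ### Smearing functions and the scaled field -/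

/-- Smearing functions for the field: functions on spacetime, and the sharp-time
`f(t, x) = δ(t - τ) η(x)`. -/
inductive Smearing where
  | smooth (f : Spacetime → ℝ)
  | sharpTime (τ : ℝ) (η : Space → ℝ)

namespace Smearing

/-- `f ∈ D(ℝ⁴; ℝ)`, respectively `η ∈ D(ℝ³; ℝ)`. -/
def IsTest : Smearing → Prop
  | smooth f => ContDiff ℝ (⊤ : ℕ∞) f ∧ HasCompactSupport f
  | sharpTime _ η => ContDiff ℝ (⊤ : ℕ∞) η ∧ HasCompactSupport η

/-- The (closed) support in spacetime. -/
def support : Smearing → Set Spacetime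
  | smooth f => tsupport f
  | sharpTime τ η => {τ} ×ˢ tsupport η

/-- The scaled smearing function `x ↦ R⁻³ f(x / R)`, where
`δ(t / R - τ) η(x / R) = R δ(t - R τ) η(x / R)`. -/
def scaled (R : ℝ) : Smearing → Smearing
  | smooth f => smooth fun p => (R ^ 3)⁻¹ * f (R⁻¹ • p)
  | sharpTime τ η => sharpTime (R * τ) fun x => (R ^ 3)⁻¹ * R * η (R⁻¹ • x)

/-- The spacetime Fourier transform
`(2π)^{-3/2} ∫ exp(i (k⁰ t - k · x)) f(t, x) dt d³x` at `(k⁰, k)`. -/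
def fourier : Smearing → ℝ → Momentum → ℂ
  | smooth f => fun k₀ k =>
      (((2 * Real.pi) ^ (-(3 / 2) : ℝ) : ℝ) : ℂ) *
        ∫ p : Spacetime, Complex.exp (Complex.I * ((k₀ * p.1 - inner ℝ k p.2 : ℝ) : ℂ)) * (f p : ℂ)
  | sharpTime τ η => fun k₀ k =>
      (((2 * Real.pi) ^ (-(3 / 2) : ℝ) : ℝ) : ℂ) *
        ∫ x : Space, Complex.exp (Complex.I * ((k₀ * τ - inner ℝ k x : ℝ) : ℂ)) * (η x : ℂ)

/-- The restriction `k ↦ f̃(|k|, k)` of the Fourier transform to the mass shell. -/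
def onShell (f : Smearing) (k : Momentum) : ℂ := f.fourier ‖k‖ k

/-- The one-particle wave function `F(k) = |k|^{-1/2} f̃(|k|, k)` of `φ(f) Ω`, up to `2^{-1/2}`. -/
def oneParticle (f : Smearing) (k : Momentum) : ℂ :=
  ((‖k‖ ^ (-(1 / 2) : ℝ) : ℝ) : ℂ) * f.onShell k

end Smearing

/-- The massless scalar free field `φ(f)` on Fock space. -/
def field (f : Smearing) : FockVector → FockVector := segalField f.oneParticle

/-- The scaled field `φ_R(f) = R⁻³ ∫ φ(x) f(x / R) d⁴x`. -/
def scaledField (R : ℝ) (f : Smearing) : FockVector → FockVector := field (f.scaled R)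

/-- The vacuum value `∫ |f̃(|k|, k)|² d³k / (2|k|)`. -/
def vacuumFluctuation (f : Smearing) : ℝ≥0∞ :=
  ∫⁻ k : Momentum, ENNReal.ofReal (‖f.onShell k‖ ^ 2 / (2 * ‖k‖))

/-! ### Real spherical harmonics -/

/-- The Legendre polynomial `P_ℓ`, by the Rodrigues formula. -/
def legendre (l : ℕ) : Polynomial ℝ :=
  Polynomial.C (1 / (2 ^ l * (Nat.factorial l : ℝ))) *
    Polynomial.derivative^[l] ((Polynomial.X ^ 2 - 1) ^ l)

/-- The real orthonormal spherical harmonics `Y_{ℓ m}`, `-ℓ ≤ m ≤ ℓ`, at a unit vector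
`u = (sin θ cos φ, sin θ sin φ, cos θ)`: the constant times
`P_ℓ^{(|m|)}(cos θ) (sin θ)^{|m|}` times `cos (mφ)` for `0 ≤ m` and `sin (|m|φ)` for `m < 0`. -/
def sphericalHarmonic (l : ℕ) (m : ℤ) (u : Momentum) : ℝ :=
  Real.sqrt ((2 * l + 1) / (4 * Real.pi) *
      ((Nat.factorial (l - m.natAbs) : ℝ) / (Nat.factorial (l + m.natAbs) : ℝ))) *
    (if m = 0 then 1 else Real.sqrt 2) *
    (Polynomial.derivative^[m.natAbs] (legendre l)).eval (u 2) *
    (if 0 ≤ m then (((u 0 : ℂ) + (u 1 : ℂ) * Complex.I) ^ m.natAbs).re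
      else (((u 0 : ℂ) + (u 1 : ℂ) * Complex.I) ^ m.natAbs).im)

/-! ### The squeezed states of radiation -/

/-- `ε_i = 2^{-(i-1)}`. -/
def eps (i : ℕ) : ℝ := 2 ^ (1 - (i : ℤ))

/-- `b_i = 1 / i`. -/
def bCoeff (i : ℕ) : ℝ := 1 / i

/-- `1 / b̂_i`, where `b̂_i = (b_i² + 1) / (b_i² - 1)`; it vanishes for `i = 1`. -/
def bHatInv (i : ℕ) : ℝ := (bCoeff i ^ 2 - 1) / (bCoeff i ^ 2 + 1)

/-- The emission times are `-τ_i`, where `τ_i = ε_i⁻¹ ε_i^r`. -/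
def emissionTime (r : ℝ) (i : ℕ) : ℝ := (eps i)⁻¹ * eps i ^ r

/-- The normalized radial functions
`ζ°_i(κ) = (log 2)^{-1/2} κ^{-3/2}` for `ε_{i+1} ≤ κ ≤ ε_i`, and zero elsewhere. -/
def radialMode (i : ℕ) (κ : ℝ) : ℝ :=
  (Set.Icc (eps (i + 1)) (eps i)).indicator
    (fun κ => (Real.log 2) ^ (-(1 / 2) : ℝ) * κ ^ (-(3 / 2) : ℝ)) κ

/-- The time-translated modes `exp(-i |k| τ_i) ζ°_i(|k|) Y_{ℓ m}(k / |k|)`. -/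
def mode (r : ℝ) (i l : ℕ) (m : ℤ) (k : Momentum) : ℂ :=
  Complex.exp (-Complex.I * ((‖k‖ * emissionTime r i : ℝ) : ℂ)) *
    ((radialMode i ‖k‖ * sphericalHarmonic l m (‖k‖⁻¹ • k) : ℝ) : ℂ)

/-- The operator `∑_β -(1 / (2 b̂_β)) a*(ζ_β)²`, the sum being over the modes
`β = (i, ℓ, m)` with `1 ≤ i ≤ n`, `0 ≤ ℓ ≤ i`, `-ℓ ≤ m ≤ ℓ`. -/
def pairCreation (r : ℝ) (n : ℕ) (Ψ : FockVector) : FockVector :=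
  ∑ i ∈ Finset.Icc 1 n, ∑ l ∈ Finset.range (i + 1), ∑ m ∈ Finset.Icc (-(l : ℤ)) (l : ℤ),
    ((-(1 / 2) * bHatInv i : ℝ) : ℂ) • creation (mode r i l m) (creation (mode r i l m) Ψ)

/-- The squeezed vector `∏_β exp(-(1 / (2 b̂_β)) a*(ζ_β)²) Ω`. The creation operators commute, so
the product is the exponential of `pairCreation`; its `j`-th power creates `2 j` particles, so that
in every component at most one term of the series is nonzero. -/
def squeezed (r : ℝ) (n : ℕ) : FockVector := fun N k =>
  ∑' j : ℕ, ((1 / (Nat.factorial j : ℝ) : ℝ) : ℂ) * ((pairCreation r n)^[j] vacuum) N k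

/-- The value `ω_r(A²) = lim_n ⟨Ψ_n, A² Ψ_n⟩ / ⟨Ψ_n, Ψ_n⟩` of the state `ω_r` at the square of the
symmetric operator `A`. -/
def stateSq (r : ℝ) (A : FockVector → FockVector) : ℝ≥0∞ :=
  limUnder atTop fun n : ℕ => expectationSq (squeezed r n) A

end InfraredPhase

end

/-!
The vectors defining `ω_r` are squeezed vectors `Ψ = exp(∑ (t_b / 2) a*(ζ_b)²) Ω` with orthonormal
modes `ζ_b` and `t = (1 - b_i²) / (1 + b_i²) < 1` in the `i`-th shell; the orthonormality of the
modes (`isOrthonormal_modeFamily`) reduces to that of the spherical harmonics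
(`integral_sphericalHarmonic_mul`), since the shells are disjoint up to null sets. On `Ψ`,
annihilation operators act as creation operators (`annihilation_squeezedVector`):
`a(F) Ψ = a*(F') Ψ` with `F' = ∑ t_b ⟨F, ζ_b⟩ ζ_b`. Hence `φ(F) Ψ` is of the form `a*(H) Ψ / √2`,
and the commutation relations give `‖a*(H) Ψ‖² = ‖H‖² ‖Ψ‖² + ‖a*(H') Ψ‖²`. As `H ↦ H'` is a
contraction of the span of the modes, this recursion determines the norm
(`normSq_creation_sum_squeezedVector`), once it is known that `Ψ` is in the form domain of the
number operator (`summable_succ_mul_l2Sq`). The outcome (`expectationSq_squeezedVector`) is that the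
real part of the coefficient `⟨ζ_b, F⟩` contributes to the fluctuations with the factor
`(1 + t) / (1 - t) = i²`, the imaginary part with the factor `1 / i²`, and the part of `F` that is
orthogonal to the modes as in the vacuum. So the fluctuations are half of `‖F‖²` plus a sum of
contributions `shellTerm` of the shells (`expectationSq_squeezed`).

Let `G` be the restriction of the Fourier transform of the test function to the mass shell. The
scaled field has the wave function `|k|^{-1/2} R G(R k)`, whose norm does not depend on `R`. Its
coefficients in the `i`-th shell are the coefficients, with respect to the spherical harmonics, of
the function `u ↦ ρ ∫_{1/2}^1 exp(i x θ) G(ρ x u) dx` on the unit sphere, where `θ = ε_i^r` and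
`ρ = R ε_i` (`IsShellWave.l2Inner_mode`). By Bessel's inequality on the sphere, the contribution of
the shell is at most `i²` times a constant times the supremum of the square of this function. Two
bounds on the supremum are used. Integration by parts in the direction of `k` shows that `G` decays,
and the supremum is `O(ρ / (1 + ρ / 2)²)`; this makes the series over the shells converge, and each
of its terms vanish as `R → ∞`. Integration by parts in the frequency gives the bound
`O(1 / θ) = O(ε_i^{-r})`, uniformly in `R`. For `r < 0` it decreases geometrically in `i`, and
dominated convergence leaves only the vacuum fluctuations as `R → ∞`
(`IsShellWave.tendsto_fluctuation`).

For `r ≥ 0`, on the other hand, `θ = ε_i^r` has a limit in `[0, 1]`. If the real part of `G` does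
not vanish identically, neither does the real part of the function on the sphere for this limit and
a suitable `ρ`: on a ray, `G` is the Fourier transform of a compactly supported real measure, whose
even moments are recovered from the averages because `cos(x θ) > 0` for `x ≤ 1`
(`exists_re_average_oscillatory_ne_zero`). By the completeness of the spherical harmonics
(`exists_integral_sphericalHarmonic_ne_zero`) some coefficient has a nonzero real part. At the scales
`R_n = ρ / ε_{n+1}` the coefficient of this angular momentum in the shell `n + 1` tends to the same
limit, while its squared real part is amplified by `(n + 1)²`. The other modes cannot compensate for
this, because the fluctuations which they suppress are part of the vacuum contribution
(`sq_mul_re_sq_le`). Hence the fluctuations diverge (`exists_tendsto_stateSq_top`).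
-/

open Filter Topology MeasureTheory
open scoped ENNReal

noncomputable section

namespace InfraredPhase

/-! ### Inner products and Bessel's inequality in `L²` -/

section L2

variable {α : Type*} [MeasurableSpace α] {μ : Measure α}

/-- The `L²` inner product `⟨F, G⟩ = ∫ conj F G`, antilinear in the first argument. -/
def l2Inner (μ : Measure α) (F G : α → ℂ) : ℂ := ∫ x, (starRingEnd ℂ) (F x) * G x ∂μ

/-- The square of the `L²` norm, as a real number. -/
def l2Sq (μ : Measure α) (F : α → ℂ) : ℝ := ∫ x, ‖F x‖ ^ 2 ∂μ

lemma memLp_conj {F : α → ℂ} (hF : MemLp F 2 μ) :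
    MemLp (fun x => (starRingEnd ℂ) (F x)) 2 μ := hF.star

lemma integrable_conj_mul {F G : α → ℂ} (hF : MemLp F 2 μ) (hG : MemLp G 2 μ) :
    Integrable (fun x => (starRingEnd ℂ) (F x) * G x) μ :=
  (memLp_conj hF).integrable_mul hG

lemma integrable_norm_sq {F : α → ℂ} (hF : MemLp F 2 μ) :
    Integrable (fun x => ‖F x‖ ^ 2) μ := hF.norm.integrable_sq

lemma l2Inner_self (F : α → ℂ) : l2Inner μ F F = (l2Sq μ F : ℂ) := by
  rw [l2Inner, l2Sq, ← integral_complex_ofReal]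
  congr 1; ext x
  rw [mul_comm, Complex.mul_conj, Complex.normSq_eq_norm_sq]

lemma l2Inner_conj (F G : α → ℂ) : (starRingEnd ℂ) (l2Inner μ F G) = l2Inner μ G F := by
  rw [l2Inner, l2Inner, ← integral_conj]
  congr 1; ext x; simp [mul_comm]

lemma l2Sq_nonneg (F : α → ℂ) : 0 ≤ l2Sq μ F := integral_nonneg fun _ => by positivity

lemma l2Inner_add_right {F G H : α → ℂ} (hF : MemLp F 2 μ) (hG : MemLp G 2 μ)
    (hH : MemLp H 2 μ) :
    l2Inner μ F (fun x => G x + H x) = l2Inner μ F G + l2Inner μ F H := by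
  rw [l2Inner, l2Inner, l2Inner,
    ← integral_add (integrable_conj_mul hF hG) (integrable_conj_mul hF hH)]
  congr 1; ext x; ring

lemma l2Inner_const_mul_right (w : ℂ) (F G : α → ℂ) :
    l2Inner μ F (fun x => w * G x) = w * l2Inner μ F G := by
  rw [l2Inner, l2Inner, ← integral_const_mul]
  congr 1; ext x; ring

lemma l2Inner_sum_right {ι : Type*} (B : Finset ι) {F : α → ℂ} {G : ι → α → ℂ}
    (hF : MemLp F 2 μ) (hG : ∀ b, MemLp (G b) 2 μ) :
    l2Inner μ F (fun x => ∑ b ∈ B, G b x) = ∑ b ∈ B, l2Inner μ F (G b) := by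
  simp only [l2Inner, Finset.mul_sum]
  exact integral_finsetSum _ fun b _ => integrable_conj_mul hF (hG b)

lemma l2Sq_const_mul (w : ℂ) (F : α → ℂ) :
    l2Sq μ (fun x => w * F x) = ‖w‖ ^ 2 * l2Sq μ F := by
  rw [l2Sq, l2Sq, ← integral_const_mul]
  congr 1; ext x; rw [norm_mul]; ring

lemma l2Sq_add_mul {F G : α → ℂ} (hF : MemLp F 2 μ) (hG : MemLp G 2 μ) (hG1 : l2Sq μ G = 1)
    (w : ℂ) : l2Sq μ (fun x => F x + w * G x) =
      l2Sq μ F + (‖l2Inner μ G F + w‖ ^ 2 - ‖l2Inner μ G F‖ ^ 2) := by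
  have key : ∀ x, ‖F x + w * G x‖ ^ 2 = ‖F x‖ ^ 2 + 2 * (w.re *
      ((starRingEnd ℂ) (G x) * F x).re + w.im * ((starRingEnd ℂ) (G x) * F x).im)
        + ‖w‖ ^ 2 * ‖G x‖ ^ 2 := by
    intro x
    simp only [← Complex.normSq_eq_norm_sq, Complex.normSq_apply, Complex.add_re, Complex.add_im,
      Complex.mul_re, Complex.mul_im, Complex.conj_re, Complex.conj_im]
    ring
  have hi := integrable_conj_mul hG hF
  have h1 : ∫ x, ((starRingEnd ℂ) (G x) * F x).re ∂μ = (l2Inner μ G F).re := integral_re hi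
  have h2 : ∫ x, ((starRingEnd ℂ) (G x) * F x).im ∂μ = (l2Inner μ G F).im := integral_im hi
  have i1 : Integrable (fun x => ((starRingEnd ℂ) (G x) * F x).re) μ := hi.re
  have i2 : Integrable (fun x => ((starRingEnd ℂ) (G x) * F x).im) μ := hi.im
  rw [l2Sq, integral_congr_ae (ae_of_all _ key), integral_add, integral_add, integral_const_mul,
    integral_add, integral_const_mul, integral_const_mul, integral_const_mul, h1, h2]
  · change l2Sq μ F + _ + _ * l2Sq μ G = _
    rw [hG1]
    simp only [← Complex.normSq_eq_norm_sq, Complex.normSq_apply, Complex.add_re, Complex.add_im]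
    ring
  · exact i1.const_mul _
  · exact i2.const_mul _
  · exact integrable_norm_sq hF
  · exact ((i1.const_mul _).add (i2.const_mul _)).const_mul 2
  · exact (integrable_norm_sq hF).add (((i1.const_mul _).add (i2.const_mul _)).const_mul 2)
  · exact (integrable_norm_sq hG).const_mul _

/-- Orthonormality in `L²(μ)` of the family `ζ` on the finite index set `B`; square integrability
is required for all indices. -/
structure IsOrthonormal {ι : Type*} [DecidableEq ι] (μ : Measure α) (B : Finset ι)
    (ζ : ι → α → ℂ) : Prop where
  memLp : ∀ b, MemLp (ζ b) 2 μ
  inner_eq : ∀ a ∈ B, ∀ b ∈ B, l2Inner μ (ζ a) (ζ b) = if a = b then 1 else 0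

variable {ι : Type*} [DecidableEq ι] {B : Finset ι} {ζ : ι → α → ℂ}

lemma IsOrthonormal.l2Sq_eq_one (h : IsOrthonormal μ B ζ) {b : ι} (hb : b ∈ B) :
    l2Sq μ (ζ b) = 1 := by
  have := h.inner_eq b hb b hb
  rw [l2Inner_self, if_pos rfl] at this
  exact_mod_cast this

lemma memLp_sum_mul {ι : Type*} {B : Finset ι} {ζ : ι → α → ℂ} (h : ∀ b, MemLp (ζ b) 2 μ)
    (w : ι → ℂ) : MemLp (fun x => ∑ b ∈ B, w b * ζ b x) 2 μ :=
  memLp_finsetSum _ fun b _ => (h b).const_mul _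

lemma IsOrthonormal.inner_sum (h : IsOrthonormal μ B ζ) (w : ι → ℂ) {a : ι} (ha : a ∈ B) :
    l2Inner μ (ζ a) (fun x => ∑ b ∈ B, w b * ζ b x) = w a := by
  rw [l2Inner_sum_right B (h.memLp a) fun b => (h.memLp b).const_mul (w b)]
  simp only [l2Inner_const_mul_right]
  rw [Finset.sum_eq_single a]
  · rw [h.inner_eq a ha a ha]; simp
  · intro b hb hba; rw [h.inner_eq a ha b hb, if_neg (Ne.symm hba), mul_zero]
  · exact fun h => (h ha).elim

/-- Adding a combination of orthonormal functions to `F` changes the coefficients of `F` with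
respect to them and nothing else. -/
lemma IsOrthonormal.l2Sq_add_sum (h : IsOrthonormal μ B ζ) {F : α → ℂ} (hF : MemLp F 2 μ)
    (w : ι → ℂ) :
    l2Sq μ (fun x => F x + ∑ b ∈ B, w b * ζ b x) =
      l2Sq μ F + ∑ b ∈ B, (‖l2Inner μ (ζ b) F + w b‖ ^ 2 - ‖l2Inner μ (ζ b) F‖ ^ 2) := by
  induction B using Finset.induction_on with
  | empty => simp
  | insert c B hc ih =>
    have hB : IsOrthonormal μ B ζ := ⟨h.memLp, fun a ha b hb =>
      h.inner_eq a (Finset.mem_insert_of_mem ha) b (Finset.mem_insert_of_mem hb)⟩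
    have e : (fun x => F x + ∑ b ∈ insert c B, w b * ζ b x) =
        fun x => (F x + ∑ b ∈ B, w b * ζ b x) + w c * ζ c x := by
      ext x; rw [Finset.sum_insert hc]; ring
    have h0 : l2Inner μ (ζ c) (fun x => ∑ b ∈ B, w b * ζ b x) = 0 := by
      rw [l2Inner_sum_right B (h.memLp c) fun b => (h.memLp b).const_mul (w b)]
      refine Finset.sum_eq_zero fun b hb => ?_
      rw [l2Inner_const_mul_right, h.inner_eq c (Finset.mem_insert_self c B) b
        (Finset.mem_insert_of_mem hb), if_neg (by rintro rfl; exact hc hb), mul_zero]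
    have hs := memLp_sum_mul (B := B) h.memLp w
    have hFs : MemLp (fun x => F x + ∑ b ∈ B, w b * ζ b x) 2 μ := hF.add hs
    rw [e, l2Sq_add_mul hFs (h.memLp c) (h.l2Sq_eq_one (Finset.mem_insert_self c B)),
      l2Inner_add_right (h.memLp c) hF hs, h0, add_zero, Finset.sum_insert hc]
    rw [ih hB]; ring

lemma IsOrthonormal.bessel (h : IsOrthonormal μ B ζ) {F : α → ℂ} (hF : MemLp F 2 μ) :
    ∑ b ∈ B, ‖l2Inner μ (ζ b) F‖ ^ 2 ≤ l2Sq μ F := by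
  have := h.l2Sq_add_sum hF (fun b => -l2Inner μ (ζ b) F)
  have h0 := l2Sq_nonneg (μ := μ) (fun x => F x + ∑ b ∈ B, -l2Inner μ (ζ b) F * ζ b x)
  rw [this] at h0
  simp at h0
  linarith

lemma lintegral_enorm_sq {F : α → ℂ} (hF : MemLp F 2 μ) :
    ∫⁻ x, ‖F x‖ₑ ^ 2 ∂μ = ENNReal.ofReal (l2Sq μ F) := by
  rw [l2Sq, ofReal_integral_eq_lintegral_ofReal (integrable_norm_sq hF)
    (ae_of_all _ fun _ => by positivity)]
  congr 1; ext x
  rw [ENNReal.ofReal_pow (norm_nonneg _), ofReal_norm]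

end L2

/-! ### Creation and annihilation operators -/

section Fock

/-- The vectors on which the calculus of creation and annihilation operators is carried out:
every component is square integrable, is symmetric in the sense that it does not matter where a
momentum is inserted, and is square integrable in one momentum for *all* (not just almost all)
values of the other ones. The last condition makes the canonical commutation relations hold
pointwise. -/
structure IsRegular (Φ : FockVector) : Prop where
  symm : ∀ (N : ℕ) (j : Fin (N + 1)) (q : Momentum) (k : Fin N → Momentum),
    Φ (N + 1) (j.insertNth q k : Fin (N + 1) → Momentum) = Φ (N + 1) (Fin.cons q k)
  memLp : ∀ N, MemLp (Φ N) 2 volume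
  slice : ∀ (N : ℕ) (k : Fin N → Momentum),
    MemLp (fun q : Momentum => Φ (N + 1) (Fin.cons q k : Fin (N + 1) → Momentum)) 2 volume

lemma isRegular_vacuum : IsRegular vacuum where
  symm N j q k := by simp [vacuum]
  memLp N := by
    rcases N with _ | N
    · exact memLp_const (1 : ℂ)
    · exact MemLp.zero
  slice _ _ := MemLp.zero

lemma IsRegular.zero : IsRegular 0 where
  symm _ _ _ _ := rfl
  memLp _ := MemLp.zero
  slice _ _ := MemLp.zero

lemma IsRegular.add {Φ Ψ : FockVector} (hΦ : IsRegular Φ) (hΨ : IsRegular Ψ) :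
    IsRegular (Φ + Ψ) where
  symm N j q k := by simp [hΦ.symm, hΨ.symm]
  memLp N := (hΦ.memLp N).add (hΨ.memLp N)
  slice N k := (hΦ.slice N k).add (hΨ.slice N k)

lemma IsRegular.smul {Φ : FockVector} (hΦ : IsRegular Φ) (c : ℂ) : IsRegular (c • Φ) where
  symm N j q k := by simp [hΦ.symm]
  memLp N := (hΦ.memLp N).const_smul c
  slice N k := (hΦ.slice N k).const_smul c

lemma IsRegular.sum {ι : Type*} (B : Finset ι) {Φ : ι → FockVector}
    (h : ∀ b ∈ B, IsRegular (Φ b)) : IsRegular (∑ b ∈ B, Φ b) :=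
  Finset.sum_induction _ _ (fun _ _ => IsRegular.add) IsRegular.zero h

/-- A vector is regular if each of its components is a component of a regular vector. -/
lemma IsRegular.of_components {Φ : FockVector} (h : ∀ N, ∃ Ψ, IsRegular Ψ ∧ Φ N = Ψ N) :
    IsRegular Φ where
  symm N j q k := by obtain ⟨Ψ, hΨ, e⟩ := h (N + 1); rw [e]; exact hΨ.symm N j q k
  memLp N := by obtain ⟨Ψ, hΨ, e⟩ := h N; rw [e]; exact hΨ.memLp N
  slice N k := by obtain ⟨Ψ, hΨ, e⟩ := h (N + 1); rw [e]; exact hΨ.slice N k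

lemma removeNth_succAbove_insertNth {N : ℕ} (j : Fin (N + 2)) (i : Fin (N + 1)) (q : Momentum)
    (k : Fin (N + 1) → Momentum) :
    (j.succAbove i).removeNth (j.insertNth q k : Fin (N + 2) → Momentum) =
      ((i.predAbove j).insertNth q (i.removeNth k) : Fin (N + 1) → Momentum) := by
  refine (Fin.eq_insertNth_iff (p := i.predAbove j)).2 ⟨?_, ?_⟩
  · rw [Fin.removeNth_apply, Fin.succAbove_succAbove_predAbove, Fin.insertNth_apply_same]
  · have := Fin.removeNth_removeNth_eq_swap (j.insertNth q k : Fin (N + 2) → Momentum) i j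
    rw [Fin.removeNth_insertNth] at this
    exact this.symm

/-- The creation operator singles out an inserted momentum. -/
lemma creation_insertNth {Φ : FockVector} (hΦ : IsRegular Φ) (F : Momentum → ℂ) (N : ℕ)
    (j : Fin (N + 2)) (q : Momentum) (k : Fin (N + 1) → Momentum) :
    creation F Φ (N + 2) (j.insertNth q k : Fin (N + 2) → Momentum) =
      ((1 / Real.sqrt ((N + 1 : ℕ) + 1 : ℝ) : ℝ) : ℂ) * (F q * Φ (N + 1) k +
        ∑ i : Fin (N + 1), F (k i) * Φ (N + 1) (Fin.cons q (i.removeNth k))) := by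
  simp only [creation]
  rw [Fin.sum_univ_succAbove _ j]
  simp only [Fin.insertNth_apply_same, Fin.removeNth_insertNth, Fin.insertNth_apply_succAbove,
    removeNth_succAbove_insertNth, hΦ.symm]

lemma creation_cons {Φ : FockVector} (hΦ : IsRegular Φ) (F : Momentum → ℂ) (N : ℕ)
    (q : Momentum) (k : Fin (N + 1) → Momentum) :
    creation F Φ (N + 2) (Fin.cons q k : Fin (N + 2) → Momentum) =
      ((1 / Real.sqrt ((N + 1 : ℕ) + 1 : ℝ) : ℝ) : ℂ) * (F q * Φ (N + 1) k +
        ∑ i : Fin (N + 1), F (k i) * Φ (N + 1) (Fin.cons q (i.removeNth k))) := by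
  rw [← creation_insertNth hΦ F N 0, Fin.insertNth_zero']

lemma creation_one (F : Momentum → ℂ) (Φ : FockVector) (k : Fin (0 + 1) → Momentum) :
    creation F Φ (0 + 1) k = F (k 0) * Φ 0 Fin.elim0 := by
  have h : ∑ j : Fin (0 + 1), F (k j) * Φ 0 (j.removeNth k) = F (k 0) * Φ 0 Fin.elim0 := by
    rw [Fin.sum_univ_succ, Subsingleton.elim (Fin.removeNth (0 : Fin (0 + 1)) k) Fin.elim0]
    simp
  simp only [creation, h]
  simp

lemma measurePreserving_removeNth {N : ℕ} (j : Fin (N + 1)) :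
    MeasurePreserving (fun k : Fin (N + 1) → Momentum => (k j, j.removeNth k)) volume volume :=
  volume_preserving_piFinSuccAbove (fun _ : Fin (N + 1) => Momentum) j

lemma measurePreserving_insertNth {N : ℕ} (j : Fin (N + 1)) :
    MeasurePreserving (fun p : Momentum × (Fin N → Momentum) =>
      (j.insertNth p.1 p.2 : Fin (N + 1) → Momentum)) volume volume :=
  (volume_preserving_piFinSuccAbove (fun _ : Fin (N + 1) => Momentum) j).symm

/-- Integration over `N + 1` momenta as iterated integration. -/
lemma integral_insertNth {N : ℕ} (j : Fin (N + 1)) (g : (Fin (N + 1) → Momentum) → ℂ) :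
    ∫ k, g k = ∫ p : Momentum × (Fin N → Momentum), g (j.insertNth p.1 p.2) :=
  ((volume_preserving_piFinSuccAbove (fun _ : Fin (N + 1) => Momentum) j).symm.integral_comp'
    (g := g)).symm

lemma memLp_mul_prod {α β : Type*} [MeasurableSpace α] [MeasurableSpace β] {μ : Measure α}
    {ν : Measure β} [SigmaFinite μ] [SigmaFinite ν] {F : α → ℂ} {G : β → ℂ}
    (hF : MemLp F 2 μ) (hG : MemLp G 2 ν) :
    MemLp (fun p : α × β => F p.1 * G p.2) 2 (μ.prod ν) := by
  rw [memLp_two_iff_integrable_sq_norm]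
  · simp only [norm_mul, mul_pow]
    exact (integrable_norm_sq hF).mul_prod (integrable_norm_sq hG)
  · exact hF.1.comp_fst.mul hG.1.comp_snd

lemma memLp_mul_removeNth {N : ℕ} {F : Momentum → ℂ} (hF : MemLp F 2 volume)
    {Φ : (Fin N → Momentum) → ℂ} (hΦ : MemLp Φ 2 volume) (j : Fin (N + 1)) :
    MemLp (fun k : Fin (N + 1) → Momentum => F (k j) * Φ (j.removeNth k)) 2 volume :=
  (memLp_mul_prod hF hΦ).comp_measurePreserving (measurePreserving_removeNth j)

lemma IsRegular.creation {Φ : FockVector} (hΦ : IsRegular Φ) {F : Momentum → ℂ}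
    (hF : MemLp F 2 volume) : IsRegular (creation F Φ) where
  symm N j q k := by
    rcases N with _ | N
    · have hj : j = 0 := Fin.fin_one_eq_zero j
      rw [hj, Fin.insertNth_zero']
    · rw [creation_insertNth hΦ, creation_cons hΦ]
  memLp N := by
    rcases N with _ | N
    · exact MemLp.zero
    · exact (memLp_finsetSum _ fun j _ => memLp_mul_removeNth hF (hΦ.memLp N) j).const_mul _
  slice N k := by
    rcases N with _ | N
    · have e : (fun q : Momentum => InfraredPhase.creation F Φ (0 + 1)
          (Fin.cons q k : Fin (0 + 1) → Momentum)) = fun q => F q * Φ 0 Fin.elim0 := by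
        funext q; rw [creation_one, Fin.cons_zero]
      rw [e]
      exact hF.mul_const _
    · simp only [creation_cons hΦ]
      exact ((hF.mul_const _).add (memLp_finsetSum _ fun i _ =>
        (hΦ.slice N _).const_mul _)).const_mul _

lemma creation_add (F : Momentum → ℂ) (Φ Ψ : FockVector) :
    creation F (Φ + Ψ) = creation F Φ + creation F Ψ := by
  funext N k
  rcases N with _ | N
  · simp [creation]
  · simp only [creation, Pi.add_apply, mul_add, Finset.sum_add_distrib]

lemma creation_smul (F : Momentum → ℂ) (c : ℂ) (Φ : FockVector) :
    creation F (c • Φ) = c • creation F Φ := by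
  funext N k
  rcases N with _ | N
  · simp [creation]
  · simp only [creation, Pi.smul_apply, smul_eq_mul, Finset.mul_sum]
    exact Finset.sum_congr rfl fun j _ => by ring

/-- The creation operator as a linear map. -/
def creationₗ (F : Momentum → ℂ) : FockVector →ₗ[ℂ] FockVector where
  toFun := creation F
  map_add' := creation_add F
  map_smul' := creation_smul F

lemma creation_sum {ι : Type*} (B : Finset ι) (F : Momentum → ℂ) (Φ : ι → FockVector) :
    creation F (∑ b ∈ B, Φ b) = ∑ b ∈ B, creation F (Φ b) :=
  map_sum (creationₗ F) Φ B

lemma creation_fun_add (F G : Momentum → ℂ) (Φ : FockVector) :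
    creation (fun k => F k + G k) Φ = creation F Φ + creation G Φ := by
  funext N k
  rcases N with _ | N
  · simp [creation]
  · simp only [creation, Pi.add_apply, add_mul, mul_add, Finset.sum_add_distrib]

lemma creation_fun_sum {ι : Type*} (B : Finset ι) (w : ι → ℂ) (F : ι → Momentum → ℂ)
    (Φ : FockVector) :
    creation (fun k => ∑ b ∈ B, w b * F b k) Φ = ∑ b ∈ B, w b • creation (F b) Φ := by
  funext N k
  rw [Finset.sum_apply, Finset.sum_apply]
  rcases N with _ | N
  · simp [creation]
  · simp only [creation, Pi.smul_apply, smul_eq_mul, Finset.sum_mul, Finset.mul_sum]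
    rw [Finset.sum_comm]
    exact Finset.sum_congr rfl fun b _ => Finset.sum_congr rfl fun j _ => by ring

lemma creation_comm (F G : Momentum → ℂ) (Φ : FockVector) :
    creation F (creation G Φ) = creation G (creation F Φ) := by
  funext N k
  rcases N with _ | _ | N
  · rfl
  · simp [creation]
  · simp only [creation, Finset.mul_sum]
    rw [← Finset.sum_product', ← Finset.sum_product']
    refine Finset.sum_nbij' (fun p => (p.1.succAbove p.2, p.2.predAbove p.1))
      (fun p => (p.1.succAbove p.2, p.2.predAbove p.1)) (by simp) (by simp) ?_ ?_ ?_
    · rintro ⟨i, j⟩ -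
      simp [Fin.succAbove_succAbove_predAbove, Fin.predAbove_predAbove_succAbove]
    · rintro ⟨i, j⟩ -
      simp [Fin.succAbove_succAbove_predAbove, Fin.predAbove_predAbove_succAbove]
    · rintro ⟨i, j⟩ -
      dsimp only
      rw [← Fin.removeNth_removeNth_eq_swap, Fin.removeNth_apply, Fin.removeNth_apply,
        Fin.succAbove_succAbove_predAbove]
      ring

lemma annihilation_smul (F : Momentum → ℂ) (c : ℂ) (Φ : FockVector) :
    annihilation F (c • Φ) = c • annihilation F Φ := by
  funext N k
  simp only [annihilation, Pi.smul_apply, smul_eq_mul]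
  rw [mul_left_comm, ← integral_const_mul c]
  congr 1
  refine integral_congr_ae (ae_of_all _ fun q => ?_)
  simp only; ring

lemma annihilation_add {Φ Ψ : FockVector} (hΦ : IsRegular Φ) (hΨ : IsRegular Ψ)
    {F : Momentum → ℂ} (hF : MemLp F 2 volume) :
    annihilation F (Φ + Ψ) = annihilation F Φ + annihilation F Ψ := by
  funext N k
  simp only [annihilation, Pi.add_apply, mul_add]
  rw [integral_add (integrable_conj_mul hF (hΦ.slice N k))
    (integrable_conj_mul hF (hΨ.slice N k)), mul_add]

lemma annihilation_zero (F : Momentum → ℂ) : annihilation F 0 = 0 := by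
  funext N k
  simp [annihilation]

lemma annihilation_sum {ι : Type*} (B : Finset ι) {Φ : ι → FockVector}
    (hΦ : ∀ b, IsRegular (Φ b)) {F : Momentum → ℂ} (hF : MemLp F 2 volume) :
    annihilation F (∑ b ∈ B, Φ b) = ∑ b ∈ B, annihilation F (Φ b) := by
  classical
  induction B using Finset.induction_on with
  | empty => simp [annihilation_zero]
  | insert b B hb ih =>
    rw [Finset.sum_insert hb, Finset.sum_insert hb,
      annihilation_add (hΦ b) (IsRegular.sum B fun b _ => hΦ b) hF, ih]

lemma annihilation_vacuum (F : Momentum → ℂ) : annihilation F vacuum = 0 := by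
  funext N k
  simp [annihilation, vacuum]

/-- The canonical commutation relations. -/
lemma annihilation_creation {Φ : FockVector} (hΦ : IsRegular Φ) {F G : Momentum → ℂ}
    (hF : MemLp F 2 volume) (hG : MemLp G 2 volume) :
    annihilation F (creation G Φ) =
      l2Inner volume F G • Φ + creation G (annihilation F Φ) := by
  funext N k
  rcases N with _ | N
  · have e : ∀ q : Momentum, creation G Φ (0 + 1) (Fin.cons q k : Fin (0 + 1) → Momentum) =
        G q * Φ 0 Fin.elim0 := fun q => by rw [creation_one, Fin.cons_zero]
    have h0 : creation G (annihilation F Φ) 0 k = 0 := rfl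
    rw [Pi.add_apply, Pi.add_apply, h0, Pi.smul_apply, Pi.smul_apply, annihilation]
    simp only [e]
    rw [Nat.cast_zero, zero_add, Real.sqrt_one, Complex.ofReal_one, one_mul, add_zero,
      smul_eq_mul, l2Inner, ← integral_mul_const, Subsingleton.elim k Fin.elim0]
    refine integral_congr_ae (ae_of_all _ fun q => ?_)
    simp only; ring
  · have hi := integrable_conj_mul hF hG
    have hs : ∀ i : Fin (N + 1), Integrable (fun q : Momentum => (starRingEnd ℂ) (F q) *
        Φ (N + 1) (Fin.cons q (i.removeNth k) : Fin (N + 1) → Momentum)) volume :=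
      fun i => integrable_conj_mul hF (hΦ.slice N _)
    have e : ∀ q : Momentum, (starRingEnd ℂ) (F q) *
        creation G Φ (N + 1 + 1) (Fin.cons q k : Fin (N + 2) → Momentum) =
        ((1 / Real.sqrt ((N + 1 : ℕ) + 1 : ℝ) : ℝ) : ℂ) *
        ((starRingEnd ℂ) (F q) * G q * Φ (N + 1) k + ∑ i : Fin (N + 1), G (k i) *
          ((starRingEnd ℂ) (F q) *
            Φ (N + 1) (Fin.cons q (i.removeNth k) : Fin (N + 1) → Momentum))) := by
      intro q
      rw [creation_cons hΦ, mul_left_comm, mul_add, Finset.mul_sum]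
      congr 2
      · ring
      · exact Finset.sum_congr rfl fun i _ => by ring
    have hsq : ∀ x : ℝ, 0 < x → ((Real.sqrt x : ℝ) : ℂ) * ((1 / Real.sqrt x : ℝ) : ℂ) = 1 := by
      intro x hx
      rw [← Complex.ofReal_mul, mul_one_div_cancel (Real.sqrt_pos.2 hx).ne', Complex.ofReal_one]
    simp only [Pi.add_apply, Pi.smul_apply, smul_eq_mul]
    rw [annihilation]
    simp only [e]
    rw [integral_const_mul, ← mul_assoc, hsq _ (by positivity), one_mul, integral_add
      (hi.mul_const _) (integrable_finsetSum _ fun i _ => (hs i).const_mul _),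
      integral_mul_const, integral_finsetSum _ fun i _ => (hs i).const_mul _]
    simp only [integral_const_mul, creation, annihilation]
    congr 1
    rw [Finset.mul_sum]
    refine Finset.sum_congr rfl fun i _ => ?_
    have := hsq (N + 1 : ℝ) (by positivity)
    linear_combination -(G (k i) * ∫ q : Momentum, (starRingEnd ℂ) (F q) *
            Φ (N + 1) (Fin.cons q (i.removeNth k) : Fin (N + 1) → Momentum)) * this

/-- The creation operator is adjoint to the annihilation operator. -/
lemma l2Inner_creation_left {Φ Ψ : FockVector} (hΦ : IsRegular Φ) (hΨ : IsRegular Ψ)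
    {F : Momentum → ℂ} (hF : MemLp F 2 volume) (N : ℕ) :
    l2Inner volume (creation F Φ (N + 1)) (Ψ (N + 1)) =
      l2Inner volume (Φ N) (annihilation F Ψ N) := by
  have hterm : ∀ j : Fin (N + 1), ∫ k : Fin (N + 1) → Momentum,
      (starRingEnd ℂ) (F (k j) * Φ N (j.removeNth k)) * Ψ (N + 1) k =
      ∫ k : Fin N → Momentum, (starRingEnd ℂ) (Φ N k) *
        ∫ q : Momentum, (starRingEnd ℂ) (F q) * Ψ (N + 1) (Fin.cons q k : Fin (N + 1) → Momentum) := by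
    intro j
    have hint : Integrable (fun p : Momentum × (Fin N → Momentum) =>
        (starRingEnd ℂ) (F p.1 * Φ N p.2) * Ψ (N + 1) (Fin.cons p.1 p.2)) volume := by
      have h1 := integrable_conj_mul (memLp_mul_removeNth hF (hΦ.memLp N) 0) (hΨ.memLp (N + 1))
      have := (measurePreserving_insertNth (N := N) 0).integrable_comp_of_integrable h1
      simpa [Function.comp_def] using this
    rw [integral_insertNth j]
    simp only [Fin.insertNth_apply_same, Fin.removeNth_insertNth, hΨ.symm]
    rw [Measure.volume_eq_prod] at hint ⊢
    rw [integral_prod_symm _ hint]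
    congr 1; ext k
    rw [← integral_const_mul]
    congr 1; ext q; simp only [map_mul]; ring
  have hsq : ((1 / Real.sqrt (N + 1 : ℝ) : ℝ) : ℂ) * ((N + 1 : ℕ) : ℂ)
      = ((Real.sqrt (N + 1 : ℝ) : ℝ) : ℂ) := by
    rw [← Complex.ofReal_natCast, ← Complex.ofReal_mul]
    congr 1
    have h : Real.sqrt (N + 1 : ℝ) ≠ 0 := (Real.sqrt_pos.2 (by positivity)).ne'
    field_simp
    rw [Real.sq_sqrt (by positivity)]; push_cast; rfl
  have e : ∀ k : Fin (N + 1) → Momentum,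
      (starRingEnd ℂ) (creation F Φ (N + 1) k) * Ψ (N + 1) k =
      ((1 / Real.sqrt (N + 1 : ℝ) : ℝ) : ℂ) * ∑ j : Fin (N + 1),
        (starRingEnd ℂ) (F (k j) * Φ N (j.removeNth k)) * Ψ (N + 1) k := by
    intro k
    simp only [creation, map_mul, Complex.conj_ofReal, map_sum, Finset.sum_mul, mul_assoc]
  simp only [l2Inner, e]
  rw [integral_const_mul, integral_finsetSum _ fun j _ => integrable_conj_mul
    (memLp_mul_removeNth hF (hΦ.memLp N) j) (hΨ.memLp (N + 1))]
  simp only [hterm, Finset.sum_const, Finset.card_univ, Fintype.card_fin, nsmul_eq_mul]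
  rw [← mul_assoc, hsq, ← integral_const_mul]
  congr 1; ext k
  simp only [annihilation]; ring

end Fock

/-! ### Squeezed vectors -/

section Squeezed

variable {ι : Type*} {B : Finset ι} {ζ : ι → Momentum → ℂ} {t : ι → ℝ}

/-- The operator `∑_b (t_b / 2) a*(ζ_b)²`. -/
def pairOp (B : Finset ι) (ζ : ι → Momentum → ℂ) (t : ι → ℝ) (Φ : FockVector) : FockVector :=
  ∑ b ∈ B, ((t b / 2 : ℝ) : ℂ) • creation (ζ b) (creation (ζ b) Φ)

/-- The contribution `(∑_b (t_b / 2) a*(ζ_b)²)^j Ω / j!` to the squeezed vector. -/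
def pairTerm (B : Finset ι) (ζ : ι → Momentum → ℂ) (t : ι → ℝ) (j : ℕ) : FockVector :=
  ((1 / (Nat.factorial j : ℝ) : ℝ) : ℂ) • (pairOp B ζ t)^[j] vacuum

/-- The squeezed vector `exp(∑_b (t_b / 2) a*(ζ_b)²) Ω`. -/
def squeezedVector (B : Finset ι) (ζ : ι → Momentum → ℂ) (t : ι → ℝ) : FockVector := fun N k =>
  ∑' j : ℕ, ((1 / (Nat.factorial j : ℝ) : ℝ) : ℂ) * ((pairOp B ζ t)^[j] vacuum) N k

/-- The function `∑_b t_b ⟨F, ζ_b⟩ ζ_b`, whose creation operator acts on the squeezed vector as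
the annihilation operator of `F`. -/
def reflected (B : Finset ι) (ζ : ι → Momentum → ℂ) (t : ι → ℝ) (F : Momentum → ℂ) :
    Momentum → ℂ :=
  fun k => ∑ b ∈ B, ((t b : ℂ) * (starRingEnd ℂ) (l2Inner volume (ζ b) F)) * ζ b k

lemma memLp_reflected (hζ : ∀ b, MemLp (ζ b) 2 volume) (F : Momentum → ℂ) :
    MemLp (reflected B ζ t F) 2 volume := memLp_sum_mul hζ _

lemma IsRegular.pairOp (hζ : ∀ b, MemLp (ζ b) 2 volume) {Φ : FockVector} (hΦ : IsRegular Φ) :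
    IsRegular (pairOp B ζ t Φ) :=
  IsRegular.sum B fun b _ => ((hΦ.creation (hζ b)).creation (hζ b)).smul _

lemma isRegular_iterate_pairOp (hζ : ∀ b, MemLp (ζ b) 2 volume) (j : ℕ) :
    IsRegular ((pairOp B ζ t)^[j] vacuum) := by
  induction j with
  | zero => exact isRegular_vacuum
  | succ j ih => rw [Function.iterate_succ_apply']; exact ih.pairOp hζ

lemma isRegular_pairTerm (hζ : ∀ b, MemLp (ζ b) 2 volume) (j : ℕ) :
    IsRegular (pairTerm B ζ t j) := (isRegular_iterate_pairOp hζ j).smul _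

lemma pairOp_smul (c : ℂ) (Φ : FockVector) : pairOp B ζ t (c • Φ) = c • pairOp B ζ t Φ := by
  simp only [pairOp, creation_smul, Finset.smul_sum]
  exact Finset.sum_congr rfl fun b _ => smul_comm _ _ _

lemma creation_pairOp (F : Momentum → ℂ) (Φ : FockVector) :
    creation F (pairOp B ζ t Φ) = pairOp B ζ t (creation F Φ) := by
  simp only [pairOp, creation_sum, creation_smul]
  refine Finset.sum_congr rfl fun b _ => ?_
  rw [creation_comm F, creation_comm F]

lemma creation_congr {F : Momentum → ℂ} {Φ Ψ : FockVector} {N : ℕ} (h : Φ N = Ψ N) :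
    creation F Φ (N + 1) = creation F Ψ (N + 1) := by
  funext k; simp only [creation, h]

lemma pairOp_congr {Φ Ψ : FockVector} {N : ℕ} (h : Φ N = Ψ N) :
    pairOp B ζ t Φ (N + 2) = pairOp B ζ t Ψ (N + 2) := by
  simp only [pairOp, Finset.sum_apply, Pi.smul_apply]
  refine Finset.sum_congr rfl fun b _ => ?_
  rw [creation_congr (creation_congr h)]

lemma pairOp_zero : pairOp B ζ t 0 = 0 := by
  simpa using pairOp_smul (B := B) (ζ := ζ) (t := t) 0 0

lemma pairOp_apply_zero (Φ : FockVector) : pairOp B ζ t Φ 0 = 0 := by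
  simp only [pairOp, Finset.sum_apply, Pi.smul_apply]
  exact Finset.sum_eq_zero fun b _ => smul_zero _

lemma pairOp_apply_one (Φ : FockVector) : pairOp B ζ t Φ 1 = 0 := by
  simp only [pairOp, Finset.sum_apply, Pi.smul_apply]
  refine Finset.sum_eq_zero fun b _ => ?_
  funext k
  simp [creation]

/-- The `j`-th power of the pair creation operator creates `2 j` particles. -/
lemma iterate_pairOp_apply_of_ne (j : ℕ) : ∀ N, N ≠ 2 * j →
    ((pairOp B ζ t)^[j] vacuum) N = 0 := by
  induction j with
  | zero => intro N hN; funext k; simp [vacuum, show N ≠ 0 by simpa using hN]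
  | succ j ih =>
    intro N hN
    rw [Function.iterate_succ_apply']
    rcases N with _ | _ | N
    · exact pairOp_apply_zero _
    · exact pairOp_apply_one _
    · rw [pairOp_congr (Ψ := 0) (ih N (by omega)), pairOp_zero]; rfl

lemma pairTerm_apply_of_ne {j N : ℕ} (h : N ≠ 2 * j) : pairTerm B ζ t j N = 0 := by
  rw [pairTerm, Pi.smul_apply, iterate_pairOp_apply_of_ne j N h, smul_zero]

lemma squeezedVector_apply (N : ℕ) : squeezedVector B ζ t N = pairTerm B ζ t (N / 2) N := by
  funext k
  rw [squeezedVector, tsum_eq_single (N / 2)]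
  · rfl
  · intro j hj
    rw [iterate_pairOp_apply_of_ne j N (by omega)]
    simp

lemma isRegular_squeezedVector (hζ : ∀ b, MemLp (ζ b) 2 volume) :
    IsRegular (squeezedVector B ζ t) :=
  IsRegular.of_components fun N => ⟨_, isRegular_pairTerm hζ (N / 2), squeezedVector_apply N⟩

lemma pairTerm_succ (j : ℕ) : ((j + 1 : ℕ) : ℂ) • pairTerm B ζ t (j + 1) =
    pairOp B ζ t (pairTerm B ζ t j) := by
  rw [pairTerm, pairTerm, pairOp_smul, Function.iterate_succ_apply', smul_smul]
  congr 1
  rw [Nat.factorial_succ]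
  have h1 : ((j : ℂ) + 1) ≠ 0 := by exact_mod_cast Nat.succ_ne_zero j
  have h2 : (Nat.factorial j : ℂ) ≠ 0 := by exact_mod_cast Nat.factorial_ne_zero j
  push_cast
  field_simp

lemma pairTerm_zero : pairTerm B ζ t 0 = vacuum := by simp [pairTerm]

lemma annihilation_pairOp (hζ : ∀ b, MemLp (ζ b) 2 volume) {F : Momentum → ℂ}
    (hF : MemLp F 2 volume) {Φ : FockVector} (hΦ : IsRegular Φ) :
    annihilation F (pairOp B ζ t Φ) =
      creation (reflected B ζ t F) Φ + pairOp B ζ t (annihilation F Φ) := by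
  have hr : creation (reflected B ζ t F) Φ = ∑ b ∈ B,
      ((t b : ℂ) * (starRingEnd ℂ) (l2Inner volume (ζ b) F)) • creation (ζ b) Φ :=
    creation_fun_sum B _ ζ Φ
  rw [pairOp, annihilation_sum B (fun b => ((hΦ.creation (hζ b)).creation (hζ b)).smul _) hF,
    hr, pairOp, ← Finset.sum_add_distrib]
  refine Finset.sum_congr rfl fun b _ => ?_
  rw [annihilation_smul, annihilation_creation (hΦ.creation (hζ b)) hF (hζ b),
    annihilation_creation hΦ hF (hζ b), creation_add, creation_smul, l2Inner_conj]
  funext N k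
  simp only [Pi.smul_apply, Pi.add_apply, smul_eq_mul]
  push_cast; ring

lemma annihilation_pairTerm_succ (hζ : ∀ b, MemLp (ζ b) 2 volume) {F : Momentum → ℂ}
    (hF : MemLp F 2 volume) (j : ℕ) :
    annihilation F (pairTerm B ζ t (j + 1)) = creation (reflected B ζ t F) (pairTerm B ζ t j) := by
  have hne : ∀ i : ℕ, ((i + 1 : ℕ) : ℂ) ≠ 0 := fun i => by exact_mod_cast Nat.succ_ne_zero i
  have step : ∀ i : ℕ, ((i + 1 : ℕ) : ℂ) • annihilation F (pairTerm B ζ t (i + 1)) =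
      creation (reflected B ζ t F) (pairTerm B ζ t i) +
        pairOp B ζ t (annihilation F (pairTerm B ζ t i)) := by
    intro i
    rw [← annihilation_smul, pairTerm_succ, annihilation_pairOp hζ hF (isRegular_pairTerm hζ i)]
  induction j with
  | zero =>
    have := step 0
    rw [pairTerm_zero, annihilation_vacuum, pairOp_zero, add_zero] at this
    simpa [pairTerm_zero] using this
  | succ j ih =>
    have := step (j + 1)
    rw [ih, ← creation_pairOp, ← pairTerm_succ, creation_smul] at this
    have e : creation (reflected B ζ t F) (pairTerm B ζ t (j + 1)) +
        ((j + 1 : ℕ) : ℂ) • creation (reflected B ζ t F) (pairTerm B ζ t (j + 1)) =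
        ((j + 1 + 1 : ℕ) : ℂ) • creation (reflected B ζ t F) (pairTerm B ζ t (j + 1)) := by
      funext N k
      simp only [Pi.add_apply, Pi.smul_apply, smul_eq_mul]
      push_cast; ring
    rw [e] at this
    exact smul_right_injective _ (hne (j + 1)) this

/-- On the squeezed vector, annihilation operators act as creation operators. -/
lemma annihilation_squeezedVector (hζ : ∀ b, MemLp (ζ b) 2 volume) {F : Momentum → ℂ}
    (hF : MemLp F 2 volume) :
    annihilation F (squeezedVector B ζ t) =
      creation (reflected B ζ t F) (squeezedVector B ζ t) := by
  have hcongr : ∀ N, annihilation F (squeezedVector B ζ t) N =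
      annihilation F (pairTerm B ζ t ((N + 1) / 2)) N := by
    intro N; funext k; simp only [annihilation, squeezedVector_apply]
  funext N
  rcases N with _ | N
  · rw [hcongr]
    change annihilation F (pairTerm B ζ t 0) 0 = 0
    rw [pairTerm_zero, annihilation_vacuum]; rfl
  · rw [hcongr, show (N + 1 + 1) / 2 = N / 2 + 1 by omega, annihilation_pairTerm_succ hζ hF]
    exact creation_congr (squeezedVector_apply N).symm

/-- The number operator acts on the squeezed vector as `∑_b t_b a*(ζ_b)²`. -/
lemma natCast_smul_squeezedVector (N : ℕ) :
    (N : ℂ) • squeezedVector B ζ t N =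
      (∑ b ∈ B, (t b : ℂ) • creation (ζ b) (creation (ζ b) (squeezedVector B ζ t))) N := by
  have e : (∑ b ∈ B, (t b : ℂ) • creation (ζ b) (creation (ζ b) (squeezedVector B ζ t))) =
      (2 : ℂ) • pairOp B ζ t (squeezedVector B ζ t) := by
    rw [pairOp, Finset.smul_sum]
    refine Finset.sum_congr rfl fun b _ => ?_
    rw [smul_smul]; congr 1; push_cast; ring
  rw [e, Pi.smul_apply]
  rcases N with _ | _ | N
  · rw [pairOp_apply_zero]; simp
  · rw [pairOp_apply_one, squeezedVector_apply, pairTerm_apply_of_ne (by norm_num)]; simp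
  · rw [pairOp_congr (squeezedVector_apply N), ← pairTerm_succ, squeezedVector_apply,
      show (N + 1 + 1) / 2 = N / 2 + 1 by omega, Pi.smul_apply, smul_smul]
    rcases Nat.even_or_odd' N with ⟨m, rfl | rfl⟩
    · congr 1; rw [show 2 * m / 2 = m by omega]; push_cast; ring
    · rw [pairTerm_apply_of_ne (by omega)]; simp

end Squeezed

/-! ### Norms and expectations of squeezed vectors -/

section SqueezedNorm

variable {ι : Type*} {B : Finset ι} {ζ : ι → Momentum → ℂ} {t : ι → ℝ}

lemma normSq_eq_tsum {Φ : FockVector} (hΦ : IsRegular Φ) :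
    normSq Φ = ∑' N, ENNReal.ofReal (l2Sq volume (Φ N)) :=
  tsum_congr fun N => lintegral_enorm_sq (hΦ.memLp N)

lemma normSq_smul (c : ℂ) (Φ : FockVector) : normSq (c • Φ) = ‖c‖ₑ ^ 2 * normSq Φ := by
  rw [normSq, normSq, ← ENNReal.tsum_mul_left]
  refine tsum_congr fun N => ?_
  rw [← lintegral_const_mul' _ _ (by finiteness)]
  simp [mul_pow]

lemma l2Inner_creation_right {Φ Ψ : FockVector} (hΦ : IsRegular Φ) (hΨ : IsRegular Ψ)
    {F : Momentum → ℂ} (hF : MemLp F 2 volume) (N : ℕ) :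
    l2Inner volume (Ψ (N + 1)) (creation F Φ (N + 1)) =
      l2Inner volume (annihilation F Ψ N) (Φ N) := by
  rw [← l2Inner_conj, l2Inner_creation_left hΦ hΨ hF, l2Inner_conj]

lemma isRegular_annihilation_squeezedVector
    (hζ : ∀ b, MemLp (ζ b) 2 volume) {F : Momentum → ℂ} (hF : MemLp F 2 volume) :
    IsRegular (annihilation F (squeezedVector B ζ t)) := by
  rw [annihilation_squeezedVector hζ hF]
  exact (isRegular_squeezedVector hζ).creation (memLp_reflected hζ F)

lemma l2Sq_creation_squeezedVector_aux
    (hζ : ∀ b, MemLp (ζ b) 2 volume) {H : Momentum → ℂ} (hH : MemLp H 2 volume) (N : ℕ) :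
    (l2Sq volume (creation H (squeezedVector B ζ t) (N + 1)) : ℂ) =
      l2Sq volume H * l2Sq volume (squeezedVector B ζ t N) +
      l2Inner volume (squeezedVector B ζ t N)
        (creation H (annihilation H (squeezedVector B ζ t)) N) := by
  have hΨ := isRegular_squeezedVector (B := B) (t := t) hζ
  have hA := (isRegular_annihilation_squeezedVector (B := B) (t := t) hζ hH).creation hH
  rw [← l2Inner_self, l2Inner_creation_left hΨ (hΨ.creation hH) hH,
    annihilation_creation hΨ hH hH, ← l2Inner_self, ← l2Inner_self,
    ← l2Inner_const_mul_right]
  exact l2Inner_add_right (hΨ.memLp N) ((hΨ.memLp N).const_mul _) (hA.memLp N)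

lemma l2Sq_creation_squeezedVector_one
    (hζ : ∀ b, MemLp (ζ b) 2 volume) {H : Momentum → ℂ} (hH : MemLp H 2 volume) :
    l2Sq volume (creation H (squeezedVector B ζ t) 1) =
      l2Sq volume H * l2Sq volume (squeezedVector B ζ t 0) := by
  have := l2Sq_creation_squeezedVector_aux (B := B) (t := t) hζ hH 0
  have h0 : l2Inner volume (squeezedVector B ζ t 0)
      (creation H (annihilation H (squeezedVector B ζ t)) 0) = 0 := by
    simp [l2Inner, creation]
  rw [h0, add_zero] at this
  exact_mod_cast this

/-- The commutation relations in terms of norms: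
`‖a*(H) Ψ‖² = ‖H‖² ‖Ψ‖² + ‖a(H) Ψ‖²` in each component. -/
lemma l2Sq_creation_squeezedVector
    (hζ : ∀ b, MemLp (ζ b) 2 volume) {H : Momentum → ℂ} (hH : MemLp H 2 volume) (N : ℕ) :
    l2Sq volume (creation H (squeezedVector B ζ t) (N + 2)) =
      l2Sq volume H * l2Sq volume (squeezedVector B ζ t (N + 1)) +
      l2Sq volume (annihilation H (squeezedVector B ζ t) N) := by
  have := l2Sq_creation_squeezedVector_aux (B := B) (t := t) hζ hH (N + 1)
  rw [l2Inner_creation_right (isRegular_annihilation_squeezedVector hζ hH)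
    (isRegular_squeezedVector hζ) hH, l2Inner_self] at this
  exact_mod_cast this

lemma normSq_creation_squeezedVector
    (hζ : ∀ b, MemLp (ζ b) 2 volume) {H : Momentum → ℂ} (hH : MemLp H 2 volume) :
    normSq (creation H (squeezedVector B ζ t)) =
      ENNReal.ofReal (l2Sq volume H) * normSq (squeezedVector B ζ t) +
      normSq (creation (reflected B ζ t H) (squeezedVector B ζ t)) := by
  have hΨ := isRegular_squeezedVector (B := B) (t := t) hζ
  rw [normSq_eq_tsum (hΨ.creation hH), normSq_eq_tsum hΨ,
    normSq_eq_tsum (hΨ.creation (memLp_reflected hζ H)), ← annihilation_squeezedVector hζ hH,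
    ← ENNReal.tsum_mul_left, tsum_eq_zero_add' ENNReal.summable,
    tsum_eq_zero_add' ENNReal.summable,
    tsum_eq_zero_add' (f := fun N => ENNReal.ofReal (l2Sq volume H) * _) ENNReal.summable,
    add_assoc, ← ENNReal.tsum_add]
  have h0 : l2Sq volume (creation H (squeezedVector B ζ t) 0) = 0 := by simp [l2Sq, creation]
  rw [h0, ENNReal.ofReal_zero, zero_add, l2Sq_creation_squeezedVector_one hζ hH,
    ENNReal.ofReal_mul (l2Sq_nonneg _)]
  congr 1
  refine tsum_congr fun N => ?_
  rw [l2Sq_creation_squeezedVector hζ hH, ENNReal.ofReal_add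
    (mul_nonneg (l2Sq_nonneg _) (l2Sq_nonneg _)) (l2Sq_nonneg _),
    ENNReal.ofReal_mul (l2Sq_nonneg _)]

lemma l2Sq_mul_removeNth {N : ℕ} (F : Momentum → ℂ) (Φ : (Fin N → Momentum) → ℂ)
    (j : Fin (N + 1)) :
    ∫ k : Fin (N + 1) → Momentum, ‖F (k j) * Φ (j.removeNth k)‖ ^ 2 =
      l2Sq volume F * l2Sq volume Φ := by
  have := (volume_preserving_piFinSuccAbove (fun _ : Fin (N + 1) => Momentum) j).integral_comp'
    (g := fun p : Momentum × (Fin N → Momentum) => ‖F p.1‖ ^ 2 * ‖Φ p.2‖ ^ 2)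
  rw [Measure.volume_eq_prod, integral_prod_mul (fun q => ‖F q‖ ^ 2) (fun k => ‖Φ k‖ ^ 2)] at this
  rw [l2Sq, l2Sq, ← this]
  refine integral_congr_ae (ae_of_all _ fun k => ?_)
  simp only [norm_mul, mul_pow]; rfl

lemma l2Sq_creation_le {Φ : FockVector} (hΦ : IsRegular Φ) {F : Momentum → ℂ}
    (hF : MemLp F 2 volume) (N : ℕ) :
    l2Sq volume (creation F Φ (N + 1)) ≤ (N + 1) * (l2Sq volume F * l2Sq volume (Φ N)) := by
  have hi : ∀ j : Fin (N + 1), Integrable (fun k : Fin (N + 1) → Momentum =>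
      ‖F (k j) * Φ N (j.removeNth k)‖ ^ 2) volume :=
    fun j => integrable_norm_sq (memLp_mul_removeNth hF (hΦ.memLp N) j)
  calc l2Sq volume (creation F Φ (N + 1))
      ≤ ∫ k : Fin (N + 1) → Momentum, ∑ j, ‖F (k j) * Φ N (j.removeNth k)‖ ^ 2 := by
        refine integral_mono (integrable_norm_sq ((hΦ.creation hF).memLp (N + 1)))
          (integrable_finsetSum _ fun j _ => hi j) fun k => ?_
        have h1 : ‖∑ j, F (k j) * Φ N (j.removeNth k)‖ ^ 2 ≤
            (N + 1) * ∑ j, ‖F (k j) * Φ N (j.removeNth k)‖ ^ 2 := by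
          have h2 := sq_sum_le_card_mul_sum_sq (s := Finset.univ)
            (f := fun j : Fin (N + 1) => ‖F (k j) * Φ N (j.removeNth k)‖)
          rw [Finset.card_univ, Fintype.card_fin] at h2
          push_cast at h2
          exact (pow_le_pow_left₀ (norm_nonneg _) (norm_sum_le _ _) 2).trans h2
        simp only [creation, norm_mul, mul_pow, Complex.norm_real, Real.norm_eq_abs, sq_abs]
        simp only [norm_mul, mul_pow] at h1
        rw [div_pow, one_pow, Real.sq_sqrt (by positivity), div_mul_eq_mul_div, one_mul,
          div_le_iff₀ (by positivity)]
        linarith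
    _ = (N + 1) * (l2Sq volume F * l2Sq volume (Φ N)) := by
        rw [integral_finsetSum _ fun j _ => hi j]
        simp only [l2Sq_mul_removeNth]
        simp

lemma l2Sq_squeezedVector_zero : l2Sq volume (squeezedVector B ζ t 0) = 1 := by
  rw [squeezedVector_apply]
  change l2Sq volume (pairTerm B ζ t 0 0) = 1
  rw [pairTerm_zero]
  simp [l2Sq, vacuum, Measure.volume_pi_eq_dirac (Fin.elim0 : Fin 0 → Momentum)]

lemma l2Sq_squeezedVector_odd (j : ℕ) : l2Sq volume (squeezedVector B ζ t (2 * j + 1)) = 0 := by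
  rw [squeezedVector_apply, pairTerm_apply_of_ne (by omega)]
  simp [l2Sq]

lemma exists_sq_le_lt_one (ht : ∀ b ∈ B, t b ^ 2 < 1) :
    ∃ T : ℝ, 0 ≤ T ∧ T < 1 ∧ ∀ b ∈ B, t b ^ 2 ≤ T := by
  rcases B.eq_empty_or_nonempty with rfl | hB
  · exact ⟨0, le_rfl, one_pos, by simp⟩
  · obtain ⟨c, hc, hmax⟩ := B.exists_max_image (fun b => t b ^ 2) hB
    exact ⟨t c ^ 2, sq_nonneg _, ht c hc, hmax⟩

variable [DecidableEq ι]

lemma reflected_sum (h : IsOrthonormal volume B ζ) (w : ι → ℂ) :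
    reflected B ζ t (fun k => ∑ b ∈ B, w b * ζ b k) =
      fun k => ∑ b ∈ B, ((t b : ℂ) * (starRingEnd ℂ) (w b)) * ζ b k := by
  funext k
  exact Finset.sum_congr rfl fun b hb => by rw [h.inner_sum w hb]

lemma annihilation_mode (h : IsOrthonormal volume B ζ) {b : ι} (hb : b ∈ B) :
    annihilation (ζ b) (squeezedVector B ζ t) =
      (t b : ℂ) • creation (ζ b) (squeezedVector B ζ t) := by
  have hr : creation (reflected B ζ t (ζ b)) (squeezedVector B ζ t) = ∑ c ∈ B,
      ((t c : ℂ) * (starRingEnd ℂ) (l2Inner volume (ζ c) (ζ b))) •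
        creation (ζ c) (squeezedVector B ζ t) := creation_fun_sum B _ ζ _
  rw [annihilation_squeezedVector h.memLp (h.memLp b), hr, Finset.sum_eq_single b]
  · rw [h.inner_eq b hb b hb]; simp
  · intro c hc hcb; rw [h.inner_eq c hc b hb, if_neg hcb]; simp
  · exact fun hb' => (hb' hb).elim

lemma l2Sq_annihilation_mode (h : IsOrthonormal volume B ζ) {b : ι} (hb : b ∈ B) (N : ℕ) :
    l2Sq volume (annihilation (ζ b) (squeezedVector B ζ t) N) =
      t b ^ 2 * l2Sq volume (creation (ζ b) (squeezedVector B ζ t) N) := by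
  rw [annihilation_mode h hb]
  have := l2Sq_const_mul (μ := volume) (t b : ℂ) (creation (ζ b) (squeezedVector B ζ t) N)
  rw [Complex.norm_real, Real.norm_eq_abs, sq_abs] at this
  exact this

/-- The expectation of the number operator, expressed by the norms of `a(ζ_b) Ψ`. -/
lemma succ_mul_l2Sq_squeezedVector (h : IsOrthonormal volume B ζ) (N : ℕ) :
    (N + 1 : ℝ) * l2Sq volume (squeezedVector B ζ t (N + 1)) =
      ∑ b ∈ B, t b ^ 2 * l2Sq volume (creation (ζ b) (squeezedVector B ζ t) N) := by
  have hΨ := isRegular_squeezedVector (B := B) (t := t) h.memLp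
  have e : ((N + 1 : ℕ) : ℂ) * l2Inner volume (squeezedVector B ζ t (N + 1))
      (squeezedVector B ζ t (N + 1)) = ∑ b ∈ B, (t b : ℂ) * l2Inner volume
        (squeezedVector B ζ t (N + 1))
        (creation (ζ b) (creation (ζ b) (squeezedVector B ζ t)) (N + 1)) := by
    simp only [← l2Inner_const_mul_right]
    rw [← l2Inner_sum_right B (hΨ.memLp _) fun b =>
      (((hΨ.creation (h.memLp b)).creation (h.memLp b)).memLp (N + 1)).const_mul _]
    congr 1
    funext k
    have := congrFun (natCast_smul_squeezedVector (B := B) (ζ := ζ) (t := t) (N + 1)) k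
    simpa using this
  have e2 : ∀ b ∈ B, (t b : ℂ) * l2Inner volume (squeezedVector B ζ t (N + 1))
        (creation (ζ b) (creation (ζ b) (squeezedVector B ζ t)) (N + 1)) =
      ((t b ^ 2 * l2Sq volume (creation (ζ b) (squeezedVector B ζ t) N) : ℝ) : ℂ) := by
    intro b hb
    rw [l2Inner_creation_right (hΨ.creation (h.memLp b)) hΨ (h.memLp b), annihilation_mode h hb,
      ← l2Inner_conj]
    have := l2Inner_const_mul_right (μ := volume) (t b : ℂ)
      (creation (ζ b) (squeezedVector B ζ t) N) (creation (ζ b) (squeezedVector B ζ t) N)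
    rw [l2Inner_self] at this
    change (t b : ℂ) * (starRingEnd ℂ) (l2Inner volume _ (fun k => (t b : ℂ) *
      creation (ζ b) (squeezedVector B ζ t) N k)) = _
    rw [this, map_mul, Complex.conj_ofReal, Complex.conj_ofReal]
    push_cast; ring
  rw [Finset.sum_congr rfl e2, l2Inner_self] at e
  exact_mod_cast e

/-- The norms of the components of the squeezed vector decay like a geometric series with ratio
close to `max t_b²`; the number of modes enters only a lower-order correction. -/
lemma add_two_mul_l2Sq_squeezedVector_le (h : IsOrthonormal volume B ζ) {T : ℝ}
    (hT : ∀ b ∈ B, t b ^ 2 ≤ T) (N : ℕ) :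
    (N + 2 : ℝ) * l2Sq volume (squeezedVector B ζ t (N + 2)) ≤
      T * ((N + B.card) * l2Sq volume (squeezedVector B ζ t N)) := by
  have h1 := succ_mul_l2Sq_squeezedVector (t := t) h (N + 1)
  have h2 : ∑ b ∈ B, l2Sq volume (creation (ζ b) (squeezedVector B ζ t) (N + 1)) =
      (N + B.card) * l2Sq volume (squeezedVector B ζ t N) := by
    rcases N with _ | N
    · rw [Finset.sum_congr rfl fun b hb => by
        rw [l2Sq_creation_squeezedVector_one h.memLp (h.memLp b), h.l2Sq_eq_one hb, one_mul]]
      simp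
    · rw [Finset.sum_congr rfl fun b hb => by
        rw [l2Sq_creation_squeezedVector h.memLp (h.memLp b), h.l2Sq_eq_one hb, one_mul,
          l2Sq_annihilation_mode h hb]]
      rw [Finset.sum_add_distrib, ← succ_mul_l2Sq_squeezedVector h]
      simp; ring
  rw [← h2, Finset.mul_sum]
  push_cast at h1
  rw [show (N + 2 : ℝ) = N + 1 + 1 by ring, h1]
  exact Finset.sum_le_sum fun b hb => mul_le_mul_of_nonneg_right (hT b hb) (l2Sq_nonneg _)

/-- The squeezed vector lies in the form domain of the number operator. -/
lemma summable_succ_mul_l2Sq (h : IsOrthonormal volume B ζ) (ht : ∀ b ∈ B, t b ^ 2 < 1) :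
    Summable fun N : ℕ => (N + 1 : ℝ) * l2Sq volume (squeezedVector B ζ t N) := by
  obtain ⟨T, hT0, hT1, hT⟩ := exists_sq_le_lt_one ht
  set s : ℕ → ℝ := fun N => l2Sq volume (squeezedVector B ζ t N) with hs
  have hs0 : ∀ N, 0 ≤ s N := fun N => l2Sq_nonneg _
  set M : ℝ := (B.card : ℝ)
  have hlim : Tendsto (fun j : ℕ => T * ((1 + 1 / (2 * (j : ℝ) + 2)) *
      (1 + (M - 1) / (2 * (j : ℝ) + 1)))) atTop (𝓝 T) := by
    have a1 : Tendsto (fun j : ℕ => 2 * (j : ℝ)) atTop atTop :=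
      tendsto_natCast_atTop_atTop.const_mul_atTop two_pos
    have l1 : Tendsto (fun j : ℕ => 1 / (2 * (j : ℝ) + 2)) atTop (𝓝 0) :=
      (tendsto_const_nhds).div_atTop (tendsto_atTop_add_const_right _ _ a1)
    have l2 : Tendsto (fun j : ℕ => (M - 1) / (2 * (j : ℝ) + 1)) atTop (𝓝 0) :=
      (tendsto_const_nhds).div_atTop (tendsto_atTop_add_const_right _ _ a1)
    have := ((l1.const_add 1).mul (l2.const_add 1)).const_mul T
    simpa using this
  have heven : Summable fun j : ℕ => ((2 * j : ℕ) + 1 : ℝ) * s (2 * j) := by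
    refine summable_of_ratio_norm_eventually_le (r := (1 + T) / 2) (by linarith) ?_
    filter_upwards [hlim.eventually_le_const (show T < (1 + T) / 2 by linarith)] with j hj
    rw [Real.norm_of_nonneg (by have := hs0 (2 * (j + 1)); positivity),
      Real.norm_of_nonneg (by have := hs0 (2 * j); positivity)]
    have hrec := add_two_mul_l2Sq_squeezedVector_le h hT (2 * j)
    change _ * s (2 * j + 2) ≤ T * ((_ + M) * s (2 * j)) at hrec
    push_cast at hrec ⊢
    rw [show 2 * (j + 1) = 2 * j + 2 by ring]
    have hj0 : (0 : ℝ) ≤ j := by positivity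
    have e : T * ((1 + 1 / (2 * (j : ℝ) + 2)) * (1 + (M - 1) / (2 * (j : ℝ) + 1))) *
        ((2 * (j : ℝ) + 1) * s (2 * j)) =
        (2 * (j : ℝ) + 3) / (2 * j + 2) * (T * ((2 * j + M) * s (2 * j))) := by
      field_simp
      ring
    calc (2 * ((j : ℝ) + 1) + 1) * s (2 * j + 2)
        = (2 * (j : ℝ) + 3) / (2 * j + 2) * ((2 * (j : ℝ) + 2) * s (2 * j + 2)) := by
          field_simp; ring
      _ ≤ (2 * (j : ℝ) + 3) / (2 * j + 2) * (T * ((2 * j + M) * s (2 * j))) :=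
          mul_le_mul_of_nonneg_left hrec (by positivity)
      _ ≤ _ := by
          rw [← e]
          exact mul_le_mul_of_nonneg_right hj (by have := hs0 (2 * j); positivity)
  refine Summable.even_add_odd heven ?_
  have : (fun j : ℕ => ((2 * j + 1 : ℕ) + 1 : ℝ) * l2Sq volume (squeezedVector B ζ t (2 * j + 1)))
      = fun _ => 0 := by
    funext j; rw [l2Sq_squeezedVector_odd, mul_zero]
  rw [this]
  exact summable_zero

lemma normSq_squeezedVector_ne_zero (h : IsOrthonormal volume B ζ) :
    normSq (squeezedVector B ζ t) ≠ 0 := by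
  rw [normSq_eq_tsum (isRegular_squeezedVector h.memLp)]
  have := ENNReal.le_tsum (f := fun N => ENNReal.ofReal (l2Sq volume (squeezedVector B ζ t N))) 0
  rw [l2Sq_squeezedVector_zero, ENNReal.ofReal_one] at this
  exact (lt_of_lt_of_le one_pos this).ne'

lemma normSq_squeezedVector_ne_top (h : IsOrthonormal volume B ζ) (ht : ∀ b ∈ B, t b ^ 2 < 1) :
    normSq (squeezedVector B ζ t) ≠ ⊤ := by
  rw [normSq_eq_tsum (isRegular_squeezedVector h.memLp)]
  refine (Summable.of_nonneg_of_le (fun _ => l2Sq_nonneg _) (fun N => ?_)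
    (summable_succ_mul_l2Sq h ht)).tsum_ofReal_ne_top
  have := l2Sq_nonneg (μ := volume) (squeezedVector B ζ t N)
  nlinarith [(Nat.cast_nonneg N : (0 : ℝ) ≤ N)]

lemma normSq_creation_squeezedVector_le (h : IsOrthonormal volume B ζ)
    (ht : ∀ b ∈ B, t b ^ 2 < 1) {H : Momentum → ℂ} (hH : MemLp H 2 volume) :
    normSq (creation H (squeezedVector B ζ t)) ≤ ENNReal.ofReal
      (l2Sq volume H * ∑' N : ℕ, (N + 1 : ℝ) * l2Sq volume (squeezedVector B ζ t N)) := by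
  have hΨ := isRegular_squeezedVector (B := B) (t := t) h.memLp
  have hsum := summable_succ_mul_l2Sq h ht
  rw [normSq_eq_tsum (hΨ.creation hH), tsum_eq_zero_add' ENNReal.summable, ← tsum_mul_left,
    ENNReal.ofReal_tsum_of_nonneg _ (hsum.mul_left _)]
  · have h0 : l2Sq volume (creation H (squeezedVector B ζ t) 0) = 0 := by simp [l2Sq, creation]
    rw [h0, ENNReal.ofReal_zero, zero_add]
    refine ENNReal.tsum_le_tsum fun N => ENNReal.ofReal_le_ofReal ?_
    rw [mul_left_comm]
    exact l2Sq_creation_le hΨ hH N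
  · intro N
    have h1 := l2Sq_nonneg (μ := volume) (squeezedVector B ζ t N)
    have h2 := l2Sq_nonneg (μ := volume) H
    positivity

lemma l2Sq_sum (h : IsOrthonormal volume B ζ) (w : ι → ℂ) :
    l2Sq volume (fun k => ∑ b ∈ B, w b * ζ b k) = ∑ b ∈ B, ‖w b‖ ^ 2 := by
  have := h.l2Sq_add_sum (F := 0) MemLp.zero w
  simpa [l2Sq, l2Inner] using this

/-- `‖a*(∑ w_b ζ_b) Ψ‖² = ‖Ψ‖² ∑ |w_b|² / (1 - t_b²)`. Both sides obey the same affine recursion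
under the contraction `w ↦ t conj w`, so that their difference is a fixed point of it. -/
lemma normSq_creation_sum_squeezedVector (h : IsOrthonormal volume B ζ)
    (ht : ∀ b ∈ B, t b ^ 2 < 1) (w : ι → ℂ) :
    (normSq (creation (fun k => ∑ b ∈ B, w b * ζ b k) (squeezedVector B ζ t))).toReal =
      (normSq (squeezedVector B ζ t)).toReal * ∑ b ∈ B, ‖w b‖ ^ 2 / (1 - t b ^ 2) := by
  obtain ⟨T, hT0, hT1, hT⟩ := exists_sq_le_lt_one ht
  set S := (normSq (squeezedVector B ζ t)).toReal with hS
  set C := ∑' N : ℕ, (N + 1 : ℝ) * l2Sq volume (squeezedVector B ζ t N) with hC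
  have hC0 : 0 ≤ C := tsum_nonneg fun N => by
    have h1 := l2Sq_nonneg (μ := volume) (squeezedVector B ζ t N)
    positivity
  have hS0 : 0 ≤ S := ENNReal.toReal_nonneg
  set Q : (ι → ℂ) → ℝ := fun w =>
    (normSq (creation (fun k => ∑ b ∈ B, w b * ζ b k) (squeezedVector B ζ t))).toReal with hQ
  set E : (ι → ℂ) → ℝ := fun w => ∑ b ∈ B, ‖w b‖ ^ 2 / (1 - t b ^ 2) with hE
  set n : (ι → ℂ) → ℝ := fun w => ∑ b ∈ B, ‖w b‖ ^ 2 with hn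
  set J : (ι → ℂ) → (ι → ℂ) := fun w b => (t b : ℂ) * (starRingEnd ℂ) (w b) with hJ
  have hmem : ∀ w : ι → ℂ, MemLp (fun k => ∑ b ∈ B, w b * ζ b k) 2 volume :=
    fun w => memLp_sum_mul h.memLp w
  have hfin : ∀ w : ι → ℂ, normSq (creation (fun k => ∑ b ∈ B, w b * ζ b k)
      (squeezedVector B ζ t)) ≠ ⊤ := fun w =>
    ne_top_of_le_ne_top ENNReal.ofReal_ne_top (normSq_creation_squeezedVector_le h ht (hmem w))
  have hn0 : ∀ w, 0 ≤ n w := fun w => Finset.sum_nonneg fun b _ => by positivity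
  have hQrec : ∀ w, Q w = n w * S + Q (J w) := by
    intro w
    have := normSq_creation_squeezedVector (B := B) (t := t) h.memLp (hmem w)
    rw [reflected_sum h, l2Sq_sum h] at this
    simp only [hQ]
    rw [this, ENNReal.toReal_add _ (hfin _), ENNReal.toReal_mul, ENNReal.toReal_ofReal (hn0 w)]
    exact ENNReal.mul_ne_top ENNReal.ofReal_ne_top (normSq_squeezedVector_ne_top h ht)
  have hErec : ∀ w, E w = n w + E (J w) := by
    intro w
    simp only [hE, hn, hJ, ← Finset.sum_add_distrib]
    refine Finset.sum_congr rfl fun b hb => ?_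
    have : (1 - t b ^ 2) ≠ 0 := by linarith [ht b hb]
    simp only [norm_mul, Complex.norm_real, RCLike.norm_conj, mul_pow, Real.norm_eq_abs, sq_abs]
    field_simp; ring
  have hQle : ∀ w, Q w ≤ C * n w := by
    intro w
    have := normSq_creation_squeezedVector_le h ht (hmem w)
    rw [l2Sq_sum h] at this
    rw [mul_comm]
    exact ENNReal.toReal_le_of_le_ofReal (mul_nonneg (hn0 w) hC0) this
  have hEle : ∀ w, E w ≤ n w / (1 - T) := by
    intro w
    simp only [hE, hn, Finset.sum_div]
    refine Finset.sum_le_sum fun b hb => ?_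
    exact div_le_div_of_nonneg_left (by positivity) (by linarith) (by linarith [hT b hb])
  have hE0 : ∀ w, 0 ≤ E w := fun w => Finset.sum_nonneg fun b hb =>
    div_nonneg (by positivity) (by linarith [ht b hb])
  have hnJ : ∀ w, n (J w) ≤ T * n w := by
    intro w
    simp only [hn, hJ, Finset.mul_sum]
    refine Finset.sum_le_sum fun b hb => ?_
    simp only [norm_mul, Complex.norm_real, RCLike.norm_conj, mul_pow, Real.norm_eq_abs, sq_abs]
    exact mul_le_mul_of_nonneg_right (hT b hb) (by positivity)
  have hQ0 : ∀ w, 0 ≤ Q w := fun w => ENNReal.toReal_nonneg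
  have hbound : ∀ m : ℕ, ∀ w, |Q w - S * E w| ≤ T ^ m * ((C + S / (1 - T)) * n w) := by
    intro m
    induction m with
    | zero =>
      intro w
      have h1 := hQle w
      have h2 := mul_le_mul_of_nonneg_left (hEle w) hS0
      have h3 := mul_nonneg hS0 (hE0 w)
      have h4 : S * (n w / (1 - T)) = S / (1 - T) * n w := by ring
      have h5 := hQ0 w
      rw [abs_le]
      constructor
      · nlinarith [mul_nonneg hC0 (hn0 w)]
      · have : 0 ≤ S / (1 - T) * n w := mul_nonneg (div_nonneg hS0 (by linarith)) (hn0 w)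
        nlinarith
    | succ m ih =>
      intro w
      have e : Q w - S * E w = Q (J w) - S * E (J w) := by rw [hQrec, hErec]; ring
      rw [e]
      refine (ih (J w)).trans ?_
      have hc : 0 ≤ C + S / (1 - T) := add_nonneg hC0 (div_nonneg hS0 (by linarith))
      calc T ^ m * ((C + S / (1 - T)) * n (J w))
          ≤ T ^ m * ((C + S / (1 - T)) * (T * n w)) := by
            gcongr; exact hnJ w
        _ = _ := by ring
  have hlim : Tendsto (fun m : ℕ => T ^ m * ((C + S / (1 - T)) * n w)) atTop (𝓝 0) := by
    simpa using (tendsto_pow_atTop_nhds_zero_of_lt_one hT0 hT1).mul_const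
      ((C + S / (1 - T)) * n w)
  have := ge_of_tendsto' hlim fun m => hbound m w
  exact sub_eq_zero.1 (abs_nonpos_iff.1 this)

/-- The expectation of the square of the field in a squeezed state: the real part of the
coefficient of `F` with respect to a mode is amplified by `(1 + t) / (1 - t)`, the imaginary part
by the inverse factor. -/
theorem expectationSq_squeezedVector (h : IsOrthonormal volume B ζ)
    (ht : ∀ b ∈ B, t b ^ 2 < 1) {F : Momentum → ℂ} (hF : MemLp F 2 volume) :
    expectationSq (squeezedVector B ζ t) (segalField F) =
      ENNReal.ofReal (1 / 2 * (l2Sq volume F + ∑ b ∈ B,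
        (((1 + t b) / (1 - t b) - 1) * (l2Inner volume (ζ b) F).re ^ 2 +
          ((1 - t b) / (1 + t b) - 1) * (l2Inner volume (ζ b) F).im ^ 2))) := by
  set Ψ := squeezedVector B ζ t with hΨ
  set f : ι → ℂ := fun b => l2Inner volume (ζ b) F with hf
  set w : ι → ℂ := fun b => (t b : ℂ) * (starRingEnd ℂ) (f b) with hw
  set H : Momentum → ℂ := fun k => F k + ∑ b ∈ B, w b * ζ b k with hHdef
  have hsum := memLp_sum_mul (B := B) h.memLp w
  have hH : MemLp H 2 volume := hF.add hsum
  have hHb : ∀ b ∈ B, l2Inner volume (ζ b) H = f b + w b := by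
    intro b hb
    rw [hHdef, l2Inner_add_right (h.memLp b) hF hsum, h.inner_sum w hb]
  have hseg : segalField F Ψ = ((1 / Real.sqrt 2 : ℝ) : ℂ) • creation H Ψ := by
    rw [segalField, annihilation_squeezedVector h.memLp hF, ← creation_fun_add]; rfl
  have hsq2 : ‖((1 / Real.sqrt 2 : ℝ) : ℂ)‖ₑ ^ 2 = ENNReal.ofReal (1 / 2) := by
    rw [← ofReal_norm, ← ENNReal.ofReal_pow (norm_nonneg _), Complex.norm_real, Real.norm_eq_abs,
      sq_abs, div_pow, Real.sq_sqrt zero_le_two, one_pow]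
  have hS0 := normSq_squeezedVector_ne_zero (t := t) h
  have hSt := normSq_squeezedVector_ne_top h ht
  have hfin : ∀ {G : Momentum → ℂ}, MemLp G 2 volume → normSq (creation G Ψ) ≠ ⊤ := fun hG =>
    ne_top_of_le_ne_top ENNReal.ofReal_ne_top (normSq_creation_squeezedVector_le h ht hG)
  have hQ : (normSq (creation H Ψ)).toReal = (normSq Ψ).toReal * (l2Sq volume F + ∑ b ∈ B,
        (((1 + t b) / (1 - t b) - 1) * (f b).re ^ 2 +
          ((1 - t b) / (1 + t b) - 1) * (f b).im ^ 2)) := by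
    have hr : reflected B ζ t H = fun k => ∑ b ∈ B,
        ((t b : ℂ) * (starRingEnd ℂ) (f b + w b)) * ζ b k := by
      funext k
      exact Finset.sum_congr rfl fun b hb => by rw [hHb b hb]
    rw [normSq_creation_squeezedVector h.memLp hH, ENNReal.toReal_add
      (ENNReal.mul_ne_top ENNReal.ofReal_ne_top hSt) (hfin (memLp_reflected h.memLp _)),
      ENNReal.toReal_mul, ENNReal.toReal_ofReal (l2Sq_nonneg _), hr,
      normSq_creation_sum_squeezedVector h ht, hHdef, h.l2Sq_add_sum hF, mul_comm _
      (normSq (squeezedVector B ζ t)).toReal, ← mul_add, add_assoc, ← Finset.sum_add_distrib]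
    congr 2
    refine Finset.sum_congr rfl fun b hb => ?_
    have h1 := ht b hb
    have h2 : 1 - t b ≠ 0 := by nlinarith
    have h3 : 1 + t b ≠ 0 := by nlinarith
    have h4 : 1 - t b ^ 2 = (1 - t b) * (1 + t b) := by ring
    simp only [hw, ← Complex.normSq_eq_norm_sq, Complex.normSq_apply, Complex.add_re,
      Complex.add_im, Complex.mul_re, Complex.mul_im, Complex.conj_re, Complex.conj_im,
      Complex.ofReal_re, Complex.ofReal_im, map_add, map_mul, Complex.conj_ofReal]
    rw [h4]
    field_simp
    ring
  rw [expectationSq, hseg, normSq_smul, hsq2, ← ENNReal.ofReal_toReal (hfin hH), hQ,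
    ENNReal.ofReal_mul ENNReal.toReal_nonneg, ENNReal.ofReal_toReal hSt,
    ENNReal.ofReal_mul (by norm_num), mul_left_comm, mul_comm (normSq Ψ)]
  exact ENNReal.mul_div_cancel_right hS0 hSt

end SqueezedNorm

/-! ### Orthogonality of associated Legendre functions and of trigonometric functions -/

section Legendre

open Polynomial

lemma intervalIntegrable_eval (p : ℝ[X]) (a b : ℝ) :
    IntervalIntegrable (fun x => p.eval x) volume a b := p.continuous.intervalIntegrable a b

lemma integral_derivative_eval_mul (p q : ℝ[X]) (h1 : p.eval 1 = 0) (h2 : p.eval (-1) = 0) :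
    ∫ x in (-1 : ℝ)..1, (derivative p).eval x * q.eval x =
      -∫ x in (-1 : ℝ)..1, p.eval x * (derivative q).eval x := by
  have := intervalIntegral.integral_eq_sub_of_hasDerivAt (a := -1) (b := 1)
    (f := fun x => (p * q).eval x) (f' := fun x => (derivative (p * q)).eval x)
    (fun x _ => (p * q).hasDerivAt x) (intervalIntegrable_eval _ _ _)
  simp only [derivative_mul, eval_add, eval_mul, h1, h2] at this
  rw [intervalIntegral.integral_add] at this
  · linarith
  · simpa using intervalIntegrable_eval (derivative p * q) (-1) 1
  · simpa using intervalIntegrable_eval (p * derivative q) (-1) 1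

lemma integral_iterate_derivative_eval_mul (n : ℕ) : ∀ p q : ℝ[X], (X ^ 2 - 1) ^ n ∣ p →
    ∫ x in (-1 : ℝ)..1, (derivative^[n] p).eval x * q.eval x =
      (-1) ^ n * ∫ x in (-1 : ℝ)..1, p.eval x * (derivative^[n] q).eval x := by
  induction n with
  | zero => intro p q _; simp
  | succ n ih =>
    rintro p q ⟨s, rfl⟩
    have hdvd : ((X : ℝ[X]) ^ 2 - 1) ^ n ∣ derivative ((X ^ 2 - 1) ^ (n + 1) * s) := by
      rw [derivative_mul, derivative_pow]
      refine dvd_add ?_ (Dvd.dvd.mul_right (pow_dvd_pow _ n.le_succ) _)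
      refine Dvd.dvd.mul_right (Dvd.dvd.mul_right (Dvd.intro_left _ rfl) _) _
    rw [Function.iterate_succ_apply, ih _ _ hdvd, integral_derivative_eval_mul _ _ (by simp)
      (by simp), Function.iterate_succ_apply' _ _ q, pow_succ]
    ring

/-- `∫ (1 - x²)^l` over `[-1, 1]`. -/
lemma integral_one_sub_sq_pow (l : ℕ) : ∫ x in (-1 : ℝ)..1, (1 - x ^ 2) ^ l =
    2 ^ (2 * l + 1) * (Nat.factorial l : ℝ) ^ 2 / Nat.factorial (2 * l + 1) := by
  induction l with
  | zero => norm_num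
  | succ l ih =>
    have hder : ∀ x : ℝ, HasDerivAt (fun x : ℝ => x * (1 - x ^ 2) ^ (l + 1))
        ((2 * l + 3) * (1 - x ^ 2) ^ (l + 1) - (2 * l + 2) * (1 - x ^ 2) ^ l) x := by
      intro x
      have h1 : HasDerivAt (fun x : ℝ => 1 - x ^ 2) (-(2 * x)) x := by
        simpa using (hasDerivAt_pow 2 x).const_sub 1
      have h2 := (hasDerivAt_id x).mul (h1.pow (l + 1))
      convert! h2 using 1
      simp only [id, Nat.add_sub_cancel, Pi.pow_apply]
      push_cast; ring
    have := intervalIntegral.integral_eq_sub_of_hasDerivAt (a := -1) (b := 1) (fun x _ => hder x)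
      (by apply Continuous.intervalIntegrable; fun_prop)
    rw [intervalIntegral.integral_sub (by apply Continuous.intervalIntegrable; fun_prop)
      (by apply Continuous.intervalIntegrable; fun_prop), intervalIntegral.integral_const_mul,
      intervalIntegral.integral_const_mul, ih] at this
    norm_num at this
    have h3 : (2 * (l : ℝ) + 3) ≠ 0 := by positivity
    have hf : (Nat.factorial (2 * (l + 1) + 1) : ℝ) =
        (2 * l + 3) * ((2 * l + 2) * Nat.factorial (2 * l + 1)) := by
      rw [show 2 * (l + 1) + 1 = 2 * l + 1 + 1 + 1 by ring, Nat.factorial_succ, Nat.factorial_succ]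
      push_cast; ring
    have hl : (Nat.factorial (l + 1) : ℝ) = (l + 1) * Nat.factorial l := by
      rw [Nat.factorial_succ]; push_cast; ring
    have h4 : (Nat.factorial (2 * l + 1) : ℝ) ≠ 0 := by positivity
    rw [hf, hl]
    have e : ∫ x in (-1 : ℝ)..1, (1 - x ^ 2) ^ (l + 1) = (2 * l + 2) / (2 * l + 3) *
        (2 ^ (2 * l + 1) * (Nat.factorial l : ℝ) ^ 2 / Nat.factorial (2 * l + 1)) := by
      field_simp at this ⊢
      linarith
    rw [e]
    field_simp
    ring

lemma natDegree_sq_sub_one_pow (l : ℕ) : (((X : ℝ[X]) ^ 2 - 1) ^ l).natDegree = 2 * l := by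
  rw [natDegree_pow, show ((X : ℝ[X]) ^ 2 - 1) = X ^ 2 - C 1 by simp, natDegree_X_pow_sub_C]
  ring

lemma coeff_sq_sub_one_pow (l : ℕ) : (((X : ℝ[X]) ^ 2 - 1) ^ l).coeff (2 * l) = 1 := by
  have h : (((X : ℝ[X]) ^ 2 - C 1) ^ l).Monic := (monic_X_pow_sub_C 1 two_ne_zero).pow l
  have := h.coeff_natDegree
  rw [C_1, natDegree_sq_sub_one_pow] at this
  exact this

lemma natDegree_legendre_le (l : ℕ) : (legendre l).natDegree ≤ l := by
  refine (natDegree_C_mul_le _ _).trans ((natDegree_iterate_derivative _ l).trans ?_)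
  rw [natDegree_sq_sub_one_pow]; omega

lemma coeff_legendre (l : ℕ) : (legendre l).coeff l =
    (Nat.factorial (2 * l) : ℝ) / (2 ^ l * (Nat.factorial l : ℝ) ^ 2) := by
  rw [legendre, coeff_C_mul, coeff_iterate_derivative, show l + l = 2 * l by ring,
    coeff_sq_sub_one_pow]
  have h := Nat.factorial_mul_descFactorial (show l ≤ 2 * l by omega)
  rw [show 2 * l - l = l by omega] at h
  have h' : (Nat.factorial l : ℝ) * ((2 * l).descFactorial l : ℝ) = Nat.factorial (2 * l) := by
    exact_mod_cast h
  rw [nsmul_eq_mul, mul_one, ← h']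
  have h4 : (Nat.factorial l : ℝ) ≠ 0 := by positivity
  field_simp

/-- The Legendre polynomial `P_l` is orthogonal to the polynomials of degree less than `l`. -/
lemma integral_mul_legendre (l : ℕ) (q : ℝ[X]) (hq : q.natDegree ≤ l) :
    ∫ x in (-1 : ℝ)..1, q.eval x * (legendre l).eval x =
      q.coeff l * (2 ^ (l + 1) * (Nat.factorial l : ℝ) ^ 2 / Nat.factorial (2 * l + 1)) := by
  have hD : derivative^[l] q = C (Nat.factorial l * q.coeff l) := by
    ext m
    rw [coeff_iterate_derivative, coeff_C]
    split_ifs with hm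
    · subst hm
      rw [zero_add, Nat.descFactorial_self, nsmul_eq_mul]
    · rw [coeff_eq_zero_of_natDegree_lt (by omega), smul_zero]
  have h := integral_iterate_derivative_eval_mul l ((X ^ 2 - 1) ^ l) q dvd_rfl
  rw [hD] at h
  have e : ∀ x : ℝ, q.eval x * (legendre l).eval x = (1 / (2 ^ l * (Nat.factorial l : ℝ))) *
      ((derivative^[l] ((X ^ 2 - 1) ^ l : ℝ[X])).eval x * q.eval x) := by
    intro x; rw [legendre, eval_mul, eval_C]; ring
  have e2 : ∀ x : ℝ, (((X : ℝ[X]) ^ 2 - 1) ^ l).eval x * (C (Nat.factorial l * q.coeff l)).eval x =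
      ((-1) ^ l * (Nat.factorial l * q.coeff l)) * (1 - x ^ 2) ^ l := by
    intro x
    rw [eval_C, eval_pow, eval_sub, eval_pow, eval_X, eval_one,
      show (x ^ 2 - 1) = (-1) * (1 - x ^ 2) by ring, mul_pow]
    ring
  simp only [e, intervalIntegral.integral_const_mul]
  rw [h]
  simp only [e2, intervalIntegral.integral_const_mul]
  rw [integral_one_sub_sq_pow]
  have h1 : ((-1 : ℝ) ^ l) * (-1) ^ l = 1 := by rw [← mul_pow]; norm_num
  have h4 : (Nat.factorial l : ℝ) ≠ 0 := by positivity
  have h5 : (Nat.factorial (2 * l + 1) : ℝ) ≠ 0 := by positivity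
  field_simp
  rw [sq, h1, show 2 * l + 1 = l + (l + 1) by ring, pow_add 2 l (l + 1)]
  ring

lemma natDegree_assoc_le (l m : ℕ) : (derivative^[m]
    ((X ^ 2 - 1) ^ m * derivative^[m] (legendre l))).natDegree ≤ l := by
  refine (natDegree_iterate_derivative _ m).trans ?_
  rcases le_or_gt m l with hml | hml
  · have h1 := natDegree_mul_le (p := ((X : ℝ[X]) ^ 2 - 1) ^ m) (q := derivative^[m] (legendre l))
    have h2 := natDegree_iterate_derivative (legendre l) m
    have h3 := natDegree_legendre_le l
    rw [natDegree_sq_sub_one_pow] at h1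
    omega
  · rw [iterate_derivative_eq_zero ((natDegree_legendre_le l).trans_lt hml)]
    simp

lemma integral_assoc_legendre_aux (l l' m : ℕ) :
    ∫ x in (-1 : ℝ)..1, (1 - x ^ 2) ^ m * ((derivative^[m] (legendre l)).eval x *
      (derivative^[m] (legendre l')).eval x) = ∫ x in (-1 : ℝ)..1, (derivative^[m]
        ((X ^ 2 - 1) ^ m * derivative^[m] (legendre l))).eval x * (legendre l').eval x := by
  rw [integral_iterate_derivative_eval_mul m _ _ (Dvd.intro _ rfl),
    ← intervalIntegral.integral_const_mul]
  congr 1; funext x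
  rw [eval_mul, eval_pow, eval_sub, eval_pow, eval_X, eval_one,
    show (1 - x ^ 2) = (-1) * (x ^ 2 - 1) by ring, mul_pow]
  ring

lemma integral_assoc_legendre_of_lt {l l' : ℕ} (m : ℕ) (h : l < l') :
    ∫ x in (-1 : ℝ)..1, (1 - x ^ 2) ^ m * ((derivative^[m] (legendre l)).eval x *
      (derivative^[m] (legendre l')).eval x) = 0 := by
  rw [integral_assoc_legendre_aux, integral_mul_legendre _ _ ((natDegree_assoc_le l m).trans h.le),
    coeff_eq_zero_of_natDegree_lt ((natDegree_assoc_le l m).trans_lt h), zero_mul]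

lemma integral_assoc_legendre_of_ne {l l' : ℕ} (m : ℕ) (h : l ≠ l') :
    ∫ x in (-1 : ℝ)..1, (1 - x ^ 2) ^ m * ((derivative^[m] (legendre l)).eval x *
      (derivative^[m] (legendre l')).eval x) = 0 := by
  rcases lt_or_gt_of_ne h with h | h
  · exact integral_assoc_legendre_of_lt m h
  · simp only [mul_comm ((derivative^[m] (legendre l)).eval _)]
    exact integral_assoc_legendre_of_lt m h

lemma integral_assoc_legendre_self {l m : ℕ} (h : m ≤ l) :
    ∫ x in (-1 : ℝ)..1, (1 - x ^ 2) ^ m * ((derivative^[m] (legendre l)).eval x *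
      (derivative^[m] (legendre l)).eval x) =
      2 / (2 * l + 1) * ((Nat.factorial (l + m) : ℝ) / Nat.factorial (l - m)) := by
  rw [integral_assoc_legendre_aux, integral_mul_legendre _ _ (natDegree_assoc_le l m),
    coeff_iterate_derivative, show l + m = 2 * m + (l - m) by omega,
    coeff_mul_add_eq_of_natDegree_le (natDegree_sq_sub_one_pow m).le
      ((natDegree_iterate_derivative _ m).trans
        (Nat.sub_le_sub_right (natDegree_legendre_le l) m)), coeff_sq_sub_one_pow,
    coeff_iterate_derivative, Nat.sub_add_cancel h, coeff_legendre, one_mul,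
    show 2 * m + (l - m) = l + m by omega]
  have h1 : (Nat.factorial l : ℝ) * ((l + m).descFactorial m : ℝ) = Nat.factorial (l + m) := by
    have := Nat.factorial_mul_descFactorial (show m ≤ l + m by omega)
    rw [Nat.add_sub_cancel] at this
    exact_mod_cast this
  have h2 : (Nat.factorial (l - m) : ℝ) * (l.descFactorial m : ℝ) = Nat.factorial l := by
    exact_mod_cast Nat.factorial_mul_descFactorial h
  have h3 : (Nat.factorial (2 * l + 1) : ℝ) = (2 * l + 1) * Nat.factorial (2 * l) := by
    rw [Nat.factorial_succ]; push_cast; ring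
  have n1 : (Nat.factorial l : ℝ) ≠ 0 := by positivity
  have n2 : (Nat.factorial (l - m) : ℝ) ≠ 0 := by positivity
  have n3 : (Nat.factorial (2 * l) : ℝ) ≠ 0 := by positivity
  have e1 : ((l + m).descFactorial m : ℝ) = Nat.factorial (l + m) / Nat.factorial l := by
    rw [← h1]; field_simp
  have e2 : (l.descFactorial m : ℝ) = Nat.factorial l / Nat.factorial (l - m) := by
    rw [← h2]; field_simp
  rw [nsmul_eq_mul, nsmul_eq_mul, e1, e2, h3]
  field_simp
  ring

/-- The azimuthal factor of the spherical harmonics: `cos (m φ)` for `0 ≤ m` and `sin (|m| φ)`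
for `m < 0`. -/
def azimuthal (m : ℤ) (φ : ℝ) : ℝ :=
  if 0 ≤ m then Real.cos (m.natAbs * φ) else Real.sin (m.natAbs * φ)

lemma integral_cos_int_mul {k : ℤ} (hk : k ≠ 0) :
    ∫ φ in (-Real.pi)..Real.pi, Real.cos (k * φ) = 0 := by
  have hk' : (k : ℝ) ≠ 0 := by exact_mod_cast hk
  rw [intervalIntegral.integral_comp_mul_left (fun x => Real.cos x) hk', integral_cos,
    mul_neg, Real.sin_neg, Real.sin_int_mul_pi]
  simp

lemma integral_sin_mul (k : ℝ) :
    ∫ φ in (-Real.pi)..Real.pi, Real.sin (k * φ) = 0 := by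
  rcases eq_or_ne k 0 with rfl | hk
  · simp
  · rw [intervalIntegral.integral_comp_mul_left (fun x => Real.sin x) hk, integral_sin,
      mul_neg, Real.cos_neg]
    simp

lemma integral_cos_natCast_sub (a b : ℕ) :
    ∫ φ in (-Real.pi)..Real.pi, Real.cos ((a - b : ℝ) * φ) =
      if a = b then 2 * Real.pi else 0 := by
  split_ifs with h
  · subst h; simp; ring
  · have := integral_cos_int_mul (k := (a : ℤ) - b) (by omega)
    push_cast at this; exact this

lemma integral_cos_natCast_add (a b : ℕ) :
    ∫ φ in (-Real.pi)..Real.pi, Real.cos ((a + b : ℝ) * φ) =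
      if a + b = 0 then 2 * Real.pi else 0 := by
  split_ifs with h
  · obtain ⟨rfl, rfl⟩ : a = 0 ∧ b = 0 := by omega
    simp; ring
  · have := integral_cos_int_mul (k := (a : ℤ) + b) (by omega)
    push_cast at this; exact this

lemma integral_azimuthal_mul (m m' : ℤ) :
    ∫ φ in (-Real.pi)..Real.pi, azimuthal m φ * azimuthal m' φ =
      if m = m' then (if m = 0 then 2 * Real.pi else Real.pi) else 0 := by
  have hint : ∀ c : ℝ, IntervalIntegrable (fun φ : ℝ => Real.cos (c * φ)) volume
      (-Real.pi) Real.pi := fun c => by apply Continuous.intervalIntegrable; fun_prop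
  have hints : ∀ c : ℝ, IntervalIntegrable (fun φ : ℝ => Real.sin (c * φ)) volume
      (-Real.pi) Real.pi := fun c => by apply Continuous.intervalIntegrable; fun_prop
  obtain ⟨a, ha⟩ : ∃ a, a = m.natAbs := ⟨_, rfl⟩
  obtain ⟨b, hb⟩ : ∃ b, b = m'.natAbs := ⟨_, rfl⟩
  have hcc : ∀ φ : ℝ, Real.cos (a * φ) * Real.cos (b * φ) =
      1 / 2 * (Real.cos ((a - b : ℝ) * φ) + Real.cos ((a + b : ℝ) * φ)) := by
    intro φ; rw [sub_mul, add_mul, Real.cos_sub, Real.cos_add]; ring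
  have hss : ∀ φ : ℝ, Real.sin (a * φ) * Real.sin (b * φ) =
      1 / 2 * (Real.cos ((a - b : ℝ) * φ) - Real.cos ((a + b : ℝ) * φ)) := by
    intro φ; rw [sub_mul, add_mul, Real.cos_sub, Real.cos_add]; ring
  have hsc : ∀ φ : ℝ, Real.sin (a * φ) * Real.cos (b * φ) =
      1 / 2 * (Real.sin ((a + b : ℝ) * φ) + Real.sin ((a - b : ℝ) * φ)) := by
    intro φ; rw [sub_mul, add_mul, Real.sin_sub, Real.sin_add]; ring
  have hcs : ∀ φ : ℝ, Real.cos (a * φ) * Real.sin (b * φ) =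
      1 / 2 * (Real.sin ((a + b : ℝ) * φ) - Real.sin ((a - b : ℝ) * φ)) := by
    intro φ; rw [sub_mul, add_mul, Real.sin_sub, Real.sin_add]; ring
  simp only [azimuthal, ← ha, ← hb]
  split_ifs with h1 h2 h3 h4 h5 h6 h7 h8 h9 h10 <;>
  simp only [hcc, hss, hsc, hcs, intervalIntegral.integral_const_mul,
    intervalIntegral.integral_add (hint _) (hint _),
    intervalIntegral.integral_sub (hint _) (hint _),
    intervalIntegral.integral_add (hints _) (hints _),
    intervalIntegral.integral_sub (hints _) (hints _), integral_sin_mul,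
    integral_cos_natCast_sub, integral_cos_natCast_add] <;>
  first
  | omega
  | (norm_num; done)
  | (split_ifs <;> first | omega | (norm_num; done) | ring)

end Legendre

/-! ### Polar and spherical coordinates in momentum space -/

section Spherical

open Metric

/-- The unit sphere in momentum space. -/
abbrev UnitSphere := sphere (0 : Momentum) 1

/-- The surface measure of the unit sphere. -/
abbrev surface : Measure UnitSphere := (volume : Measure Momentum).toSphere

lemma homeomorphUnitSphereProd_smul (k : ({0}ᶜ : Set Momentum)) :
    ((homeomorphUnitSphereProd Momentum k).2 : ℝ) •
      ((homeomorphUnitSphereProd Momentum k).1 : Momentum) = k := by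
  have hk : ‖(k : Momentum)‖ ≠ 0 := norm_ne_zero_iff.2 k.2
  simp [smul_smul, hk]

lemma measurePreserving_polar : MeasurePreserving (homeomorphUnitSphereProd Momentum)
    ((volume : Measure Momentum).comap (↑)) (surface.prod (Measure.volumeIoiPow 2)) := by
  have := (volume : Measure Momentum).measurePreserving_homeomorphUnitSphereProd
  simpa using this

lemma integral_polar_prod {F : Type*} [NormedAddCommGroup F] [NormedSpace ℝ F]
    (f : Momentum → F) :
    ∫ k, f k = ∫ p, f ((p.2 : ℝ) • (p.1 : Momentum))
      ∂(surface.prod (Measure.volumeIoiPow 2)) := by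
  rw [← measurePreserving_polar.integral_comp (Homeomorph.measurableEmbedding _)]
  simp only [homeomorphUnitSphereProd_smul]
  rw [integral_subtype_comap (measurableSet_singleton _).compl f, restrict_compl_singleton]

lemma integrable_polar_prod {F : Type*} [NormedAddCommGroup F]
    {f : Momentum → F} (hf : Integrable f) :
    Integrable (fun p : UnitSphere × Set.Ioi (0 : ℝ) => f ((p.2 : ℝ) • (p.1 : Momentum)))
      (surface.prod (Measure.volumeIoiPow 2)) := by
  rw [← measurePreserving_polar.integrable_comp_emb (Homeomorph.measurableEmbedding _)]
  simp only [Function.comp_def, homeomorphUnitSphereProd_smul]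
  have := (integrableOn_iff_comap_subtypeVal (μ := (volume : Measure Momentum)) (f := f)
    (measurableSet_singleton (0 : Momentum)).compl).1 hf.integrableOn
  exact this

lemma lintegral_polar_prod (f : Momentum → ℝ≥0∞) :
    ∫⁻ k, f k = ∫⁻ p, f ((p.2 : ℝ) • (p.1 : Momentum))
      ∂(surface.prod (Measure.volumeIoiPow 2)) := by
  rw [← measurePreserving_polar.lintegral_comp_emb (Homeomorph.measurableEmbedding _)]
  simp only [homeomorphUnitSphereProd_smul]
  rw [lintegral_subtype_comap (measurableSet_singleton _).compl f, restrict_compl_singleton]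

lemma integral_volumeIoiPow {F : Type*} [NormedAddCommGroup F] [NormedSpace ℝ F] (n : ℕ)
    (f : ℝ → F) :
    ∫ x : Set.Ioi (0 : ℝ), f x ∂(Measure.volumeIoiPow n) =
      ∫ x in Set.Ioi (0 : ℝ), x ^ n • f x := by
  simp only [Measure.volumeIoiPow, ENNReal.ofReal]
  rw [integral_withDensity_eq_integral_smul,
    integral_subtype_comap measurableSet_Ioi fun a ↦ Real.toNNReal (a ^ n) • f a,
    setIntegral_congr_fun measurableSet_Ioi fun x hx ↦ ?_]
  · rw [NNReal.smul_def, Real.coe_toNNReal _ (pow_nonneg hx.out.le _)]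
  · exact (measurable_subtype_coe.pow_const _).real_toNNReal

/-- Polar coordinates in momentum space. -/
lemma integral_polar {F : Type*} [NormedAddCommGroup F] [NormedSpace ℝ F]
    {f : Momentum → F} (hf : Integrable f) :
    ∫ k, f k = ∫ u : UnitSphere, (∫ x in Set.Ioi (0 : ℝ), x ^ 2 • f (x • (u : Momentum)))
      ∂surface := by
  rw [integral_polar_prod, integral_prod _ (integrable_polar_prod hf)]
  congr 1; funext u
  exact integral_volumeIoiPow 2 fun x => f (x • (u : Momentum))

/-- The point of the unit sphere with polar angle `θ` and azimuth `φ`. -/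
def sphericalPoint (θ φ : ℝ) : Momentum :=
  !₂[Real.sin θ * Real.cos φ, Real.sin θ * Real.sin φ, Real.cos θ]

lemma continuous_sphericalPoint : Continuous fun p : ℝ × ℝ => sphericalPoint p.1 p.2 := by
  refine (PiLp.continuous_toLp 2 _).comp (continuous_pi fun i => ?_)
  fin_cases i <;> simp <;> fun_prop

lemma norm_sphericalPoint (θ φ : ℝ) : ‖sphericalPoint θ φ‖ = 1 := by
  rw [sphericalPoint, EuclideanSpace.norm_eq, Real.sqrt_eq_one, Fin.sum_univ_three]
  simp only [Real.norm_eq_abs, sq_abs]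
  simp
  nlinarith [Real.sin_sq_add_cos_sq θ, Real.sin_sq_add_cos_sq φ]

lemma measurePreserving_cylinder : MeasurePreserving
    (fun k : Momentum => ((k 2, (k 0, k 1)) : ℝ × (ℝ × ℝ))) volume volume := by
  have h1 := PiLp.volume_preserving_ofLp (Fin 3)
  have h2 := volume_preserving_piFinSuccAbove (fun _ : Fin 3 => ℝ) 2
  have h3 : MeasurePreserving (Prod.map (id : ℝ → ℝ) (MeasurableEquiv.finTwoArrow (α := ℝ)))
      volume volume := (MeasurePreserving.id volume).prod (volume_preserving_finTwoArrow ℝ)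
  exact (h3.comp (h2.comp h1))

lemma lintegral_cylinder {f : Momentum → ℝ≥0∞} (hf : Measurable f) :
    ∫⁻ k, f k = ∫⁻ z : ℝ, ∫⁻ p : ℝ × ℝ, f (!₂[p.1, p.2, z] : Momentum) := by
  have hm : Measurable fun q : ℝ × (ℝ × ℝ) => (!₂[q.2.1, q.2.2, q.1] : Momentum) := by
    refine (PiLp.continuous_toLp 2 _).measurable.comp (measurable_pi_lambda _ fun i => ?_)
    fin_cases i <;> simp <;> fun_prop
  have e : ∀ k : Momentum, (!₂[k 0, k 1, k 2] : Momentum) = k := by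
    intro k; ext i; fin_cases i <;> simp
  have h := measurePreserving_cylinder.lintegral_comp (hf.comp hm)
  simp only [Function.comp_def, e] at h
  rw [h, Measure.volume_eq_prod]
  exact lintegral_prod (fun q : ℝ × (ℝ × ℝ) => f (!₂[q.2.1, q.2.2, q.1] : Momentum))
    (hf.comp hm).aemeasurable

lemma lintegral_polarCoord {f : ℝ × ℝ → ℝ≥0∞} (hf : Measurable f) :
    ∫⁻ p, f p = ∫⁻ r in Set.Ioi (0 : ℝ), ∫⁻ θ in Set.Ioo (-Real.pi) Real.pi,
      ENNReal.ofReal r * f (r * Real.cos θ, r * Real.sin θ) := by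
  rw [← lintegral_comp_polarCoord_symm, polarCoord_target, Measure.volume_eq_prod,
    setLIntegral_prod]
  · rfl
  · refine Measurable.aemeasurable ?_
    simp only [polarCoord_symm_apply, smul_eq_mul]
    exact (by fun_prop : Measurable fun p : ℝ × ℝ => ENNReal.ofReal p.1).mul
      (hf.comp (by fun_prop))

lemma measurable_vec3 {α : Type*} [MeasurableSpace α] {f g h : α → ℝ} (hf : Measurable f)
    (hg : Measurable g) (hh : Measurable h) :
    Measurable fun a => (!₂[f a, g a, h a] : Momentum) := by
  refine (PiLp.continuous_toLp 2 _).measurable.comp (measurable_pi_lambda _ fun i => ?_)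
  fin_cases i
  · exact hf
  · exact hg
  · exact hh

lemma lintegral_cylindrical {f : Momentum → ℝ≥0∞} (hf : Measurable f) :
    ∫⁻ k, f k = ∫⁻ q : ℝ × ℝ, (Set.Ioi (0 : ℝ)).indicator 1 q.2 *
      ∫⁻ φ in Set.Ioo (-Real.pi) Real.pi, ENNReal.ofReal q.2 *
        f (!₂[q.2 * Real.cos φ, q.2 * Real.sin φ, q.1] : Momentum) := by
  have hm : Measurable fun q : ℝ × ℝ => (Set.Ioi (0 : ℝ)).indicator (1 : ℝ → ℝ≥0∞) q.2 *
      ∫⁻ φ in Set.Ioo (-Real.pi) Real.pi, ENNReal.ofReal q.2 *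
        f (!₂[q.2 * Real.cos φ, q.2 * Real.sin φ, q.1] : Momentum) := by
    refine ((measurable_one.indicator measurableSet_Ioi).comp measurable_snd).mul ?_
    refine Measurable.lintegral_prod_right' (f := fun q : (ℝ × ℝ) × ℝ => ENNReal.ofReal q.1.2 *
      f (!₂[q.1.2 * Real.cos q.2, q.1.2 * Real.sin q.2, q.1.1] : Momentum)) ?_
    exact (by fun_prop : Measurable fun q : (ℝ × ℝ) × ℝ => ENNReal.ofReal q.1.2).mul
      (hf.comp (measurable_vec3 (by fun_prop) (by fun_prop) (by fun_prop)))
  rw [lintegral_cylinder hf, Measure.volume_eq_prod, lintegral_prod _ hm.aemeasurable]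
  refine lintegral_congr fun z => ?_
  rw [← Measure.volume_eq_prod, lintegral_polarCoord (f := fun p : ℝ × ℝ => f (!₂[p.1, p.2, z] : Momentum))
    (hf.comp (measurable_vec3 (by fun_prop) (by fun_prop) (by fun_prop))),
    ← lintegral_indicator measurableSet_Ioi]
  refine lintegral_congr fun ρ => ?_
  by_cases hρ : ρ ∈ Set.Ioi (0 : ℝ)
  · rw [Set.indicator_of_mem hρ, Set.indicator_of_mem hρ, Pi.one_apply, one_mul]
  · rw [Set.indicator_of_notMem hρ, Set.indicator_of_notMem hρ, zero_mul]

/-- Spherical coordinates, obtained by introducing plane polar coordinates twice: around the third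
axis, and then in the half plane `(z, ρ)`. -/
lemma lintegral_spherical {f : Momentum → ℝ≥0∞} (hf : Measurable f) :
    ∫⁻ k, f k = ∫⁻ r in Set.Ioi (0 : ℝ), ∫⁻ θ in Set.Ioo 0 Real.pi,
      ∫⁻ φ in Set.Ioo (-Real.pi) Real.pi,
        ENNReal.ofReal (r ^ 2 * Real.sin θ) * f (r • sphericalPoint θ φ) := by
  have hm : Measurable fun q : ℝ × ℝ => (Set.Ioi (0 : ℝ)).indicator (1 : ℝ → ℝ≥0∞) q.2 *
      ∫⁻ φ in Set.Ioo (-Real.pi) Real.pi, ENNReal.ofReal q.2 *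
        f (!₂[q.2 * Real.cos φ, q.2 * Real.sin φ, q.1] : Momentum) := by
    refine ((measurable_one.indicator measurableSet_Ioi).comp measurable_snd).mul ?_
    refine Measurable.lintegral_prod_right' (f := fun q : (ℝ × ℝ) × ℝ => ENNReal.ofReal q.1.2 *
      f (!₂[q.1.2 * Real.cos q.2, q.1.2 * Real.sin q.2, q.1.1] : Momentum)) ?_
    exact (by fun_prop : Measurable fun q : (ℝ × ℝ) × ℝ => ENNReal.ofReal q.1.2).mul
      (hf.comp (measurable_vec3 (by fun_prop) (by fun_prop) (by fun_prop)))
  rw [lintegral_cylindrical hf, lintegral_polarCoord hm]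
  refine setLIntegral_congr_fun measurableSet_Ioi fun r hr => ?_
  have hr' : (0 : ℝ) < r := hr
  have hsub : Set.Ioo 0 Real.pi ⊆ Set.Ioo (-Real.pi) Real.pi :=
    Set.Ioo_subset_Ioo_left (by linarith [Real.pi_pos])
  rw [← Set.inter_eq_left.2 hsub, ← setLIntegral_indicator measurableSet_Ioo]
  refine setLIntegral_congr_fun measurableSet_Ioo fun θ hθ => ?_
  have hv : ∀ φ, (!₂[r * Real.sin θ * Real.cos φ, r * Real.sin θ * Real.sin φ,
      r * Real.cos θ] : Momentum) = r • sphericalPoint θ φ := by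
    intro φ; ext i; fin_cases i <;> simp [sphericalPoint, mul_assoc]
  by_cases hθ0 : θ ∈ Set.Ioo 0 Real.pi
  · have hpos : r * Real.sin θ ∈ Set.Ioi (0 : ℝ) := mul_pos hr' (Real.sin_pos_of_mem_Ioo hθ0)
    simp only [hv]
    rw [Set.indicator_of_mem hpos, Set.indicator_of_mem hθ0, Pi.one_apply, one_mul,
      ← lintegral_const_mul' _ _ ENNReal.ofReal_ne_top]
    refine lintegral_congr fun φ => ?_
    rw [← mul_assoc, ← ENNReal.ofReal_mul hr'.le]
    congr 2; ring
  · have hs : r * Real.sin θ ∉ Set.Ioi (0 : ℝ) := by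
      have : Real.sin θ ≤ 0 := Real.sin_nonpos_of_nonpos_of_neg_pi_le
        (not_lt.1 fun h => hθ0 ⟨h, hθ.2⟩) hθ.1.le
      exact not_lt.2 (mul_nonpos_of_nonneg_of_nonpos hr'.le this)
    rw [Set.indicator_of_notMem hs, Set.indicator_of_notMem hθ0, zero_mul, mul_zero]

/-- The surface measure of the unit sphere in spherical coordinates. -/
lemma lintegral_surface {g : Momentum → ℝ≥0∞} (hg : Measurable g) :
    ∫⁻ u : UnitSphere, g u ∂surface = ∫⁻ θ in Set.Ioo 0 Real.pi,
      ∫⁻ φ in Set.Ioo (-Real.pi) Real.pi,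
        ENNReal.ofReal (Real.sin θ) * g (sphericalPoint θ φ) := by
  have hind : Measurable ((Set.Iio (1 : ℝ)).indicator (1 : ℝ → ℝ≥0∞)) :=
    measurable_one.indicator measurableSet_Iio
  have hFm : Measurable fun k : Momentum => (Set.Iio (1 : ℝ)).indicator 1 ‖k‖ * g (‖k‖⁻¹ • k) :=
    (hind.comp measurable_norm).mul (hg.comp (measurable_norm.inv.smul measurable_id))
  have hval : ∀ r ∈ Set.Ioi (0 : ℝ), ∀ u : Momentum, ‖u‖ = 1 →
      (Set.Iio (1 : ℝ)).indicator (1 : ℝ → ℝ≥0∞) ‖r • u‖ * g (‖r • u‖⁻¹ • (r • u)) =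
        (Set.Iio (1 : ℝ)).indicator 1 r * g u := by
    intro r hr u hu
    have hr' : (0 : ℝ) < r := hr
    rw [norm_smul, hu, mul_one, Real.norm_eq_abs, abs_of_pos hr', smul_smul,
      inv_mul_cancel₀ hr'.ne', one_smul]
  set c : ℝ≥0∞ := ∫⁻ r in Set.Ioi (0 : ℝ), ENNReal.ofReal (r ^ 2) *
    (Set.Iio (1 : ℝ)).indicator 1 r with hc
  have hcv : c = Measure.volumeIoiPow 2 (Set.Iio (⟨1, Set.mem_Ioi.2 one_pos⟩ : Set.Ioi (0 : ℝ))) := by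
    have e : ∀ r : ℝ, ENNReal.ofReal (r ^ 2) * (Set.Iio (1 : ℝ)).indicator 1 r =
        (Set.Iio (1 : ℝ)).indicator (fun r => ENNReal.ofReal (r ^ 2)) r := by
      intro r; by_cases h : r ∈ Set.Iio (1 : ℝ) <;> simp [h]
    rw [Measure.volumeIoiPow, withDensity_apply _ measurableSet_Iio,
      setLIntegral_subtype measurableSet_Ioi _ fun a : ℝ ↦ .ofReal (a ^ 2),
      Set.image_subtype_val_Ioi_Iio, hc]
    simp only [e]
    rw [setLIntegral_indicator measurableSet_Iio, Set.inter_comm, Set.Ioi_inter_Iio]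
  have hcval : c = ENNReal.ofReal (1 / 3) := by
    rw [hcv, Measure.volumeIoiPow_apply_Iio]; norm_num
  have h1 := lintegral_polar_prod
    (fun k : Momentum => (Set.Iio (1 : ℝ)).indicator 1 ‖k‖ * g (‖k‖⁻¹ • k))
  have e1 : ∀ p : UnitSphere × Set.Ioi (0 : ℝ), (Set.Iio (1 : ℝ)).indicator (1 : ℝ → ℝ≥0∞)
        ‖(p.2 : ℝ) • (p.1 : Momentum)‖ * g (‖(p.2 : ℝ) • (p.1 : Momentum)‖⁻¹ •
          ((p.2 : ℝ) • (p.1 : Momentum))) =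
      g p.1 * (Set.Iio (⟨1, Set.mem_Ioi.2 one_pos⟩ : Set.Ioi (0 : ℝ))).indicator 1 p.2 := by
    rintro ⟨⟨u, hu⟩, ⟨r, hr⟩⟩
    rw [hval r hr u (mem_sphere_zero_iff_norm.1 hu), mul_comm]; rfl
  simp only [e1] at h1
  rw [lintegral_prod_mul (f := fun u : UnitSphere => g u)
    (g := (Set.Iio (⟨1, Set.mem_Ioi.2 one_pos⟩ : Set.Ioi (0 : ℝ))).indicator 1)
    (hg.comp measurable_subtype_coe).aemeasurable
    (measurable_one.indicator measurableSet_Iio).aemeasurable,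
    lintegral_indicator_one measurableSet_Iio, ← hcv, mul_comm, lintegral_spherical hFm] at h1
  have hKm : Measurable fun θ => ∫⁻ φ in Set.Ioo (-Real.pi) Real.pi,
      ENNReal.ofReal (Real.sin θ) * g (sphericalPoint θ φ) :=
    Measurable.lintegral_prod_right'
      (f := fun p : ℝ × ℝ => ENNReal.ofReal (Real.sin p.1) * g (sphericalPoint p.1 p.2))
      ((by fun_prop : Measurable fun p : ℝ × ℝ => ENNReal.ofReal (Real.sin p.1)).mul
        (hg.comp continuous_sphericalPoint.measurable))
  have h2 : ∀ r ∈ Set.Ioi (0 : ℝ), (∫⁻ θ in Set.Ioo 0 Real.pi, ∫⁻ φ in Set.Ioo (-Real.pi) Real.pi,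
        ENNReal.ofReal (r ^ 2 * Real.sin θ) * ((Set.Iio (1 : ℝ)).indicator 1 ‖r • sphericalPoint θ φ‖ *
          g (‖r • sphericalPoint θ φ‖⁻¹ • (r • sphericalPoint θ φ)))) =
      (ENNReal.ofReal (r ^ 2) * (Set.Iio (1 : ℝ)).indicator 1 r) * ∫⁻ θ in Set.Ioo 0 Real.pi,
        ∫⁻ φ in Set.Ioo (-Real.pi) Real.pi,
          ENNReal.ofReal (Real.sin θ) * g (sphericalPoint θ φ) := by
    intro r hr
    rw [← lintegral_const_mul _ hKm]
    refine lintegral_congr fun θ => ?_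
    have hm : Measurable fun φ => ENNReal.ofReal (Real.sin θ) * g (sphericalPoint θ φ) :=
      (hg.comp (continuous_sphericalPoint.measurable.comp
        (by fun_prop : Measurable fun φ : ℝ => (θ, φ)))).const_mul _
    rw [← lintegral_const_mul _ hm]
    refine lintegral_congr fun φ => ?_
    rw [hval r hr _ (norm_sphericalPoint θ φ), ENNReal.ofReal_mul (sq_nonneg r)]
    ring
  have hcm : Measurable fun r : ℝ => ENNReal.ofReal (r ^ 2) *
      (Set.Iio (1 : ℝ)).indicator (1 : ℝ → ℝ≥0∞) r :=
    (by fun_prop : Measurable fun r : ℝ => ENNReal.ofReal (r ^ 2)).mul hind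
  have h3 := h1.symm.trans
    ((setLIntegral_congr_fun measurableSet_Ioi h2).trans (lintegral_mul_const _ hcm))
  have hc0 : c ≠ 0 := by rw [hcval]; simp
  have hct : c ≠ ⊤ := by rw [hcval]; exact ENNReal.ofReal_ne_top
  exact (ENNReal.mul_right_inj hc0 hct).1 h3

lemma integral_surface {g : Momentum → ℝ} (hg : Continuous g) :
    ∫ u : UnitSphere, g u ∂surface = ∫ p in Set.Ioo 0 Real.pi ×ˢ Set.Ioo (-Real.pi) Real.pi,
      Real.sin p.1 * g (sphericalPoint p.1 p.2) := by
  set D := Set.Ioo 0 Real.pi ×ˢ Set.Ioo (-Real.pi) Real.pi with hD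
  have hDm : MeasurableSet D := measurableSet_Ioo.prod measurableSet_Ioo
  set ν : Measure (ℝ × ℝ) := (volume.restrict D).withDensity
    fun p => ENNReal.ofReal (Real.sin p.1) with hν
  have hsph : Measurable fun p : ℝ × ℝ => sphericalPoint p.1 p.2 :=
    continuous_sphericalPoint.measurable
  have hmap : Measure.map ((↑) : UnitSphere → Momentum) surface =
      Measure.map (fun p : ℝ × ℝ => sphericalPoint p.1 p.2) ν := by
    refine Measure.ext_of_lintegral _ fun f hf => ?_
    have hm : Measurable fun p : ℝ × ℝ => f (sphericalPoint p.1 p.2) := hf.comp hsph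
    have hs : Measurable fun p : ℝ × ℝ => ENNReal.ofReal (Real.sin p.1) := by fun_prop
    rw [lintegral_map hf measurable_subtype_coe, lintegral_map hf hsph, lintegral_surface hf, hν,
      lintegral_withDensity_eq_lintegral_mul _ hs hm, hD, Measure.volume_eq_prod,
      setLIntegral_prod _ (hs.mul hm).aemeasurable]
    rfl
  have e1 := integral_map (μ := surface) measurable_subtype_coe.aemeasurable
    (f := g) hg.aestronglyMeasurable
  have e2 := integral_map (μ := ν) hsph.aemeasurable (f := g) hg.aestronglyMeasurable
  rw [← e1, hmap, e2, hν, integral_withDensity_eq_integral_toReal_smul (by fun_prop)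
    (ae_of_all _ fun _ => ENNReal.ofReal_lt_top)]
  refine setIntegral_congr_fun hDm fun p hp => ?_
  simp only [smul_eq_mul]
  rw [ENNReal.toReal_ofReal (Real.sin_pos_of_mem_Ioo hp.1).le]

/-! ### Spherical harmonics -/

lemma continuous_sphericalHarmonic (l : ℕ) (m : ℤ) : Continuous (sphericalHarmonic l m) := by
  unfold sphericalHarmonic
  have h : ∀ i : Fin 3, Continuous fun u : Momentum => u i := fun i => by fun_prop
  refine ((continuous_const.mul ((Polynomial.continuous _).comp (h 2)))).mul ?_
  split_ifs
  · exact Complex.continuous_re.comp (by fun_prop)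
  · exact Complex.continuous_im.comp (by fun_prop)

/-- The normalization constant of the spherical harmonic `Y_{l m}`. -/
def harmonicConst (l : ℕ) (m : ℤ) : ℝ :=
  Real.sqrt ((2 * l + 1) / (4 * Real.pi) *
      ((Nat.factorial (l - m.natAbs) : ℝ) / (Nat.factorial (l + m.natAbs) : ℝ))) *
    (if m = 0 then 1 else Real.sqrt 2)

lemma sphericalHarmonic_sphericalPoint (l : ℕ) (m : ℤ) (θ φ : ℝ) :
    sphericalHarmonic l m (sphericalPoint θ φ) = harmonicConst l m *
      ((Polynomial.derivative^[m.natAbs] (legendre l)).eval (Real.cos θ) *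
        Real.sin θ ^ m.natAbs) * azimuthal m φ := by
  have e : (((sphericalPoint θ φ) 0 : ℂ) + ((sphericalPoint θ φ) 1 : ℂ) * Complex.I) ^ m.natAbs =
      ((Real.sin θ ^ m.natAbs : ℝ) : ℂ) * ((Real.cos (m.natAbs * φ) : ℝ) +
        (Real.sin (m.natAbs * φ) : ℝ) * Complex.I) := by
    have h1 : ((sphericalPoint θ φ) 0 : ℂ) + ((sphericalPoint θ φ) 1 : ℂ) * Complex.I =
        (Real.sin θ : ℂ) * (Complex.cos φ + Complex.sin φ * Complex.I) := by
      simp [sphericalPoint]; ring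
    rw [h1, mul_pow, Complex.cos_add_sin_mul_I_pow]
    push_cast; rfl
  have h2 : (sphericalPoint θ φ) 2 = Real.cos θ := by simp [sphericalPoint]
  rw [sphericalHarmonic, e, h2, Complex.re_ofReal_mul, Complex.im_ofReal_mul, harmonicConst,
    azimuthal]
  simp only [Complex.add_re, Complex.ofReal_re, Complex.mul_re, Complex.I_re, mul_zero,
    Complex.ofReal_im, Complex.I_im, Complex.add_im, Complex.mul_im, mul_one, add_zero,
    zero_add, sub_self]
  split_ifs <;> ring

lemma integral_sin_mul_comp_cos (n : ℕ) (p : Polynomial ℝ) :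
    ∫ θ in (0 : ℝ)..Real.pi, Real.sin θ * (Real.sin θ ^ (2 * n) * p.eval (Real.cos θ)) =
      ∫ x in (-1 : ℝ)..1, (1 - x ^ 2) ^ n * p.eval x := by
  have h := intervalIntegral.integral_comp_mul_deriv (a := 0) (b := Real.pi) (f := Real.cos)
    (f' := fun θ => -Real.sin θ) (g := fun x => (1 - x ^ 2) ^ n * p.eval x)
    (fun x _ => Real.hasDerivAt_cos x) (by fun_prop) (by fun_prop)
  rw [Real.cos_zero, Real.cos_pi] at h
  have h' := h.trans (intervalIntegral.integral_symm _ _)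
  rw [← neg_eq_iff_eq_neg.2 h', ← intervalIntegral.integral_neg]
  congr 1; funext θ
  simp only [Function.comp_apply]
  rw [← Real.sin_sq, pow_mul]; ring

lemma harmonicConst_sq (l : ℕ) (m : ℤ) :
    harmonicConst l m * harmonicConst l m *
      ((2 / (2 * l + 1) * ((Nat.factorial (l + m.natAbs) : ℝ) / Nat.factorial (l - m.natAbs))) *
        (if m = 0 then 2 * Real.pi else Real.pi)) = 1 := by
  have h1 : (Nat.factorial (l + m.natAbs) : ℝ) ≠ 0 := by positivity
  have h2 : (Nat.factorial (l - m.natAbs) : ℝ) ≠ 0 := by positivity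
  have h3 : (2 * (l : ℝ) + 1) ≠ 0 := by positivity
  have hsq : harmonicConst l m * harmonicConst l m = ((2 * l + 1) / (4 * Real.pi) *
      ((Nat.factorial (l - m.natAbs) : ℝ) / (Nat.factorial (l + m.natAbs) : ℝ))) *
      (if m = 0 then 1 else 2) := by
    rw [harmonicConst, mul_mul_mul_comm, Real.mul_self_sqrt (by positivity)]
    congr 1
    split_ifs
    · norm_num
    · exact Real.mul_self_sqrt zero_le_two
  rw [hsq]
  have hpi := Real.pi_ne_zero
  split_ifs <;> field_simp <;> norm_num

/-- The spherical harmonics are orthonormal. -/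
lemma integral_sphericalHarmonic_mul {l l' : ℕ} {m m' : ℤ} (hm : m.natAbs ≤ l) :
    ∫ u : UnitSphere, sphericalHarmonic l m u * sphericalHarmonic l' m' u ∂surface =
      if l = l' ∧ m = m' then 1 else 0 := by
  rw [integral_surface (g := fun u => sphericalHarmonic l m u * sphericalHarmonic l' m' u)
    ((continuous_sphericalHarmonic l m).mul (continuous_sphericalHarmonic l' m'))]
  set a := m.natAbs with ha
  set b := m'.natAbs with hb
  have e : ∀ p : ℝ × ℝ, Real.sin p.1 * (sphericalHarmonic l m (sphericalPoint p.1 p.2) *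
      sphericalHarmonic l' m' (sphericalPoint p.1 p.2)) =
      (harmonicConst l m * harmonicConst l' m' * (Real.sin p.1 * (Real.sin p.1 ^ (a + b) *
        ((Polynomial.derivative^[a] (legendre l)).eval (Real.cos p.1) *
        (Polynomial.derivative^[b] (legendre l')).eval (Real.cos p.1))))) *
      (azimuthal m p.2 * azimuthal m' p.2) := by
    intro p
    rw [sphericalHarmonic_sphericalPoint, sphericalHarmonic_sphericalPoint]
    ring
  have hφ : ∫ φ in Set.Ioo (-Real.pi) Real.pi, azimuthal m φ * azimuthal m' φ =
      if m = m' then (if m = 0 then 2 * Real.pi else Real.pi) else 0 := by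
    rw [← integral_azimuthal_mul, intervalIntegral.integral_of_le (by linarith [Real.pi_pos]),
      integral_Ioc_eq_integral_Ioo]
  simp only [e]
  rw [Measure.volume_eq_prod, setIntegral_prod_mul (fun θ => harmonicConst l m *
    harmonicConst l' m' * (Real.sin θ * (Real.sin θ ^ (a + b) *
        ((Polynomial.derivative^[a] (legendre l)).eval (Real.cos θ) *
        (Polynomial.derivative^[b] (legendre l')).eval (Real.cos θ)))))
    (fun φ => azimuthal m φ * azimuthal m' φ), hφ]
  by_cases hmm : m = m'
  · subst hmm
    have hab : a + b = 2 * a := by omega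
    rw [hab, if_pos (rfl : m = m), integral_const_mul, ← integral_Ioc_eq_integral_Ioo,
      ← intervalIntegral.integral_of_le Real.pi_pos.le]
    simp only [← Polynomial.eval_mul]
    rw [integral_sin_mul_comp_cos]
    simp only [Polynomial.eval_mul]
    by_cases hl : l = l'
    · subst hl
      rw [integral_assoc_legendre_self hm, if_pos (⟨rfl, trivial⟩ : l = l ∧ True), mul_assoc]
      exact harmonicConst_sq l m
    · rw [integral_assoc_legendre_of_ne a hl, if_neg (fun h : l = l' ∧ True => hl h.1)]
      simp
  · rw [if_neg hmm, if_neg (fun h => hmm h.2), mul_zero]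

end Spherical

/-! ### Completeness of the spherical harmonics -/

section Completeness

open Polynomial

lemma norm_unitSphere (u : UnitSphere) : ‖(u : Momentum)‖ = 1 := mem_sphere_zero_iff_norm.1 u.2

lemma unitSphere_coord (u : UnitSphere) :
    (u : Momentum) 0 ^ 2 + (u : Momentum) 1 ^ 2 = 1 - (u : Momentum) 2 ^ 2 := by
  have h := norm_unitSphere u
  rw [EuclideanSpace.norm_eq, Real.sqrt_eq_one, Fin.sum_univ_three] at h
  simp only [Real.norm_eq_abs, sq_abs] at h
  linarith

/-- The complex coordinate `x + i y` on the unit sphere. -/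
def complexCoord (u : UnitSphere) : ℂ :=
  (((u : Momentum) 0 : ℝ) : ℂ) + (((u : Momentum) 1 : ℝ) : ℂ) * Complex.I

lemma continuous_coord (i : Fin 3) : Continuous fun u : UnitSphere => (u : Momentum) i := by
  fun_prop

lemma continuous_complexCoord : Continuous complexCoord :=
  (Complex.continuous_ofReal.comp (continuous_coord 0)).add
    ((Complex.continuous_ofReal.comp (continuous_coord 1)).mul continuous_const)

/-- The function `p(z) Re (x + i y)^n` on the unit sphere. -/
def zonalRe (p : ℝ[X]) (n : ℕ) : C(UnitSphere, ℝ) where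
  toFun u := p.eval ((u : Momentum) 2) * (complexCoord u ^ n).re
  continuous_toFun := (p.continuous.comp (continuous_coord 2)).mul
    (Complex.continuous_re.comp (continuous_complexCoord.pow n))

/-- The function `p(z) Im (x + i y)^n` on the unit sphere. -/
def zonalIm (p : ℝ[X]) (n : ℕ) : C(UnitSphere, ℝ) where
  toFun u := p.eval ((u : Momentum) 2) * (complexCoord u ^ n).im
  continuous_toFun := (p.continuous.comp (continuous_coord 2)).mul
    (Complex.continuous_im.comp (continuous_complexCoord.pow n))

/-- The coordinate functions on the unit sphere. -/
def coordMap (i : Fin 3) : C(UnitSphere, ℝ) := ⟨_, continuous_coord i⟩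

/-- The span of the functions `p(z) Re (x + i y)^n` and `p(z) Im (x + i y)^n`. -/
def zonalSpan : Submodule ℝ C(UnitSphere, ℝ) :=
  Submodule.span ℝ ({v | ∃ p n, v = zonalRe p n} ∪ {v | ∃ p n, v = zonalIm p n})

lemma zonalRe_mem (p : ℝ[X]) (n : ℕ) : zonalRe p n ∈ zonalSpan :=
  Submodule.subset_span (Or.inl ⟨p, n, rfl⟩)

lemma zonalIm_mem (p : ℝ[X]) (n : ℕ) : zonalIm p n ∈ zonalSpan :=
  Submodule.subset_span (Or.inr ⟨p, n, rfl⟩)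

lemma complexCoord_re (u : UnitSphere) : (complexCoord u).re = (u : Momentum) 0 := by
  simp [complexCoord]

lemma complexCoord_im (u : UnitSphere) : (complexCoord u).im = (u : Momentum) 1 := by
  simp [complexCoord]

/-- The relation `x (x + i y)^(n+1) = ((x + i y)^(n+2) + (1 - z²) (x + i y)^n) / 2` on the unit
sphere, and the analogous one for `y`. -/
lemma coord_mul_complexCoord_pow (u : UnitSphere) (n : ℕ) :
    (((u : Momentum) 0 : ℝ) : ℂ) * complexCoord u ^ (n + 1) =
      ((1 / 2 : ℝ) : ℂ) * (complexCoord u ^ (n + 2) +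
        ((1 - (u : Momentum) 2 ^ 2 : ℝ) : ℂ) * complexCoord u ^ n) ∧
    (((u : Momentum) 1 : ℝ) : ℂ) * complexCoord u ^ (n + 1) =
      ((1 / 2 : ℝ) : ℂ) * (-Complex.I) * (complexCoord u ^ (n + 2) -
        ((1 - (u : Momentum) 2 ^ 2 : ℝ) : ℂ) * complexCoord u ^ n) := by
  have h : ((1 - (u : Momentum) 2 ^ 2 : ℝ) : ℂ) = (((u : Momentum) 0 : ℝ) : ℂ) ^ 2 +
      (((u : Momentum) 1 : ℝ) : ℂ) ^ 2 := by
    rw [← unitSphere_coord]; push_cast; rfl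
  rw [h, pow_add _ n 2, pow_succ]
  generalize complexCoord u ^ n = w
  rw [complexCoord]
  have hI := Complex.I_sq
  constructor
  · push_cast
    linear_combination (-(1 / 2) * w * (((u : Momentum) 1 : ℝ) : ℂ) ^ 2) * hI
  · push_cast
    linear_combination (w * (((u : Momentum) 0 : ℝ) : ℂ) * (((u : Momentum) 1 : ℝ) : ℂ) +
      (1 / 2) * w * Complex.I * (((u : Momentum) 1 : ℝ) : ℂ) ^ 2) * hI

lemma coordMap_mul_mem (i : Fin 3) {v : C(UnitSphere, ℝ)} (hv : v ∈ zonalSpan) :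
    coordMap i * v ∈ zonalSpan := by
  have h0re : ∀ p n, coordMap 0 * zonalRe p n ∈ zonalSpan := by
    rintro p (_ | n)
    · have : coordMap 0 * zonalRe p 0 = zonalRe p 1 := by
        ext u; simp [coordMap, zonalRe, complexCoord_re, mul_comm]
      rw [this]; exact zonalRe_mem _ _
    · have : coordMap 0 * zonalRe p (n + 1) = zonalRe (C (1 / 2) * p) (n + 2) +
          zonalRe (C (1 / 2) * p * (1 - X ^ 2)) n := by
        ext u
        have h := congrArg Complex.re (coord_mul_complexCoord_pow u n).1
        simp only [Complex.re_ofReal_mul, Complex.add_re] at h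
        simp [coordMap, zonalRe] at h ⊢
        linear_combination (eval ((u : Momentum) 2) p) * h
      rw [this]; exact add_mem (zonalRe_mem _ _) (zonalRe_mem _ _)
  have h0im : ∀ p n, coordMap 0 * zonalIm p n ∈ zonalSpan := by
    rintro p (_ | n)
    · have : coordMap 0 * zonalIm p 0 = 0 := by
        ext u; simp [coordMap, zonalIm]
      rw [this]; exact zero_mem _
    · have : coordMap 0 * zonalIm p (n + 1) = zonalIm (C (1 / 2) * p) (n + 2) +
          zonalIm (C (1 / 2) * p * (1 - X ^ 2)) n := by
        ext u
        have h := congrArg Complex.im (coord_mul_complexCoord_pow u n).1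
        simp only [Complex.im_ofReal_mul, Complex.add_im] at h
        simp [coordMap, zonalIm] at h ⊢
        linear_combination (eval ((u : Momentum) 2) p) * h
      rw [this]; exact add_mem (zonalIm_mem _ _) (zonalIm_mem _ _)
  have h1re : ∀ p n, coordMap 1 * zonalRe p n ∈ zonalSpan := by
    rintro p (_ | n)
    · have : coordMap 1 * zonalRe p 0 = zonalIm p 1 := by
        ext u; simp [coordMap, zonalRe, zonalIm, complexCoord_im, mul_comm]
      rw [this]; exact zonalIm_mem _ _
    · have : coordMap 1 * zonalRe p (n + 1) = zonalIm (C (1 / 2) * p) (n + 2) +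
          zonalIm (C (-1 / 2) * p * (1 - X ^ 2)) n := by
        ext u
        have h := congrArg Complex.re (coord_mul_complexCoord_pow u n).2
        simp only [mul_assoc, Complex.mul_re, Complex.neg_re, Complex.I_re,
          Complex.neg_im, Complex.I_im, Complex.sub_im, Complex.im_ofReal_mul] at h
        simp [coordMap, zonalRe, zonalIm] at h ⊢
        linear_combination (eval ((u : Momentum) 2) p) * h
      rw [this]; exact add_mem (zonalIm_mem _ _) (zonalIm_mem _ _)
  have h1im : ∀ p n, coordMap 1 * zonalIm p n ∈ zonalSpan := by
    rintro p (_ | n)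
    · have : coordMap 1 * zonalIm p 0 = 0 := by
        ext u; simp [coordMap, zonalIm]
      rw [this]; exact zero_mem _
    · have : coordMap 1 * zonalIm p (n + 1) = zonalRe (C (-1 / 2) * p) (n + 2) +
          zonalRe (C (1 / 2) * p * (1 - X ^ 2)) n := by
        ext u
        have h := congrArg Complex.im (coord_mul_complexCoord_pow u n).2
        simp only [mul_assoc, Complex.mul_im, Complex.neg_re, Complex.I_re,
          Complex.neg_im, Complex.I_im, Complex.sub_re, Complex.re_ofReal_mul] at h
        simp [coordMap, zonalRe, zonalIm] at h ⊢
        linear_combination (eval ((u : Momentum) 2) p) * h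
      rw [this]; exact add_mem (zonalRe_mem _ _) (zonalRe_mem _ _)
  have h2re : ∀ p n, coordMap 2 * zonalRe p n ∈ zonalSpan := by
    intro p n
    have : coordMap 2 * zonalRe p n = zonalRe (X * p) n := by
      ext u; simp [coordMap, zonalRe, mul_assoc]
    rw [this]; exact zonalRe_mem _ _
  have h2im : ∀ p n, coordMap 2 * zonalIm p n ∈ zonalSpan := by
    intro p n
    have : coordMap 2 * zonalIm p n = zonalIm (X * p) n := by
      ext u; simp [coordMap, zonalIm, mul_assoc]
    rw [this]; exact zonalIm_mem _ _
  have hle : zonalSpan.map (LinearMap.mulLeft ℝ (coordMap i)) ≤ zonalSpan := by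
    refine (Submodule.map_span_le _ _ _).2 ?_
    rintro _ (⟨p, n, rfl⟩ | ⟨p, n, rfl⟩) <;> fin_cases i
    · exact h0re p n
    · exact h1re p n
    · exact h2re p n
    · exact h0im p n
    · exact h1im p n
    · exact h2im p n
  exact hle (Submodule.mem_map_of_mem hv)

/-- The polynomial functions on the unit sphere. -/
def polynomialAlgebra : Subalgebra ℝ C(UnitSphere, ℝ) :=
  Algebra.adjoin ℝ (Set.range coordMap)

lemma mem_zonalSpan_of_mem_polynomialAlgebra {v : C(UnitSphere, ℝ)}
    (hv : v ∈ polynomialAlgebra) : v ∈ zonalSpan := by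
  have h : ∀ w ∈ zonalSpan, v * w ∈ zonalSpan := by
    refine Algebra.adjoin_induction (p := fun v _ => ∀ w ∈ zonalSpan, v * w ∈ zonalSpan)
      ?_ ?_ ?_ ?_ hv
    · rintro _ ⟨i, rfl⟩ w hw
      exact coordMap_mul_mem i hw
    · intro c w hw
      rw [Algebra.algebraMap_eq_smul_one, smul_mul_assoc, one_mul]
      exact Submodule.smul_mem _ _ hw
    · intro a b _ _ ha hb w hw
      rw [add_mul]; exact add_mem (ha w hw) (hb w hw)
    · intro a b _ _ ha hb w hw
      rw [mul_assoc]; exact ha _ (hb w hw)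
  have h1 : zonalRe 1 0 = 1 := by ext u; simp [zonalRe]
  have := h _ (h1 ▸ zonalRe_mem 1 0)
  rwa [mul_one] at this

lemma separatesPoints_polynomialAlgebra : polynomialAlgebra.SeparatesPoints := by
  intro u v huv
  have : ∃ i, (u : Momentum) i ≠ (v : Momentum) i := by
    by_contra h
    push Not at h
    exact huv (Subtype.ext (by ext i; exact h i))
  obtain ⟨i, hi⟩ := this
  exact ⟨coordMap i, ⟨coordMap i, Algebra.subset_adjoin ⟨i, rfl⟩, rfl⟩, hi⟩

lemma integrable_surface {g : UnitSphere → ℝ} (hg : Continuous g) : Integrable g surface :=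
  hg.integrable_of_hasCompactSupport (HasCompactSupport.of_compactSpace g)

lemma coeff_iterate_derivative_legendre_ne_zero (n d : ℕ) :
    (derivative^[n] (legendre (n + d))).coeff d ≠ 0 := by
  rw [coeff_iterate_derivative, add_comm d n, coeff_legendre, nsmul_eq_mul]
  have : (n + d).descFactorial n ≠ 0 := by
    rw [Ne, Nat.descFactorial_eq_zero_iff_lt]; omega
  positivity

lemma natDegree_iterate_derivative_legendre_le (n d : ℕ) :
    (derivative^[n] (legendre (n + d))).natDegree ≤ d :=
  (natDegree_iterate_derivative _ n).trans (by have := natDegree_legendre_le (n + d); omega)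

/-- The derivatives `P_{n + d}^{(n)}`, `d = 0, 1, …`, span the polynomials: a linear functional
that annihilates them is zero. -/
lemma eq_zero_of_iterate_derivative_legendre (n : ℕ) (L : ℝ[X] →ₗ[ℝ] ℝ)
    (hL : ∀ d, L (derivative^[n] (legendre (n + d))) = 0) (p : ℝ[X]) : L p = 0 := by
  have key : ∀ d : ℕ, ∀ p : ℝ[X], p.degree < d → L p = 0 := by
    intro d
    induction d with
    | zero =>
      intro p hp
      rw [Nat.cast_zero] at hp
      have : p = 0 := by
        by_contra h
        exact absurd hp (not_lt.2 (zero_le_degree_iff.2 h))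
      rw [this, map_zero]
    | succ d ih =>
      intro p hp
      set q := derivative^[n] (legendre (n + d))
      have hq0 : q.coeff d ≠ 0 := coeff_iterate_derivative_legendre_ne_zero n d
      have hlt : (p - (p.coeff d / q.coeff d) • q).degree < d := by
        rw [degree_lt_iff_coeff_zero] at hp ⊢
        intro m hm
        rw [coeff_sub, coeff_smul, smul_eq_mul]
        rcases hm.eq_or_lt with rfl | hm
        · field_simp; ring
        · rw [hp m hm, coeff_eq_zero_of_natDegree_lt
            ((natDegree_iterate_derivative_legendre_le n d).trans_lt hm)]
          simp
      have := ih _ hlt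
      rwa [map_sub, map_smul, hL, smul_zero, sub_zero] at this
  exact key (p.natDegree + 1) p (by
    refine lt_of_le_of_lt degree_le_natDegree ?_
    exact_mod_cast Nat.lt_succ_self _)

lemma harmonicConst_ne_zero (l : ℕ) (m : ℤ) : harmonicConst l m ≠ 0 := by
  intro h
  have := harmonicConst_sq l m
  rw [h] at this
  simp at this

/-- The spherical harmonics are complete: a continuous function on the sphere all of whose
coefficients vanish is zero. -/
theorem exists_integral_sphericalHarmonic_ne_zero {g : UnitSphere → ℝ} (hg : Continuous g)
    {u₀ : UnitSphere} (hu₀ : g u₀ ≠ 0) :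
    ∃ (l : ℕ) (m : ℤ), m.natAbs ≤ l ∧ ∫ u, sphericalHarmonic l m u * g u ∂surface ≠ 0 := by
  by_contra hcon
  push Not at hcon
  let L : C(UnitSphere, ℝ) →ₗ[ℝ] ℝ :=
    { toFun := fun v => ∫ u, v u * g u ∂surface
      map_add' := fun v w => by
        simp only [ContinuousMap.add_apply, add_mul]
        exact integral_add (integrable_surface (v.continuous.mul hg))
          (integrable_surface (w.continuous.mul hg))
      map_smul' := fun c v => by
        simp only [ContinuousMap.smul_apply, smul_eq_mul, mul_assoc, RingHom.id_apply]
        exact integral_const_mul _ _ }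
  let zRe : ℕ → ℝ[X] →ₗ[ℝ] C(UnitSphere, ℝ) := fun n =>
    { toFun := fun p => zonalRe p n
      map_add' := fun p q => by ext u; simp [zonalRe, add_mul]
      map_smul' := fun c p => by ext u; simp [zonalRe, mul_assoc] }
  let zIm : ℕ → ℝ[X] →ₗ[ℝ] C(UnitSphere, ℝ) := fun n =>
    { toFun := fun p => zonalIm p n
      map_add' := fun p q => by ext u; simp [zonalIm, add_mul]
      map_smul' := fun c p => by ext u; simp [zonalIm, mul_assoc] }
  have hRe : ∀ p n, L (zonalRe p n) = 0 := by
    intro p n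
    refine eq_zero_of_iterate_derivative_legendre n (L ∘ₗ zRe n) (fun d => ?_) p
    have h := hcon (n + d) n (by simp)
    have e : ∀ u : UnitSphere, sphericalHarmonic (n + d) n u * g u = harmonicConst (n + d) n *
        (zonalRe (derivative^[n] (legendre (n + d))) n u * g u) := by
      intro u
      have hn : (0 : ℤ) ≤ n := by positivity
      simp only [sphericalHarmonic, harmonicConst, Int.natAbs_natCast, zonalRe,
        ContinuousMap.coe_mk, complexCoord, if_pos hn]
      ring
    simp only [e] at h
    rw [integral_const_mul] at h
    exact (mul_eq_zero.1 h).resolve_left (harmonicConst_ne_zero _ _)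
  have hIm : ∀ p n, L (zonalIm p n) = 0 := by
    intro p n
    rcases Nat.eq_zero_or_pos n with rfl | hn0
    · have : zonalIm p 0 = 0 := by ext u; simp [zonalIm]
      rw [this, map_zero]
    refine eq_zero_of_iterate_derivative_legendre n (L ∘ₗ zIm n) (fun d => ?_) p
    have h := hcon (n + d) (-n) (by simp)
    have e : ∀ u : UnitSphere, sphericalHarmonic (n + d) (-n) u * g u =
        harmonicConst (n + d) (-n) *
        (zonalIm (derivative^[n] (legendre (n + d))) n u * g u) := by
      intro u
      have hn : ¬ (0 : ℤ) ≤ -n := by omega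
      simp only [sphericalHarmonic, harmonicConst, Int.natAbs_neg, Int.natAbs_natCast, zonalIm,
        ContinuousMap.coe_mk, complexCoord, if_neg hn]
      ring
    simp only [e] at h
    rw [integral_const_mul] at h
    exact (mul_eq_zero.1 h).resolve_left (harmonicConst_ne_zero _ _)
  have hspan : ∀ v ∈ zonalSpan, L v = 0 := by
    intro v hv
    have : zonalSpan ≤ LinearMap.ker L := by
      refine Submodule.span_le.2 ?_
      rintro _ (⟨p, n, rfl⟩ | ⟨p, n, rfl⟩)
      · exact hRe p n
      · exact hIm p n
    exact this hv
  -- `∫ g²` is arbitrarily small, since `g` is a uniform limit of polynomials.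
  have hsmall : ∀ ε : ℝ, 0 < ε → ∫ u, g u * g u ∂surface ≤ ε * ∫ u, |g u| ∂surface := by
    intro ε hε
    obtain ⟨⟨v, hv⟩, hvg⟩ :=
      ContinuousMap.exists_mem_subalgebra_near_continuous_of_separatesPoints polynomialAlgebra
        separatesPoints_polynomialAlgebra g hg ε hε
    have h0 : ∫ u, v u * g u ∂surface = 0 := hspan v (mem_zonalSpan_of_mem_polynomialAlgebra hv)
    have h1 : ∫ u, g u * g u ∂surface = ∫ u, (g u * g u - v u * g u) ∂surface := by
      have i1 : Integrable (fun u => g u * g u) surface := integrable_surface (hg.mul hg)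
      have i2 : Integrable (fun u => v u * g u) surface :=
        integrable_surface (v.continuous.mul hg)
      rw [integral_sub i1 i2, h0, sub_zero]
    rw [h1, ← integral_const_mul]
    refine integral_mono (integrable_surface ((hg.mul hg).sub (v.continuous.mul hg)))
      ((integrable_surface hg.abs).const_mul ε) fun u => ?_
    have h2 := (hvg u).le
    rw [Real.norm_eq_abs, abs_sub_comm] at h2
    calc g u * g u - v u * g u = (g u - v u) * g u := by ring
      _ ≤ |(g u - v u) * g u| := le_abs_self _
      _ = |g u - v u| * |g u| := abs_mul _ _
      _ ≤ ε * |g u| := mul_le_mul_of_nonneg_right h2 (abs_nonneg _)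
  have hpos : 0 < ∫ u, g u * g u ∂surface :=
    (hg.mul hg).integral_pos_of_hasCompactSupport_nonneg_nonzero
      (HasCompactSupport.of_compactSpace _) (fun u => mul_self_nonneg (g u))
      (mul_self_ne_zero.2 hu₀)
  have hI0 : 0 ≤ ∫ u, |g u| ∂surface := integral_nonneg fun u => abs_nonneg _
  have h := hsmall ((∫ u, g u * g u ∂surface) / (2 * (∫ u, |g u| ∂surface + 1))) (by positivity)
  set A := ∫ u, g u * g u ∂surface
  set I := ∫ u, |g u| ∂surface
  have h2 : A / (2 * (I + 1)) * I < A := by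
    rw [div_mul_eq_mul_div, div_lt_iff₀ (by positivity)]
    nlinarith
  linarith

end Completeness

/-! ### The modes of the squeezed states -/

section Modes

lemma eps_pos (i : ℕ) : 0 < eps i := by unfold eps; positivity

lemma eps_succ (i : ℕ) : eps (i + 1) = eps i / 2 := by
  unfold eps
  rw [show (1 - ((i + 1 : ℕ) : ℤ)) = (1 - (i : ℤ)) - 1 by push_cast; ring,
    zpow_sub_one₀ two_ne_zero]
  ring

lemma eps_eq (i : ℕ) : eps i = 2 * (1 / 2) ^ i := by
  induction i with
  | zero => simp [eps]
  | succ i ih => rw [eps_succ, ih, pow_succ]; ring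

lemma eps_le_of_le {i j : ℕ} (h : i ≤ j) : eps j ≤ eps i := by
  rw [eps_eq, eps_eq]
  exact mul_le_mul_of_nonneg_left (pow_le_pow_of_le_one (by norm_num) (by norm_num) h) two_pos.le

/-- In units of the frequencies of its shell, the `i`-th mode is emitted at the time `ε_i^r`, which
tends to infinity with `i` exactly if `r < 0`. -/
lemma eps_mul_emissionTime (r : ℝ) (i : ℕ) : eps i * emissionTime r i = eps i ^ r := by
  rw [emissionTime, mul_inv_cancel_left₀ (eps_pos i).ne']

lemma smul_unit_norm {u : Momentum} (hu : ‖u‖ = 1) {x : ℝ} (hx : 0 < x) : ‖x • u‖ = x := by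
  rw [norm_smul, hu, mul_one, Real.norm_eq_abs, abs_of_pos hx]

lemma mode_smul (r : ℝ) (i l : ℕ) (m : ℤ) {u : Momentum} (hu : ‖u‖ = 1) {x : ℝ} (hx : 0 < x) :
    mode r i l m (x • u) = Complex.exp (-Complex.I * ((x * emissionTime r i : ℝ) : ℂ)) *
      ((radialMode i x * sphericalHarmonic l m u : ℝ) : ℂ) := by
  rw [mode, smul_unit_norm hu hx, smul_smul, inv_mul_cancel₀ hx.ne', one_smul]

lemma measurable_radialMode (i : ℕ) : Measurable (radialMode i) := by
  unfold radialMode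
  exact Measurable.indicator (by fun_prop) measurableSet_Icc

lemma measurable_mode (r : ℝ) (i l : ℕ) (m : ℤ) : Measurable (mode r i l m) := by
  unfold mode
  have h1 : Measurable fun k : Momentum => radialMode i ‖k‖ :=
    (measurable_radialMode i).comp measurable_norm
  have h2 : Measurable fun k : Momentum => sphericalHarmonic l m (‖k‖⁻¹ • k) :=
    (continuous_sphericalHarmonic l m).measurable.comp (measurable_norm.inv.smul measurable_id)
  have h3 : Measurable fun k : Momentum =>
      Complex.exp (-Complex.I * ((‖k‖ * emissionTime r i : ℝ) : ℂ)) := by fun_prop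
  exact h3.mul (Complex.measurable_ofReal.comp (h1.mul h2))

lemma exists_sphericalHarmonic_bound (l : ℕ) (m : ℤ) :
    ∃ C, ∀ u : Momentum, ‖u‖ = 1 → |sphericalHarmonic l m u| ≤ C := by
  obtain ⟨C, hC⟩ := (isCompact_sphere (0 : Momentum) 1).exists_bound_of_continuousOn
    (continuous_sphericalHarmonic l m).continuousOn
  exact ⟨C, fun u hu => hC u (mem_sphere_zero_iff_norm.2 hu)⟩

lemma radialMode_of_mem {i : ℕ} {x : ℝ} (hx : x ∈ Set.Icc (eps (i + 1)) (eps i)) :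
    radialMode i x = (Real.log 2) ^ (-(1 / 2) : ℝ) * x ^ (-(3 / 2) : ℝ) :=
  Set.indicator_of_mem hx _

lemma radialMode_of_notMem {i : ℕ} {x : ℝ} (hx : x ∉ Set.Icc (eps (i + 1)) (eps i)) :
    radialMode i x = 0 :=
  Set.indicator_of_notMem hx _

lemma log_two_pos : 0 < Real.log 2 := Real.log_pos one_lt_two

lemma memLp_mode (r : ℝ) (i l : ℕ) (m : ℤ) : MemLp (mode r i l m) 2 volume := by
  obtain ⟨C, hC⟩ := exists_sphericalHarmonic_bound l m
  have hsupp : mode r i l m =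
      (Metric.closedBall (0 : Momentum) (eps i)).indicator (mode r i l m) := by
    funext k
    by_cases hk : k ∈ Metric.closedBall (0 : Momentum) (eps i)
    · rw [Set.indicator_of_mem hk]
    · rw [Set.indicator_of_notMem hk, mode, radialMode_of_notMem]
      · simp
      · rw [mem_closedBall_zero_iff] at hk
        exact fun h => hk h.2
  rw [hsupp, memLp_indicator_iff_restrict measurableSet_closedBall]
  have : IsFiniteMeasure ((volume : Measure Momentum).restrict
      (Metric.closedBall (0 : Momentum) (eps i))) :=
    ⟨by rw [Measure.restrict_apply_univ]; exact measure_closedBall_lt_top⟩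
  refine MemLp.of_bound (measurable_mode r i l m).aestronglyMeasurable
    ((Real.log 2) ^ (-(1 / 2) : ℝ) * eps (i + 1) ^ (-(3 / 2) : ℝ) * C) (ae_of_all _ fun k => ?_)
  have hlog : 0 ≤ (Real.log 2) ^ (-(1 / 2) : ℝ) := Real.rpow_nonneg log_two_pos.le _
  have he : 0 ≤ eps (i + 1) ^ (-(3 / 2) : ℝ) := Real.rpow_nonneg (eps_pos _).le _
  have hexp : ‖Complex.exp (-Complex.I * ((‖k‖ * emissionTime r i : ℝ) : ℂ))‖ = 1 := by
    rw [Complex.norm_exp]; simp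
  rw [mode, norm_mul, hexp, one_mul, Complex.norm_real, Real.norm_eq_abs, abs_mul]
  by_cases hk : ‖k‖ ∈ Set.Icc (eps (i + 1)) (eps i)
  · have hk0 : 0 < ‖k‖ := (eps_pos _).trans_le hk.1
    have hu : ‖‖k‖⁻¹ • k‖ = 1 := by
      rw [norm_smul, norm_inv, norm_norm, inv_mul_cancel₀ hk0.ne']
    have h1 : ‖k‖ ^ (-(3 / 2) : ℝ) ≤ eps (i + 1) ^ (-(3 / 2) : ℝ) :=
      Real.rpow_le_rpow_of_nonpos (eps_pos _) hk.1 (by norm_num)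
    rw [radialMode_of_mem hk, abs_of_nonneg (mul_nonneg hlog (Real.rpow_nonneg hk0.le _))]
    exact mul_le_mul (mul_le_mul_of_nonneg_left h1 hlog) (hC _ hu) (abs_nonneg _)
      (mul_nonneg hlog he)
  · have hC0 : 0 ≤ C := (abs_nonneg _).trans (hC (sphericalPoint 0 0) (norm_sphericalPoint 0 0))
    rw [radialMode_of_notMem hk, abs_zero, zero_mul]
    exact mul_nonneg (mul_nonneg hlog he) hC0

lemma integral_sq_mul_radialMode_sq (i : ℕ) :
    ∫ x in Set.Ioi (0 : ℝ), x ^ 2 * (radialMode i x * radialMode i x) = 1 := by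
  have hlog := log_two_pos
  have e : ∀ x ∈ Set.Ioi (0 : ℝ), x ^ 2 * (radialMode i x * radialMode i x) =
      (Set.Icc (eps (i + 1)) (eps i)).indicator (fun x => (Real.log 2)⁻¹ * x⁻¹) x := by
    intro x hx
    have hx' : (0 : ℝ) < x := hx
    by_cases h : x ∈ Set.Icc (eps (i + 1)) (eps i)
    · rw [radialMode_of_mem h, Set.indicator_of_mem h, mul_mul_mul_comm, ← Real.rpow_add hlog,
        ← Real.rpow_add hx', mul_left_comm, ← Real.rpow_natCast x 2, ← Real.rpow_add hx']
      norm_num [Real.rpow_neg_one]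
    · rw [radialMode_of_notMem h, Set.indicator_of_notMem h]; ring
  have hsub : Set.Icc (eps (i + 1)) (eps i) ⊆ Set.Ioi 0 := fun x hx => (eps_pos _).trans_le hx.1
  rw [setIntegral_congr_fun measurableSet_Ioi e, setIntegral_indicator measurableSet_Icc,
    Set.inter_eq_right.2 hsub, integral_const_mul,
    integral_Icc_eq_integral_Ioc, ← intervalIntegral.integral_of_le (eps_le_of_le i.le_succ),
    integral_inv_of_pos (eps_pos _) (eps_pos _), eps_succ,
    show eps i / (eps i / 2) = 2 by have := (eps_pos i).ne'; field_simp]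
  exact inv_mul_cancel₀ hlog.ne'

/-- Different shells overlap at most in one common endpoint. -/
lemma radialMode_mul_ae_eq_zero {i j : ℕ} (h : i ≠ j) :
    ∀ᵐ x : ℝ, radialMode i x * radialMode j x = 0 := by
  have hnull : ∀ᵐ x : ℝ, x ≠ eps (i + 1) ∧ x ≠ eps (j + 1) := by
    have h1 : ∀ a : ℝ, ∀ᵐ x : ℝ, x ≠ a := fun a => by simp [ae_iff]
    exact (h1 _).and (h1 _)
  filter_upwards [hnull] with x hx
  by_contra hne
  have hi : x ∈ Set.Icc (eps (i + 1)) (eps i) := by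
    by_contra h'; exact hne (by rw [radialMode_of_notMem h', zero_mul])
  have hj : x ∈ Set.Icc (eps (j + 1)) (eps j) := by
    by_contra h'; exact hne (by rw [radialMode_of_notMem h', mul_zero])
  rcases lt_or_gt_of_ne h with h | h
  · exact hx.1 (le_antisymm (hj.2.trans (eps_le_of_le h)) hi.1)
  · exact hx.2 (le_antisymm (hi.2.trans (eps_le_of_le h)) hj.1)

lemma l2Inner_mode_mode (r : ℝ) (i l i' l' : ℕ) (m m' : ℤ) (hm : m.natAbs ≤ l) :
    l2Inner volume (mode r i l m) (mode r i' l' m') =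
      if i = i' ∧ l = l' ∧ m = m' then 1 else 0 := by
  have e : ∀ p : UnitSphere × Set.Ioi (0 : ℝ),
      (starRingEnd ℂ) (mode r i l m ((p.2 : ℝ) • (p.1 : Momentum))) *
        mode r i' l' m' ((p.2 : ℝ) • (p.1 : Momentum)) =
      ((sphericalHarmonic l m p.1 * sphericalHarmonic l' m' p.1 : ℝ) : ℂ) *
        (Complex.exp (Complex.I * (((p.2 : ℝ) * (emissionTime r i - emissionTime r i') : ℝ) : ℂ)) *
          ((radialMode i p.2 * radialMode i' p.2 : ℝ) : ℂ)) := by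
    rintro ⟨u, x, hx⟩
    rw [mode_smul r i l m (norm_unitSphere u) hx, mode_smul r i' l' m' (norm_unitSphere u) hx,
      map_mul, Complex.conj_ofReal, ← Complex.exp_conj, map_mul, map_neg, Complex.conj_I,
      Complex.conj_ofReal, neg_neg]
    have : Complex.exp (Complex.I * ((x * (emissionTime r i - emissionTime r i') : ℝ) : ℂ)) =
        Complex.exp (Complex.I * ((x * emissionTime r i : ℝ) : ℂ)) *
        Complex.exp (-Complex.I * ((x * emissionTime r i' : ℝ) : ℂ)) := by
      rw [← Complex.exp_add]; congr 1; push_cast; ring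
    rw [this]; push_cast; ring
  rw [l2Inner, integral_polar_prod]
  simp only [e]
  rw [integral_prod_mul (fun u : UnitSphere =>
    ((sphericalHarmonic l m u * sphericalHarmonic l' m' u : ℝ) : ℂ))
    (fun x : Set.Ioi (0 : ℝ) =>
      Complex.exp (Complex.I * (((x : ℝ) * (emissionTime r i - emissionTime r i') : ℝ) : ℂ)) *
          ((radialMode i x * radialMode i' x : ℝ) : ℂ)), integral_complex_ofReal,
    integral_sphericalHarmonic_mul hm,
    integral_volumeIoiPow 2 (fun x : ℝ =>
      Complex.exp (Complex.I * ((x * (emissionTime r i - emissionTime r i') : ℝ) : ℂ)) *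
          ((radialMode i x * radialMode i' x : ℝ) : ℂ))]
  by_cases hlm : l = l' ∧ m = m'
  · rw [if_pos hlm, Complex.ofReal_one, one_mul]
    by_cases hi : i = i'
    · subst hi
      rw [if_pos ⟨rfl, hlm⟩]
      have e2 : ∀ x : ℝ, x ^ 2 • (Complex.exp (Complex.I *
          ((x * (emissionTime r i - emissionTime r i) : ℝ) : ℂ)) *
          ((radialMode i x * radialMode i x : ℝ) : ℂ)) =
          ((x ^ 2 * (radialMode i x * radialMode i x) : ℝ) : ℂ) := by
        intro x
        rw [sub_self, mul_zero, Complex.ofReal_zero, mul_zero, Complex.exp_zero, one_mul,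
          Complex.real_smul]
        push_cast; ring
      simp only [e2]
      rw [integral_complex_ofReal, integral_sq_mul_radialMode_sq, Complex.ofReal_one]
    · rw [if_neg (fun h => hi h.1)]
      refine integral_eq_zero_of_ae (ae_restrict_of_ae ?_)
      filter_upwards [radialMode_mul_ae_eq_zero hi] with x hx
      rw [hx]; simp
  · rw [if_neg hlm, if_neg (fun h => hlm h.2), Complex.ofReal_zero, zero_mul]

/-- The indices `(l, m)` of the modes in the `i`-th shell. -/
def shellIndex (i : ℕ) : Finset (Σ _ : ℕ, ℤ) :=
  (Finset.range (i + 1)).sigma fun l => Finset.Icc (-(l : ℤ)) (l : ℤ)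

/-- The indices `(i, l, m)` of the modes in the first `n` shells. -/
def modeIndex (n : ℕ) : Finset (Σ _ : ℕ, Σ _ : ℕ, ℤ) :=
  (Finset.Icc 1 n).sigma shellIndex

/-- The modes as a family with a single index. -/
def modeFamily (r : ℝ) (b : Σ _ : ℕ, Σ _ : ℕ, ℤ) : Momentum → ℂ := mode r b.1 b.2.1 b.2.2

/-- The squeezing parameter `t_i = (1 - b_i²) / (1 + b_i²)`. -/
def squeezing (b : Σ _ : ℕ, Σ _ : ℕ, ℤ) : ℝ := -bHatInv b.1

lemma natAbs_le_of_mem_shellIndex {i : ℕ} {b : Σ _ : ℕ, ℤ} (h : b ∈ shellIndex i) :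
    b.2.natAbs ≤ b.1 := by
  have := Finset.mem_Icc.1 (Finset.mem_sigma.1 h).2
  omega

lemma isOrthonormal_modeFamily (r : ℝ) (n : ℕ) :
    IsOrthonormal volume (modeIndex n) (modeFamily r) where
  memLp b := memLp_mode r _ _ _
  inner_eq := by
    rintro ⟨i, l, m⟩ ha ⟨i', l', m'⟩ -
    have hm := natAbs_le_of_mem_shellIndex (Finset.mem_sigma.1 ha).2
    simp only [modeFamily]
    rw [l2Inner_mode_mode r i l i' l' m m' hm]
    simp

lemma isOrthonormal_sphericalHarmonic (i : ℕ) :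
    IsOrthonormal surface (shellIndex i)
      fun (b : Σ _ : ℕ, ℤ) (u : UnitSphere) => ((sphericalHarmonic b.1 b.2 u : ℝ) : ℂ) where
  memLp b := by
    obtain ⟨C, hC⟩ := exists_sphericalHarmonic_bound b.1 b.2
    refine MemLp.of_bound (Complex.measurable_ofReal.comp
      ((continuous_sphericalHarmonic _ _).measurable.comp
        measurable_subtype_coe)).aestronglyMeasurable C (ae_of_all _ fun u => ?_)
    rw [Complex.norm_real]
    exact hC u (norm_unitSphere u)
  inner_eq := by
    rintro ⟨l, m⟩ ha ⟨l', m'⟩ -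
    have hm := natAbs_le_of_mem_shellIndex ha
    have := integral_sphericalHarmonic_mul (l' := l') (m' := m') hm
    simp only [l2Inner, Complex.conj_ofReal, ← Complex.ofReal_mul]
    rw [integral_complex_ofReal, this]
    by_cases h : l = l' ∧ m = m' <;> simp [h]

lemma pairCreation_eq (r : ℝ) (n : ℕ) :
    pairCreation r n = pairOp (modeIndex n) (modeFamily r) squeezing := by
  funext Φ
  rw [pairCreation, pairOp, modeIndex, Finset.sum_sigma]
  refine Finset.sum_congr rfl fun i _ => ?_
  rw [shellIndex, Finset.sum_sigma]
  refine Finset.sum_congr rfl fun l _ => Finset.sum_congr rfl fun m _ => ?_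
  simp only [modeFamily, squeezing]
  rw [show -(1 / 2) * bHatInv i = -bHatInv i / 2 by ring]

lemma squeezed_eq (r : ℝ) (n : ℕ) :
    squeezed r n = squeezedVector (modeIndex n) (modeFamily r) squeezing := by
  funext N k
  simp only [squeezed, pairCreation_eq]
  rfl

lemma neg_bHatInv {i : ℕ} (hi : 1 ≤ i) :
    -bHatInv i = ((i : ℝ) ^ 2 - 1) / ((i : ℝ) ^ 2 + 1) := by
  have h : (i : ℝ) ≠ 0 := by positivity
  rw [bHatInv, bCoeff]
  field_simp
  ring

lemma squeezing_sq_lt_one {n : ℕ} : ∀ b ∈ modeIndex n, squeezing b ^ 2 < 1 := by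
  rintro ⟨i, b⟩ hb
  have hi := (Finset.mem_Icc.1 (Finset.mem_sigma.1 hb).1).1
  simp only [squeezing]
  have h : (1 : ℝ) ≤ i := by exact_mod_cast hi
  rw [neg_bHatInv hi, div_pow, div_lt_one (by positivity)]
  nlinarith

/-- The contribution of the `i`-th shell to twice the fluctuations of the field with wave
function `F`. -/
def shellTerm (r : ℝ) (F : Momentum → ℂ) (i : ℕ) : ℝ :=
  ∑ b ∈ shellIndex i, (((i : ℝ) ^ 2 - 1) * (l2Inner volume (mode r i b.1 b.2) F).re ^ 2 +
    (1 / (i : ℝ) ^ 2 - 1) * (l2Inner volume (mode r i b.1 b.2) F).im ^ 2)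

/-- The fluctuations of the field in the vector states defining the state `ω_r`. -/
theorem expectationSq_squeezed (r : ℝ) (n : ℕ) {F : Momentum → ℂ} (hF : MemLp F 2 volume) :
    expectationSq (squeezed r n) (segalField F) =
      ENNReal.ofReal (1 / 2 * (l2Sq volume F + ∑ i ∈ Finset.Icc 1 n, shellTerm r F i)) := by
  rw [squeezed_eq, expectationSq_squeezedVector (isOrthonormal_modeFamily r n)
    squeezing_sq_lt_one hF, modeIndex, Finset.sum_sigma]
  congr 3
  refine Finset.sum_congr rfl fun i hi => Finset.sum_congr rfl fun b _ => ?_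
  have hi1 := (Finset.mem_Icc.1 hi).1
  have h : (i : ℝ) ≠ 0 := by positivity
  simp only [squeezing, modeFamily]
  rw [neg_bHatInv hi1]
  have h1 : (1 + ((i : ℝ) ^ 2 - 1) / ((i : ℝ) ^ 2 + 1)) /
      (1 - ((i : ℝ) ^ 2 - 1) / ((i : ℝ) ^ 2 + 1)) = (i : ℝ) ^ 2 := by
    have h2 : ((i : ℝ) ^ 2 + 1) ≠ 0 := by positivity
    have h3 : 1 - ((i : ℝ) ^ 2 - 1) / ((i : ℝ) ^ 2 + 1) = 2 / ((i : ℝ) ^ 2 + 1) := by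
      field_simp; ring
    rw [h3]; field_simp; ring
  have h4 : (1 - ((i : ℝ) ^ 2 - 1) / ((i : ℝ) ^ 2 + 1)) /
      (1 + ((i : ℝ) ^ 2 - 1) / ((i : ℝ) ^ 2 + 1)) = 1 / (i : ℝ) ^ 2 := by
    rw [← one_div_div, h1]
  rw [h1, h4]

end Modes

/-! ### Oscillatory integrals -/

section Oscillatory

variable {α : Type*} [MeasurableSpace α] {μ : Measure α} {Φ : α → ℝ} {w : α → ℂ}

/-- The oscillatory integral `∫ exp(i κ Φ) w`. -/
def oscillatory (μ : Measure α) (Φ : α → ℝ) (w : α → ℂ) (κ : ℝ) : ℂ :=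
  ∫ a, Complex.exp (Complex.I * ((κ * Φ a : ℝ) : ℂ)) * w a ∂μ

lemma norm_exp_I_mul_ofReal (x : ℝ) : ‖Complex.exp (Complex.I * (x : ℂ))‖ = 1 := by
  rw [mul_comm, Complex.norm_exp_ofReal_mul_I]

lemma aestronglyMeasurable_exp_phase (hΦ : AEStronglyMeasurable Φ μ) (κ : ℝ) :
    AEStronglyMeasurable (fun a => Complex.exp (Complex.I * ((κ * Φ a : ℝ) : ℂ))) μ :=
  (show Continuous fun x : ℝ => Complex.exp (Complex.I * ((κ * x : ℝ) : ℂ)) by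
    fun_prop).comp_aestronglyMeasurable hΦ

lemma norm_oscillatory_le (κ : ℝ) : ‖oscillatory μ Φ w κ‖ ≤ ∫ a, ‖w a‖ ∂μ := by
  refine (norm_integral_le_integral_norm _).trans_eq (integral_congr_ae (ae_of_all _ fun a => ?_))
  simp only [norm_mul, norm_exp_I_mul_ofReal, one_mul]

lemma integrable_exp_phase_mul (hΦ : AEStronglyMeasurable Φ μ) (hw : Integrable w μ) (κ : ℝ) :
    Integrable (fun a => Complex.exp (Complex.I * ((κ * Φ a : ℝ) : ℂ)) * w a) μ :=
  hw.bdd_mul (aestronglyMeasurable_exp_phase hΦ κ)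
    (ae_of_all _ fun _ => (norm_exp_I_mul_ofReal _).le)

lemma hasDerivAt_oscillatory (hΦ : AEStronglyMeasurable Φ μ) (hw : Integrable w μ)
    (hΦw : Integrable (fun a => Complex.I * (Φ a : ℂ) * w a) μ) (κ : ℝ) :
    HasDerivAt (oscillatory μ Φ w)
      (oscillatory μ Φ (fun a => Complex.I * (Φ a : ℂ) * w a) κ) κ := by
  refine (hasDerivAt_integral_of_dominated_loc_of_deriv_le (s := Set.univ) (x₀ := κ)
    (F := fun κ a => Complex.exp (Complex.I * ((κ * Φ a : ℝ) : ℂ)) * w a)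
    (F' := fun κ a => Complex.exp (Complex.I * ((κ * Φ a : ℝ) : ℂ)) *
      (Complex.I * (Φ a : ℂ) * w a))
    (bound := fun a => ‖Complex.I * (Φ a : ℂ) * w a‖) univ_mem
    (Eventually.of_forall fun x => (integrable_exp_phase_mul hΦ hw x).aestronglyMeasurable)
    (integrable_exp_phase_mul hΦ hw κ) (integrable_exp_phase_mul hΦ hΦw κ).aestronglyMeasurable
    (ae_of_all _ fun a x _ => ?_) hΦw.norm (ae_of_all _ fun a x _ => ?_)).2
  · rw [norm_mul, norm_exp_I_mul_ofReal, one_mul]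
  · have h1 : HasDerivAt (fun x : ℝ => Complex.I * ((x * Φ a : ℝ) : ℂ))
        (Complex.I * (Φ a : ℂ)) x := by
      have := ((hasDerivAt_id x).mul_const (Φ a)).ofReal_comp.const_mul Complex.I
      simpa using this
    exact (h1.cexp.mul_const (w a)).congr_deriv (by ring)

lemma oscillatory_sum_mul {ι : Type*} (s : Finset ι) (c : ι → ℂ) {w : ι → α → ℂ}
    (hΦ : AEStronglyMeasurable Φ μ) (hw : ∀ i, Integrable (w i) μ) (κ : ℝ) :
    oscillatory μ Φ (fun p => ∑ i ∈ s, c i * w i p) κ =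
      ∑ i ∈ s, c i * oscillatory μ Φ (w i) κ := by
  simp only [oscillatory, Finset.mul_sum, ← integral_const_mul]
  rw [← integral_finsetSum]
  · exact integral_congr_ae (ae_of_all _ fun p => Finset.sum_congr rfl fun i _ => by ring)
  · exact fun i _ => (integrable_exp_phase_mul hΦ (hw i) κ).const_mul _

lemma integrable_phase_pow_mul (hΦ : AEStronglyMeasurable Φ μ) (hw : Integrable w μ) {B : ℝ}
    (hB : ∀ a, w a ≠ 0 → |Φ a| ≤ B) (n : ℕ) :
    Integrable (fun a => (Complex.I * (Φ a : ℂ)) ^ n * w a) μ := by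
  refine (hw.norm.const_mul (B ^ n)).mono' ?_ (ae_of_all _ fun a => ?_)
  · exact ((show Continuous fun x : ℝ => (Complex.I * (x : ℂ)) ^ n by
      fun_prop).comp_aestronglyMeasurable hΦ).mul hw.aestronglyMeasurable
  · by_cases h : w a = 0
    · simp [h]
    · rw [norm_mul, norm_pow, norm_mul, Complex.norm_I, one_mul, Complex.norm_real]
      exact mul_le_mul_of_nonneg_right (pow_le_pow_left₀ (norm_nonneg _) (hB a h) n)
        (norm_nonneg _)

/-- The power series of an oscillatory integral with bounded phase. -/
lemma hasSum_oscillatory (hΦ : AEStronglyMeasurable Φ μ) (hw : Integrable w μ) {B : ℝ}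
    (hB : ∀ a, w a ≠ 0 → |Φ a| ≤ B) (κ : ℝ) :
    HasSum (fun n : ℕ => ((κ ^ n / (Nat.factorial n : ℝ) : ℝ) : ℂ) *
      ∫ a, (Complex.I * (Φ a : ℂ)) ^ n * w a ∂μ) (oscillatory μ Φ w κ) := by
  have hint := integrable_phase_pow_mul hΦ hw hB
  simp only [← integral_const_mul]
  have key := hasSum_integral_of_summable_integral_norm (μ := μ)
    (F := fun (n : ℕ) a => ((κ ^ n / (Nat.factorial n : ℝ) : ℝ) : ℂ) *
      ((Complex.I * (Φ a : ℂ)) ^ n * w a)) (fun n => (hint n).const_mul _) ?_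
  · suffices e : oscillatory μ Φ w κ = ∫ a, ∑' n : ℕ, ((κ ^ n / (Nat.factorial n : ℝ) : ℝ) : ℂ) *
        ((Complex.I * (Φ a : ℂ)) ^ n * w a) ∂μ by rwa [e]
    refine integral_congr_ae (ae_of_all _ fun a => ?_)
    have h := (NormedSpace.expSeries_div_hasSum_exp
      (Complex.I * ((κ * Φ a : ℝ) : ℂ))).mul_right (w a)
    rw [← Complex.exp_eq_exp_ℂ] at h
    simp only
    rw [← h.tsum_eq]
    refine tsum_congr fun n => ?_
    push_cast
    ring
  · refine Summable.of_nonneg_of_le (fun n => integral_nonneg fun a => norm_nonneg _) (fun n => ?_)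
      ((Real.summable_pow_div_factorial (|κ| * |B|)).mul_right (∫ a, ‖w a‖ ∂μ))
    rw [← integral_const_mul]
    refine integral_mono ((hint n).const_mul _).norm (hw.norm.const_mul _) fun a => ?_
    by_cases h : w a = 0
    · simp [h]
    · simp only
      rw [norm_mul, norm_mul, Complex.norm_real, norm_pow, norm_mul, Complex.norm_I, one_mul,
        Complex.norm_real, norm_div, norm_pow, Real.norm_natCast, ← mul_assoc, mul_pow,
        div_mul_eq_mul_div]
      gcongr
      · exact le_rfl
      · exact (hB a h).trans (le_abs_self B)

/-- If the real part of an oscillatory integral vanishes for positive parameters, then so do the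
real parts of its Taylor coefficients at zero. -/
lemma re_moment_eq_zero (hΦ : AEStronglyMeasurable Φ μ) (hw : Integrable w μ) {B : ℝ}
    (hB : ∀ a, w a ≠ 0 → |Φ a| ≤ B) (h : ∀ κ > 0, (oscillatory μ Φ w κ).re = 0) (n : ℕ) :
    (∫ a, (Complex.I * (Φ a : ℂ)) ^ n * w a ∂μ).re = 0 := by
  have hint := integrable_phase_pow_mul hΦ hw hB
  have hder : ∀ n κ, HasDerivAt (oscillatory μ Φ fun a => (Complex.I * (Φ a : ℂ)) ^ n * w a)
      (oscillatory μ Φ (fun a => (Complex.I * (Φ a : ℂ)) ^ (n + 1) * w a) κ) κ := by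
    intro n κ
    have e : (fun a => Complex.I * (Φ a : ℂ) * ((Complex.I * (Φ a : ℂ)) ^ n * w a)) =
        fun a => (Complex.I * (Φ a : ℂ)) ^ (n + 1) * w a := by funext a; ring
    have := hasDerivAt_oscillatory hΦ (hint n) (by rw [e]; exact hint (n + 1)) κ
    rwa [e] at this
  have hre : ∀ n κ, HasDerivAt (fun κ =>
      (oscillatory μ Φ (fun a => (Complex.I * (Φ a : ℂ)) ^ n * w a) κ).re)
      (oscillatory μ Φ (fun a => (Complex.I * (Φ a : ℂ)) ^ (n + 1) * w a) κ).re κ := fun n κ =>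
    Complex.reCLM.hasFDerivAt.comp_hasDerivAt κ (hder n κ)
  have hzero : ∀ n, ∀ κ > 0,
      (oscillatory μ Φ (fun a => (Complex.I * (Φ a : ℂ)) ^ n * w a) κ).re = 0 := by
    intro n
    induction n with
    | zero => simpa using h
    | succ n ih =>
      intro κ hκ
      refine (hre n κ).unique ((hasDerivAt_const κ (0 : ℝ)).congr_of_eventuallyEq ?_)
      filter_upwards [lt_mem_nhds hκ] with x hx using ih x hx
  have hcont : Tendsto (fun κ : ℝ =>
      (oscillatory μ Φ (fun a => (Complex.I * (Φ a : ℂ)) ^ n * w a) κ).re) (𝓝[>] 0)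
      (𝓝 (oscillatory μ Φ (fun a => (Complex.I * (Φ a : ℂ)) ^ n * w a) 0).re) :=
    (hre n 0).continuousAt.tendsto.mono_left nhdsWithin_le_nhds
  have hlim := tendsto_nhds_unique hcont (tendsto_const_nhds.congr'
    (eventually_mem_nhdsWithin.mono fun κ hκ => (hzero n κ hκ).symm))
  simpa [oscillatory] using hlim

lemma integral_pow_mul_cos_pos {θ : ℝ} (h0 : 0 ≤ θ) (h1 : θ ≤ 1) (n : ℕ) :
    0 < ∫ x in (1 / 2 : ℝ)..1, x ^ n * Real.cos (x * θ) := by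
  refine intervalIntegral.intervalIntegral_pos_of_pos_on
    ((show Continuous fun x : ℝ => x ^ n * Real.cos (x * θ) by fun_prop).intervalIntegrable _ _)
    (fun x hx => ?_) (by norm_num)
  have hx0 : 0 < x := lt_trans (by norm_num) hx.1
  have hpi := Real.pi_gt_three
  refine mul_pos (pow_pos hx0 n) (Real.cos_pos_of_mem_Ioo ⟨?_, ?_⟩)
  · have := mul_nonneg hx0.le h0
    linarith
  · have := mul_le_one₀ hx.2.le h0 h1
    linarith

/-- The windowed average of an oscillatory integral with real weight has a nonvanishing real part
somewhere if the integral itself has: the even moments of the phase, which determine the real part,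
enter the Taylor coefficients of the average with positive factors. -/
lemma exists_re_average_oscillatory_ne_zero [SFinite μ] {g : α → ℝ} (hΦ : AEStronglyMeasurable Φ μ)
    (hg : Integrable g μ) {B : ℝ} (hB : ∀ a, g a ≠ 0 → |Φ a| ≤ B) {θ : ℝ} (h0 : 0 ≤ θ)
    (h1 : θ ≤ 1) {κ : ℝ} (hκ : (oscillatory μ Φ (fun a => (g a : ℂ)) κ).re ≠ 0) :
    ∃ ρ > 0, (∫ x in (1 / 2 : ℝ)..1, Complex.exp (Complex.I * ((x * θ : ℝ) : ℂ)) *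
      oscillatory μ Φ (fun a => (g a : ℂ)) (ρ * x)).re ≠ 0 := by
  by_contra! hcon
  apply hκ
  set ν : Measure ℝ := volume.restrict (Set.Ioc (1 / 2) 1) with hν
  have hgc : Integrable (fun a => (g a : ℂ)) μ := hg.ofReal
  have hexp : Integrable (fun x : ℝ => Complex.exp (Complex.I * ((x * θ : ℝ) : ℂ))) ν :=
    ((show Continuous fun x : ℝ => Complex.exp (Complex.I * ((x * θ : ℝ) : ℂ)) by
      fun_prop).integrableOn_Icc (a := 1 / 2) (b := 1)).mono_set Set.Ioc_subset_Icc_self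
  -- the average is an oscillatory integral on the product space; the cutoff keeps its phase bounded
  set Φ' : ℝ × α → ℝ := fun p => (Set.Ioc (1 / 2 : ℝ) 1).indicator id p.1 * Φ p.2 with hΦ'
  set w' : ℝ × α → ℂ := fun p => Complex.exp (Complex.I * ((p.1 * θ : ℝ) : ℂ)) * (g p.2 : ℂ)
  have hmeas : AEStronglyMeasurable Φ' (ν.prod μ) :=
    ((measurable_id.indicator measurableSet_Ioc).comp measurable_fst).aestronglyMeasurable.mul
      hΦ.comp_snd
  have hw' : Integrable w' (ν.prod μ) := hexp.mul_prod hgc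
  have hB' : ∀ p, w' p ≠ 0 → |Φ' p| ≤ B := by
    rintro ⟨x, a⟩ hp
    have hga : g a ≠ 0 := fun h => hp (by simp [w', h])
    have hx : |(Set.Ioc (1 / 2 : ℝ) 1).indicator id x| ≤ 1 := by
      by_cases hx : x ∈ Set.Ioc (1 / 2 : ℝ) 1
      · rw [Set.indicator_of_mem hx, id, abs_le]
        constructor <;> linarith [hx.1, hx.2]
      · rw [Set.indicator_of_notMem hx]; simp
    simp only [hΦ', abs_mul]
    exact (mul_le_of_le_one_left (abs_nonneg _) hx).trans (hB a hga)
  have hmem : ∀ᵐ x ∂ν, x ∈ Set.Ioc (1 / 2 : ℝ) 1 := ae_restrict_mem measurableSet_Ioc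
  have hzero : ∀ ρ > 0, (oscillatory (ν.prod μ) Φ' w' ρ).re = 0 := by
    intro ρ hρ
    rw [oscillatory, integral_prod _ (integrable_exp_phase_mul hmeas hw' ρ), ← hcon ρ hρ,
      intervalIntegral.integral_of_le (by norm_num)]
    congr 1
    refine integral_congr_ae ?_
    filter_upwards [hmem] with x hx
    rw [oscillatory, ← integral_const_mul]
    refine integral_congr_ae (ae_of_all _ fun a => ?_)
    simp only [hΦ', w', Set.indicator_of_mem hx, id]
    rw [← mul_assoc ρ]
    ring
  have hmom := re_moment_eq_zero hmeas hw' hB' hzero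
  have hBc : ∀ a, (g a : ℂ) ≠ 0 → |Φ a| ≤ B := fun a h => hB a (by simpa using h)
  have heven : ∀ m : ℕ, (∫ a, (Complex.I * (Φ a : ℂ)) ^ (2 * m) * (g a : ℂ) ∂μ).re = 0 := by
    intro m
    have hreal : (∫ a, (Complex.I * (Φ a : ℂ)) ^ (2 * m) * (g a : ℂ) ∂μ) =
        ((∫ a, (-1) ^ m * Φ a ^ (2 * m) * g a ∂μ : ℝ) : ℂ) := by
      rw [← integral_complex_ofReal]
      refine integral_congr_ae (ae_of_all _ fun a => ?_)
      simp only
      rw [mul_pow, pow_mul Complex.I, Complex.I_sq]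
      push_cast
      ring
    have hprod : (∫ p, (Complex.I * (Φ' p : ℂ)) ^ (2 * m) * w' p ∂(ν.prod μ)) =
        (∫ x in (1 / 2 : ℝ)..1, ((x ^ (2 * m) : ℝ) : ℂ) *
          Complex.exp (Complex.I * ((x * θ : ℝ) : ℂ))) *
        (∫ a, (Complex.I * (Φ a : ℂ)) ^ (2 * m) * (g a : ℂ) ∂μ) := by
      rw [intervalIntegral.integral_of_le (by norm_num), ← integral_prod_mul]
      refine integral_congr_ae ?_
      have hmem' : ∀ᵐ p : ℝ × α ∂(ν.prod μ), p.1 ∈ Set.Ioc (1 / 2 : ℝ) 1 :=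
        Measure.quasiMeasurePreserving_fst.ae hmem
      filter_upwards [hmem'] with p hp
      simp only [hΦ', w', Set.indicator_of_mem hp, id]
      push_cast
      ring
    have hpart : (∫ x in (1 / 2 : ℝ)..1, ((x ^ (2 * m) : ℝ) : ℂ) *
          Complex.exp (Complex.I * ((x * θ : ℝ) : ℂ))).re =
        ∫ x in (1 / 2 : ℝ)..1, x ^ (2 * m) * Real.cos (x * θ) := by
      have := Complex.reCLM.intervalIntegral_comp_comm (μ := volume) (a := (1 / 2 : ℝ)) (b := 1)
        (f := fun x : ℝ => ((x ^ (2 * m) : ℝ) : ℂ) *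
          Complex.exp (Complex.I * ((x * θ : ℝ) : ℂ)))
        ((by fun_prop : Continuous _).intervalIntegrable _ _)
      rw [← Complex.reCLM_apply, ← this]
      refine intervalIntegral.integral_congr fun x _ => ?_
      rw [Complex.reCLM_apply, Complex.re_ofReal_mul, mul_comm Complex.I, Complex.exp_ofReal_mul_I_re]
    have := hmom (2 * m)
    rw [hprod, hreal, Complex.re_mul_ofReal, hpart] at this
    rw [hreal, Complex.ofReal_re]
    exact (mul_eq_zero.1 this).resolve_left (integral_pow_mul_cos_pos h0 h1 _).ne'
  have hsum := Complex.hasSum_re (hasSum_oscillatory hΦ hgc hBc κ)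
  refine hsum.unique ?_
  convert hasSum_zero using 2 with n
  rw [Complex.re_ofReal_mul]
  obtain ⟨m, rfl | rfl⟩ := n.even_or_odd'
  · rw [heven, mul_zero]
  · have : (∫ a, (Complex.I * (Φ a : ℂ)) ^ (2 * m + 1) * (g a : ℂ) ∂μ) =
        Complex.I * ((∫ a, (-1) ^ m * Φ a ^ (2 * m + 1) * g a ∂μ : ℝ) : ℂ) := by
      rw [← integral_complex_ofReal, ← integral_const_mul]
      refine integral_congr_ae (ae_of_all _ fun a => ?_)
      simp only
      rw [mul_pow, pow_succ Complex.I, pow_mul Complex.I, Complex.I_sq]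
      push_cast
      ring
    rw [this, Complex.I_mul_re, Complex.ofReal_im, neg_zero, mul_zero]

end Oscillatory

/-! ### Waves on the mass shell -/

section Waves

variable {E : Type*} [NormedAddCommGroup E] [NormedSpace ℝ E]

/-- Time and space coordinates `T` and `X` on `E`, with a section `V` of `X` along which the time is
constant. It is satisfied both by spacetime and by a time slice. -/
structure IsSlicing (T : E → ℝ) (X : E →L[ℝ] Space) (V : Space →L[ℝ] E) : Prop where
  contDiff : ContDiff ℝ (⊤ : ℕ∞) T
  time_add : ∀ p v, T (p + V v) = T p
  right_inv : ∀ v, X (V v) = v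

/-- The phase `t - u · x` of a wave of unit frequency in the direction `u`. -/
def phase (T : E → ℝ) (X : E →L[ℝ] Space) (u : Momentum) (p : E) : ℝ := T p - inner ℝ u (X p)

variable {T : E → ℝ} {X : E →L[ℝ] Space} {V : Space →L[ℝ] E}

lemma IsSlicing.contDiff_phase (h : IsSlicing T X V) (u : Momentum) :
    ContDiff ℝ (⊤ : ℕ∞) (phase T X u) :=
  h.contDiff.sub (contDiff_const.inner ℝ X.contDiff)

lemma IsSlicing.phase_add (h : IsSlicing T X V) {u : Momentum} (hu : ‖u‖ = 1) (p : E) (s : ℝ) :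
    phase T X u (p + s • V u) = phase T X u p - s := by
  rw [phase, phase, ← map_smul, h.time_add, map_add, h.right_inv, inner_add_right,
    inner_smul_right, real_inner_self_eq_norm_sq, hu]
  ring

lemma integrable_of_test [MeasurableSpace E] [BorelSpace E] {μ : Measure E}
    [IsFiniteMeasureOnCompacts μ] {w : E → ℂ} (hw : ContDiff ℝ (⊤ : ℕ∞) w) (hc : HasCompactSupport w) :
    Integrable w μ := hw.continuous.integrable_of_hasCompactSupport hc

/-- The wave `∫ exp(i (|k| t - k · x)) g` on the mass shell. -/
def shellWave [MeasurableSpace E] (μ : Measure E) (T : E → ℝ) (X : E →L[ℝ] Space) (g : E → ℝ) (k : Momentum) : ℂ :=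
  ∫ p, Complex.exp (Complex.I * ((‖k‖ * T p - inner ℝ k (X p) : ℝ) : ℂ)) * (g p : ℂ) ∂μ

lemma shellWave_smul [MeasurableSpace E] {μ : Measure E} (g : E → ℝ) {u : Momentum} (hu : ‖u‖ = 1) {κ : ℝ} (hκ : 0 ≤ κ) :
    shellWave μ T X g (κ • u) = oscillatory μ (phase T X u) (fun p => (g p : ℂ)) κ := by
  rw [shellWave, oscillatory]
  refine integral_congr_ae (ae_of_all _ fun p => ?_)
  simp only [norm_smul, hu, mul_one, Real.norm_of_nonneg hκ, real_inner_smul_left, phase, mul_sub]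

variable [FiniteDimensional ℝ E] [MeasurableSpace E] [BorelSpace E] {μ : Measure E}
  [μ.IsAddHaarMeasure]

/-- Integration by parts in the direction of the wave. -/
lemma IsSlicing.mul_oscillatory (h : IsSlicing T X V) {w : E → ℂ}
    (hw : ContDiff ℝ (⊤ : ℕ∞) w) (hc : HasCompactSupport w) {u : Momentum} (hu : ‖u‖ = 1) (κ : ℝ) :
    (κ : ℂ) * oscillatory μ (phase T X u) w κ =
      -Complex.I * oscillatory μ (phase T X u) (fun p => fderiv ℝ w p (V u)) κ := by
  have hΦ := h.contDiff_phase u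
  set e : E → ℂ := fun p => Complex.exp (Complex.I * ((κ * phase T X u p : ℝ) : ℂ)) with he
  have hsmooth : ContDiff ℝ (⊤ : ℕ∞) e :=
    (contDiff_const.mul (Complex.ofRealCLM.contDiff.comp (contDiff_const.mul hΦ))).cexp
  have hediff : Differentiable ℝ e := hsmooth.differentiable (by simp)
  have hwdiff : Differentiable ℝ w := hw.differentiable (by simp)
  have hfd : ∀ p, fderiv ℝ e p (V u) = -(Complex.I * κ) * e p := by
    intro p
    rw [← (hediff p).lineDeriv_eq_fderiv, lineDeriv]
    have h1 : (fun s : ℝ => e (p + s • V u)) = fun s : ℝ =>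
        Complex.exp (Complex.I * ((κ * (phase T X u p - s) : ℝ) : ℂ)) := by
      funext s; simp only [he, h.phase_add hu]
    have h2 : HasDerivAt (fun s : ℝ => Complex.I * ((κ * (phase T X u p - s) : ℝ) : ℂ))
        (-(Complex.I * κ)) 0 := by
      have := (((hasDerivAt_id (0 : ℝ)).const_sub (phase T X u p)).const_mul κ).ofReal_comp.const_mul
        Complex.I
      simpa using this
    rw [h1, h2.cexp.deriv]
    simp only [he, sub_zero]
    ring
  have hdw : Continuous fun p => fderiv ℝ w p (V u) :=
    (hw.continuous_fderiv (by simp)).clm_apply continuous_const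
  have hint1 : Integrable (fun p => fderiv ℝ e p (V u) * w p) μ := by
    simp only [hfd]
    exact Continuous.integrable_of_hasCompactSupport
      ((continuous_const.mul hsmooth.continuous).mul hw.continuous) hc.mul_left
  have hint2 : Integrable (fun p => e p * fderiv ℝ w p (V u)) μ :=
    Continuous.integrable_of_hasCompactSupport (hsmooth.continuous.mul hdw)
      (hc.fderiv_apply (𝕜 := ℝ) (V u)).mul_left
  have hint3 : Integrable (fun p => e p * w p) μ :=
    Continuous.integrable_of_hasCompactSupport (hsmooth.continuous.mul hw.continuous) hc.mul_left
  have key := integral_mul_fderiv_eq_neg_fderiv_mul_of_integrable hint1 hint2 hint3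
    (fun x _ => hediff x) (fun x _ => hwdiff x)
  simp only [hfd] at key
  rw [oscillatory, oscillatory]
  rw [show (∫ p, e p * fderiv ℝ w p (V u) ∂μ) = Complex.I * κ * ∫ p, e p * w p ∂μ by
    rw [key, ← integral_neg, ← integral_const_mul]
    exact integral_congr_ae (ae_of_all _ fun p => by ring)]
  rw [← mul_assoc, ← mul_assoc, neg_mul, Complex.I_mul_I, neg_neg, one_mul]

lemma abs_coord_le_one {u : Momentum} (hu : ‖u‖ = 1) (i : Fin 3) : ‖((u i : ℝ) : ℂ)‖ ≤ 1 := by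
  rw [Complex.norm_real, ← hu]
  exact PiLp.norm_apply_le u i

lemma sum_coord_smul_single (u : Momentum) :
    u = ∑ i, u i • (EuclideanSpace.single i (1 : ℝ) : Momentum) := by
  ext j
  simp [Finset.sum_apply, Pi.single_apply]

lemma IsSlicing.exists_pow_mul_oscillatory_le (h : IsSlicing T X V) (N : ℕ) :
    ∀ w : E → ℂ, ContDiff ℝ (⊤ : ℕ∞) w → HasCompactSupport w →
      ∃ C, ∀ u, ‖u‖ = 1 → ∀ κ, 0 ≤ κ → κ ^ N * ‖oscillatory μ (phase T X u) w κ‖ ≤ C := by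
  induction N with
  | zero =>
    intro w _ _
    refine ⟨∫ p, ‖w p‖ ∂μ, fun u _ κ _ => ?_⟩
    rw [pow_zero, one_mul]
    exact norm_oscillatory_le κ
  | succ N ih =>
    intro w hw hc
    have hsm : ∀ v : E, ContDiff ℝ (⊤ : ℕ∞) fun p => fderiv ℝ w p v := fun v =>
      (hw.fderiv_right (m := (⊤ : ℕ∞)) (by simp)).clm_apply contDiff_const
    have hcs : ∀ v : E, HasCompactSupport fun p => fderiv ℝ w p v := fun v =>
      hc.fderiv_apply (𝕜 := ℝ) v
    choose C hC using fun i : Fin 3 =>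
      ih _ (hsm (V (EuclideanSpace.single i 1))) (hcs (V (EuclideanSpace.single i 1)))
    refine ⟨∑ i, C i, fun u hu κ hκ => ?_⟩
    have hlin : (fun p => fderiv ℝ w p (V u)) = fun p =>
        ∑ i, ((u i : ℝ) : ℂ) * fderiv ℝ w p (V (EuclideanSpace.single i 1)) := by
      funext p
      conv_lhs => rw [sum_coord_smul_single u]
      simp only [map_sum, map_smul, Complex.real_smul]
    have h1 : κ * ‖oscillatory μ (phase T X u) w κ‖ ≤
        ∑ i, ‖oscillatory μ (phase T X u)
          (fun p => fderiv ℝ w p (V (EuclideanSpace.single i 1))) κ‖ := by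
      have := congrArg norm (h.mul_oscillatory (μ := μ) hw hc hu κ)
      rw [norm_mul, Complex.norm_real, Real.norm_of_nonneg hκ, norm_mul, norm_neg, Complex.norm_I,
        one_mul] at this
      rw [this, hlin, oscillatory_sum_mul Finset.univ _ (h.contDiff_phase u).continuous.aestronglyMeasurable
        fun i => integrable_of_test (hsm _) (hcs _)]
      refine (norm_sum_le _ _).trans (Finset.sum_le_sum fun i _ => ?_)
      rw [norm_mul]
      exact mul_le_of_le_one_left (norm_nonneg _) (abs_coord_le_one hu i)
    rw [pow_succ, mul_assoc]
    refine (mul_le_mul_of_nonneg_left h1 (pow_nonneg hκ N)).trans ?_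
    rw [Finset.mul_sum]
    exact Finset.sum_le_sum fun i _ => hC i u hu κ hκ

lemma IsSlicing.exists_oscillatory_decay (h : IsSlicing T X V) {w : E → ℂ}
    (hw : ContDiff ℝ (⊤ : ℕ∞) w) (hc : HasCompactSupport w) :
    ∃ C, ∀ u, ‖u‖ = 1 → ∀ κ, 0 ≤ κ →
      ‖oscillatory μ (phase T X u) w κ‖ ≤ C / (1 + κ) ^ 2 := by
  obtain ⟨C₀, h₀⟩ := h.exists_pow_mul_oscillatory_le (μ := μ) 0 w hw hc
  obtain ⟨C₂, h₂⟩ := h.exists_pow_mul_oscillatory_le (μ := μ) 2 w hw hc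
  refine ⟨2 * (C₀ + C₂), fun u hu κ hκ => ?_⟩
  have a := h₀ u hu κ hκ
  have b := h₂ u hu κ hκ
  rw [le_div_iff₀ (by positivity)]
  have hn := norm_nonneg (oscillatory μ (phase T X u) w κ)
  nlinarith [mul_nonneg hn (sq_nonneg (1 - κ))]

/-- The decay of the derivative of the oscillatory integral in the frequency. -/
lemma IsSlicing.exists_oscillatory_deriv_decay (h : IsSlicing T X V) {w : E → ℂ}
    (hw : ContDiff ℝ (⊤ : ℕ∞) w) (hc : HasCompactSupport w) :
    ∃ C, ∀ u, ‖u‖ = 1 → ∀ κ, 0 ≤ κ →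
      ‖oscillatory μ (phase T X u) (fun p => Complex.I * (phase T X u p : ℂ) * w p) κ‖ ≤
        C / (1 + κ) ^ 2 := by
  have hT : ContDiff ℝ (⊤ : ℕ∞) fun p => (T p : ℂ) * w p :=
    (Complex.ofRealCLM.contDiff.comp h.contDiff).mul hw
  have hX : ∀ j : Fin 3, ContDiff ℝ (⊤ : ℕ∞) fun p => ((X p j : ℝ) : ℂ) * w p := fun j =>
    (Complex.ofRealCLM.contDiff.comp
      ((EuclideanSpace.proj j : Space →L[ℝ] ℝ).contDiff.comp X.contDiff)).mul hw
  obtain ⟨C, hC⟩ := h.exists_oscillatory_decay (μ := μ) hT hc.mul_left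
  choose D hD using fun j => h.exists_oscillatory_decay (μ := μ) (hX j) hc.mul_left
  refine ⟨C + ∑ j, D j, fun u hu κ hκ => ?_⟩
  have e : (fun p => Complex.I * (phase T X u p : ℂ) * w p) = fun p => ∑ j : Option (Fin 3),
      (j.elim Complex.I fun j => -(Complex.I * ((u j : ℝ) : ℂ))) *
        (j.elim (fun p => (T p : ℂ) * w p) (fun j p => ((X p j : ℝ) : ℂ) * w p)) p := by
    funext p
    rw [Fintype.sum_option]
    simp only [Option.elim, phase, PiLp.inner_apply, Real.inner_apply, Fin.sum_univ_three]
    push_cast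
    ring
  rw [e, oscillatory_sum_mul Finset.univ _ (h.contDiff_phase u).continuous.aestronglyMeasurable,
    Fintype.sum_option, add_div, Finset.sum_div]
  · refine (norm_add_le _ _).trans (add_le_add ?_ ((norm_sum_le _ _).trans
      (Finset.sum_le_sum fun j _ => ?_)))
    · rw [norm_mul]
      exact (mul_le_of_le_one_left (norm_nonneg _) (by simp)).trans (hC u hu κ hκ)
    · rw [norm_mul]
      refine (mul_le_of_le_one_left (norm_nonneg _) ?_).trans (hD j u hu κ hκ)
      simpa using abs_coord_le_one hu j
  · rintro (_ | j)
    · exact integrable_of_test hT hc.mul_left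
    · exact integrable_of_test (hX j) hc.mul_left

/-- The properties of the restriction of the Fourier transform of a test function to the mass shell
that determine the behavior of the fluctuations. -/
structure IsShellWave (G : Momentum → ℂ) : Prop where
  continuous : Continuous G
  exists_decay : ∃ C, ∀ k, ‖G k‖ ≤ C / (1 + ‖k‖) ^ 2
  exists_deriv : ∃ (C : ℝ) (G' : Momentum → ℝ → ℂ), ∀ u, ‖u‖ = 1 →
    Continuous (G' u) ∧ ∀ κ, 0 < κ →
      HasDerivAt (fun x : ℝ => G (x • u)) (G' u κ) κ ∧ ‖G' u κ‖ ≤ C / (1 + κ) ^ 2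
  exists_average_ne_zero : (∃ k, (G k).re ≠ 0) → ∀ θ, 0 ≤ θ → θ ≤ 1 →
    ∃ ρ > 0, ∃ u, ‖u‖ = 1 ∧ (∫ x in (1 / 2 : ℝ)..1,
      Complex.exp (Complex.I * ((x * θ : ℝ) : ℂ)) * G ((ρ * x) • u)).re ≠ 0

theorem IsSlicing.isShellWave (h : IsSlicing T X V) {g : E → ℝ}
    (hg : ContDiff ℝ (⊤ : ℕ∞) g) (hc : HasCompactSupport g) :
    IsShellWave (shellWave μ T X g) := by
  have hgc : ContDiff ℝ (⊤ : ℕ∞) fun p => (g p : ℂ) := Complex.ofRealCLM.contDiff.comp hg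
  have hcc : HasCompactSupport fun p => (g p : ℂ) := hc.comp_left Complex.ofReal_zero
  have hTc := h.contDiff.continuous
  -- polar coordinates, including the origin
  have hpolar : ∀ k : Momentum, ∃ u : Momentum, ‖u‖ = 1 ∧ k = ‖k‖ • u := by
    intro k
    by_cases hk : k = 0
    · exact ⟨EuclideanSpace.single 0 1, by simp, by simp [hk]⟩
    · have hk' := norm_ne_zero_iff.2 hk
      refine ⟨‖k‖⁻¹ • k, ?_, ?_⟩
      · rw [norm_smul, norm_inv, norm_norm, inv_mul_cancel₀ hk']
      · rw [smul_smul, mul_inv_cancel₀ hk', one_smul]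
  refine ⟨?_, ?_, ?_, ?_⟩
  · refine continuous_of_dominated (bound := fun p => ‖(g p : ℂ)‖) (fun k => ?_)
      (fun k => ae_of_all _ fun p => ?_) (integrable_of_test hgc hcc).norm
      (ae_of_all _ fun p => ?_)
    · exact Continuous.aestronglyMeasurable (by fun_prop)
    · rw [norm_mul, norm_exp_I_mul_ofReal, one_mul]
    · fun_prop
  · obtain ⟨C, hC⟩ := h.exists_oscillatory_decay (μ := μ) hgc hcc
    refine ⟨C, fun k => ?_⟩
    obtain ⟨u, hu, hk⟩ := hpolar k
    conv_lhs => rw [hk, shellWave_smul g hu (norm_nonneg k)]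
    exact hC u hu _ (norm_nonneg k)
  · obtain ⟨C, hC⟩ := h.exists_oscillatory_deriv_decay (μ := μ) hgc hcc
    refine ⟨C, fun u => oscillatory μ (phase T X u)
      (fun p => Complex.I * (phase T X u p : ℂ) * (g p : ℂ)), fun u hu => ?_⟩
    have hΦ := (h.contDiff_phase u).continuous
    have hint : ∀ w : E → ℂ, Continuous w → HasCompactSupport w →
        Integrable w μ := fun w hw hc => hw.integrable_of_hasCompactSupport hc
    have hIΦ : Continuous fun p => Complex.I * (phase T X u p : ℂ) := by fun_prop
    have hd0 := hint _ hgc.continuous hcc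
    have hd1 := hint _ (hIΦ.mul hgc.continuous) hcc.mul_left
    have hd2 := hint _ (hIΦ.mul (hIΦ.mul hgc.continuous)) hcc.mul_left.mul_left
    refine ⟨continuous_iff_continuousAt.2 fun κ =>
      (hasDerivAt_oscillatory hΦ.aestronglyMeasurable hd1 hd2 κ).continuousAt, fun κ hκ =>
      ⟨?_, hC u hu κ hκ.le⟩⟩
    refine (hasDerivAt_oscillatory hΦ.aestronglyMeasurable hd0 hd1 κ).congr_of_eventuallyEq ?_
    filter_upwards [lt_mem_nhds hκ] with x hx using shellWave_smul g hu hx.le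
  · rintro ⟨k, hk⟩ θ h0 h1
    obtain ⟨u, hu, hku⟩ := hpolar k
    rw [hku, shellWave_smul g hu (norm_nonneg k)] at hk
    have hΦ := (h.contDiff_phase u).continuous
    obtain ⟨B, hB⟩ := hc.isCompact.exists_bound_of_continuousOn hΦ.continuousOn
    obtain ⟨ρ, hρ, hne⟩ := exists_re_average_oscillatory_ne_zero hΦ.aestronglyMeasurable
      (hg.continuous.integrable_of_hasCompactSupport hc)
      (fun p hp => hB p (subset_tsupport g hp)) h0 h1 hk
    refine ⟨ρ, hρ, u, hu, fun hz => hne ?_⟩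
    rw [← hz]
    congr 1
    refine intervalIntegral.integral_congr fun x hx => ?_
    rw [Set.uIcc_of_le (by norm_num)] at hx
    have hx0 : 0 ≤ ρ * x := mul_nonneg hρ.le (le_trans (by norm_num) hx.1)
    simp only [shellWave_smul g hu hx0]

end Waves

/-! ### The wave functions of the scaled field -/

section Scaling

variable {f : Smearing} {G : Momentum → ℂ} {R : ℝ}

instance isAddHaarMeasure_spacetime : (volume : Measure Spacetime).IsAddHaarMeasure :=
  inferInstanceAs ((volume : Measure ℝ).prod (volume : Measure Space)).IsAddHaarMeasure

lemma isShellWave_onShell (hf : f.IsTest) : IsShellWave f.onShell := by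
  cases f with
  | smooth f =>
    have h : IsSlicing (Prod.fst : Spacetime → ℝ) (ContinuousLinearMap.snd ℝ ℝ Space)
        (ContinuousLinearMap.inr ℝ ℝ Space) :=
      ⟨contDiff_fst, fun p v => by simp, fun v => rfl⟩
    have := h.isShellWave (μ := volume) (g := fun p => (2 * Real.pi) ^ (-(3 / 2) : ℝ) * f p)
      (contDiff_const.mul hf.1) hf.2.mul_left
    convert this using 1
    funext k
    simp only [Smearing.onShell, Smearing.fourier, shellWave]
    rw [← integral_const_mul]
    refine integral_congr_ae (ae_of_all _ fun p => ?_)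
    simp only [ContinuousLinearMap.coe_snd']
    push_cast
    ring
  | sharpTime τ η =>
    have h : IsSlicing (fun _ : Space => τ) (ContinuousLinearMap.id ℝ Space)
        (ContinuousLinearMap.id ℝ Space) :=
      ⟨contDiff_const, fun p v => rfl, fun v => rfl⟩
    have := h.isShellWave (μ := volume) (g := fun p => (2 * Real.pi) ^ (-(3 / 2) : ℝ) * η p)
      (contDiff_const.mul hf.1) hf.2.mul_left
    convert this using 1
    funext k
    simp only [Smearing.onShell, Smearing.fourier, shellWave]
    rw [← integral_const_mul]
    refine integral_congr_ae (ae_of_all _ fun p => ?_)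
    simp only [ContinuousLinearMap.coe_id', id]
    push_cast
    ring

/-- Scaling to the size `R` concentrates the test function at momenta of order `1 / R`. The total
power of `R` is `-3 + 4` for functions on spacetime and, since `δ(t / R) = R δ(t)`, `-3 + 1 + 3` for
sharp-time functions. -/
lemma onShell_scaled (f : Smearing) (hR : 0 < R) (k : Momentum) :
    (f.scaled R).onShell k = (R : ℂ) * f.onShell (R • k) := by
  have hR' : (R : ℂ) ≠ 0 := by exact_mod_cast hR.ne'
  cases f with
  | smooth f =>
    simp only [Smearing.scaled, Smearing.onShell, Smearing.fourier]
    rw [mul_left_comm (R : ℂ)]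
    congr 1
    have h := Measure.integral_comp_inv_smul_of_nonneg (volume : Measure Spacetime)
      (fun q : Spacetime => Complex.exp
        (Complex.I * ((‖R • k‖ * q.1 - inner ℝ (R • k) q.2 : ℝ) : ℂ)) * (f q : ℂ)) hR.le
    rw [show Module.finrank ℝ Spacetime = 4 by simp] at h
    have e : (R : ℂ) * (∫ q : Spacetime, Complex.exp
        (Complex.I * ((‖R • k‖ * q.1 - inner ℝ (R • k) q.2 : ℝ) : ℂ)) * (f q : ℂ)) =
        ((R ^ 3)⁻¹ : ℂ) * (R ^ 4 • ∫ q : Spacetime, Complex.exp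
        (Complex.I * ((‖R • k‖ * q.1 - inner ℝ (R • k) q.2 : ℝ) : ℂ)) * (f q : ℂ)) := by
      rw [Complex.real_smul]; push_cast; field_simp
    rw [e, ← h, ← integral_const_mul]
    refine integral_congr_ae (ae_of_all _ fun p => ?_)
    simp only [norm_smul, Real.norm_of_nonneg hR.le, Prod.smul_fst, Prod.smul_snd, smul_eq_mul,
      inner_smul_left, inner_smul_right, conj_trivial]
    rw [show R * ‖k‖ * (R⁻¹ * p.1) - R⁻¹ * (R * inner ℝ k p.2) = ‖k‖ * p.1 - inner ℝ k p.2 by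
      field_simp]
    push_cast
    ring
  | sharpTime τ η =>
    simp only [Smearing.scaled, Smearing.onShell, Smearing.fourier]
    rw [mul_left_comm (R : ℂ)]
    congr 1
    have h := Measure.integral_comp_inv_smul_of_nonneg (volume : Measure Space)
      (fun q : Space => Complex.exp
        (Complex.I * ((‖R • k‖ * τ - inner ℝ (R • k) q : ℝ) : ℂ)) * (η q : ℂ)) hR.le
    rw [show Module.finrank ℝ Space = 3 by simp] at h
    have e : (R : ℂ) * (∫ q : Space, Complex.exp
        (Complex.I * ((‖R • k‖ * τ - inner ℝ (R • k) q : ℝ) : ℂ)) * (η q : ℂ)) =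
        ((R ^ 3)⁻¹ * R : ℂ) * (R ^ 3 • ∫ q : Space, Complex.exp
        (Complex.I * ((‖R • k‖ * τ - inner ℝ (R • k) q : ℝ) : ℂ)) * (η q : ℂ)) := by
      rw [Complex.real_smul]; push_cast; field_simp
    rw [e, ← h, ← integral_const_mul]
    refine integral_congr_ae (ae_of_all _ fun p => ?_)
    simp only [norm_smul, Real.norm_of_nonneg hR.le,
      inner_smul_left, inner_smul_right, conj_trivial]
    rw [show R * ‖k‖ * τ - R⁻¹ * (R * inner ℝ k p) = ‖k‖ * (R * τ) - inner ℝ k p by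
      field_simp]
    push_cast
    ring

/-- The wave function `|k|^{-1/2} R G(R k)` of the field scaled by `R`. -/
def scaledWave (G : Momentum → ℂ) (R : ℝ) (k : Momentum) : ℂ :=
  ((‖k‖ ^ (-(1 / 2) : ℝ) : ℝ) : ℂ) * ((R : ℂ) * G (R • k))

lemma oneParticle_scaled (f : Smearing) (hR : 0 < R) :
    (f.scaled R).oneParticle = scaledWave f.onShell R := by
  funext k
  rw [Smearing.oneParticle, onShell_scaled f hR, scaledWave]

lemma norm_scaledWave_sq (hR : 0 < R) (k : Momentum) :
    ‖scaledWave G R k‖ ^ 2 = R ^ 3 * (‖G (R • k)‖ ^ 2 / ‖R • k‖) := by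
  rw [scaledWave, norm_mul, norm_mul, Complex.norm_real, Complex.norm_real,
    Real.norm_of_nonneg hR.le, Real.norm_of_nonneg (Real.rpow_nonneg (norm_nonneg k) _), mul_pow,
    mul_pow, norm_smul, Real.norm_of_nonneg hR.le, ← Real.rpow_natCast (‖k‖ ^ (-(1 / 2) : ℝ)) 2,
    ← Real.rpow_mul (norm_nonneg k)]
  norm_num [Real.rpow_neg_one]
  field_simp

lemma IsShellWave.integrable_norm_sq_div (h : IsShellWave G) :
    Integrable fun k => ‖G k‖ ^ 2 / ‖k‖ := by
  obtain ⟨C, hC⟩ := h.exists_decay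
  have hr : Integrable fun k : Momentum => C ^ 2 * (‖k‖⁻¹ * ((1 + ‖k‖) ^ 4)⁻¹) := by
    refine (integrable_fun_norm_addHaar volume
      (f := fun y : ℝ => C ^ 2 * (y⁻¹ * ((1 + y) ^ 4)⁻¹))).2 ?_
    refine ((integrable_inv_one_add_sq.const_mul (C ^ 2)).integrableOn).mono' ?_ ?_
    · exact Measurable.aestronglyMeasurable (by fun_prop)
    · refine (ae_restrict_iff' measurableSet_Ioi).2 (ae_of_all _ fun y hy => ?_)
      have hy' : 0 < y := hy
      have hd : Module.finrank ℝ Momentum - 1 = 2 := by simp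
      rw [hd, smul_eq_mul, Real.norm_of_nonneg (by positivity)]
      rw [show y ^ 2 * (C ^ 2 * (y⁻¹ * ((1 + y) ^ 4)⁻¹)) = C ^ 2 * (y * ((1 + y) ^ 4)⁻¹) by
        field_simp]
      refine mul_le_mul_of_nonneg_left ?_ (sq_nonneg C)
      rw [← div_eq_mul_inv, ← one_div, div_le_div_iff₀ (by positivity) (by positivity)]
      nlinarith [pow_pos hy' 2, pow_pos hy' 3, pow_pos hy' 4]
  refine hr.mono' ?_ (ae_of_all _ fun k => ?_)
  · exact ((h.continuous.norm.pow 2).measurable.div measurable_norm).aestronglyMeasurable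
  · rw [Real.norm_of_nonneg (by positivity), div_eq_mul_inv, mul_comm (‖k‖⁻¹), ← mul_assoc]
    refine mul_le_mul_of_nonneg_right ?_ (by positivity)
    calc ‖G k‖ ^ 2 ≤ (C / (1 + ‖k‖) ^ 2) ^ 2 := pow_le_pow_left₀ (norm_nonneg _) (hC k) 2
      _ = C ^ 2 * ((1 + ‖k‖) ^ 4)⁻¹ := by rw [div_pow, ← pow_mul, div_eq_mul_inv]

lemma IsShellWave.memLp_scaledWave (h : IsShellWave G) (hR : 0 < R) :
    MemLp (scaledWave G R) 2 volume := by
  have hcont := h.continuous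
  have hm : AEStronglyMeasurable (scaledWave G R) volume := by
    refine Measurable.aestronglyMeasurable ?_
    unfold scaledWave
    have : Measurable fun k : Momentum => ‖k‖ ^ (-(1 / 2) : ℝ) := by fun_prop
    exact (Complex.measurable_ofReal.comp this).mul
      ((hcont.comp (continuous_const_smul R)).measurable.const_mul _)
  rw [memLp_two_iff_integrable_sq_norm hm]
  simp only [norm_scaledWave_sq hR]
  exact (((integrable_comp_smul_iff volume (fun k => ‖G k‖ ^ 2 / ‖k‖) hR.ne').2
    h.integrable_norm_sq_div)).const_mul _

/-- The fluctuations in the vacuum do not depend on the scale. -/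
lemma l2Sq_scaledWave (G : Momentum → ℂ) (hR : 0 < R) :
    l2Sq volume (scaledWave G R) = ∫ k, ‖G k‖ ^ 2 / ‖k‖ := by
  rw [l2Sq]
  simp only [norm_scaledWave_sq hR]
  rw [integral_const_mul, Measure.integral_comp_smul_of_nonneg volume
    (fun k => ‖G k‖ ^ 2 / ‖k‖) R (hR := hR.le), show Module.finrank ℝ Momentum = 3 by simp,
    smul_eq_mul, mul_inv_cancel_left₀ (by positivity)]

lemma vacuumFluctuation_eq (hf : f.IsTest) :
    vacuumFluctuation f = ENNReal.ofReal (1 / 2 * ∫ k, ‖f.onShell k‖ ^ 2 / ‖k‖) := by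
  rw [← integral_const_mul, ofReal_integral_eq_lintegral_ofReal
    ((isShellWave_onShell hf).integrable_norm_sq_div.const_mul _)
    (ae_of_all _ fun k => by positivity), vacuumFluctuation]
  refine lintegral_congr fun k => ?_
  congr 1
  rw [div_mul_div_comm, one_mul]

end Scaling

/-! ### The coefficients of the scaled field in a shell -/

section Shells

variable {G : Momentum → ℂ} {R θ ρ : ℝ}

/-- The radial integral to which the coefficients of the scaled field in the `i`-th shell reduce,
with `θ = ε_i τ_i` and `ρ = R ε_i`. -/
def shellIntegral (G : Momentum → ℂ) (θ ρ : ℝ) (u : Momentum) : ℂ :=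
  (ρ : ℂ) * ∫ x in (1 / 2 : ℝ)..1,
    Complex.exp (Complex.I * ((x * θ : ℝ) : ℂ)) * G ((ρ * x) • u)

lemma continuous_shellIntegral (hG : Continuous G) (ρ : ℝ) {X : Type*} [TopologicalSpace X]
    {θ : X → ℝ} {u : X → Momentum} (hθ : Continuous θ) (hu : Continuous u) :
    Continuous fun x => shellIntegral G (θ x) ρ (u x) := by
  have h1 : Continuous fun p : ℝ × Momentum => shellIntegral G p.1 ρ p.2 := by
    unfold shellIntegral
    exact continuous_const.mul
      (intervalIntegral.continuous_parametric_intervalIntegral_of_continuous'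
        (f := fun (p : ℝ × Momentum) (x : ℝ) =>
          Complex.exp (Complex.I * ((x * p.1 : ℝ) : ℂ)) * G ((ρ * x) • p.2)) (by fun_prop) _ _)
  have h2 := h1.comp (hθ.prodMk hu)
  simpa only [Function.comp_def] using h2

/-- The powers `|k|^{-3/2}` of the mode and `|k|^{-1/2}` of the field cancel the Jacobian `|k|²`, so
that only the windowed average of the wave is left. -/
lemma radial_integral_mode (r : ℝ) (i l : ℕ) (m : ℤ) (G : Momentum → ℂ) (R : ℝ)
    {u : Momentum} (hu : ‖u‖ = 1) :
    ∫ x in Set.Ioi (0 : ℝ), x ^ 2 •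
      ((starRingEnd ℂ) (mode r i l m (x • u)) * scaledWave G R (x • u)) =
    (((Real.log 2) ^ (-(1 / 2) : ℝ) : ℝ) : ℂ) * (((sphericalHarmonic l m u : ℝ) : ℂ) *
      shellIntegral G (eps i ^ r) (R * eps i) u) := by
  have hi := eps_pos i
  have hsub : Set.Icc (eps (i + 1)) (eps i) ⊆ Set.Ioi 0 := fun x hx => (eps_pos _).trans_le hx.1
  set c : ℂ := (((Real.log 2) ^ (-(1 / 2) : ℝ) : ℝ) : ℂ) * ((sphericalHarmonic l m u : ℝ) : ℂ) *
    (R : ℂ)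
  have e : ∀ x ∈ Set.Ioi (0 : ℝ), x ^ 2 •
      ((starRingEnd ℂ) (mode r i l m (x • u)) * scaledWave G R (x • u)) =
      (Set.Icc (eps (i + 1)) (eps i)).indicator (fun x => c *
        (Complex.exp (Complex.I * ((x * emissionTime r i : ℝ) : ℂ)) * G ((R * x) • u))) x := by
    intro x hx
    have hx' : (0 : ℝ) < x := hx
    rw [mode_smul r i l m hu hx', map_mul, Complex.conj_ofReal, ← Complex.exp_conj, map_mul,
      map_neg, Complex.conj_I, Complex.conj_ofReal, neg_neg, scaledWave, smul_unit_norm hu hx',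
      smul_smul]
    by_cases h : x ∈ Set.Icc (eps (i + 1)) (eps i)
    · rw [radialMode_of_mem h, Set.indicator_of_mem h, Complex.real_smul]
      have hpow : ((x ^ 2 : ℝ) : ℂ) * (((x ^ (-(3 / 2) : ℝ) : ℝ) : ℂ) *
          ((x ^ (-(1 / 2) : ℝ) : ℝ) : ℂ)) = 1 := by
        rw [← Complex.ofReal_mul, ← Complex.ofReal_mul, ← Real.rpow_add hx',
          ← Real.rpow_natCast x 2, ← Real.rpow_add hx']
        norm_num
      rw [← mul_one (c * _), ← hpow]
      simp only [c]
      push_cast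
      ring
    · rw [radialMode_of_notMem h, Set.indicator_of_notMem h]
      simp
  rw [setIntegral_congr_fun measurableSet_Ioi e, setIntegral_indicator measurableSet_Icc,
    Set.inter_eq_right.2 hsub, integral_const_mul, integral_Icc_eq_integral_Ioc,
    ← intervalIntegral.integral_of_le (eps_le_of_le i.le_succ), eps_succ]
  have hsubst := intervalIntegral.smul_integral_comp_mul_left (a := (1 / 2 : ℝ)) (b := 1)
    (fun x : ℝ => Complex.exp (Complex.I * ((x * emissionTime r i : ℝ) : ℂ)) * G ((R * x) • u))
    (eps i)
  rw [mul_one, mul_one_div] at hsubst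
  rw [← hsubst, shellIntegral, Complex.real_smul]
  have e2 : ∀ x : ℝ, Complex.exp (Complex.I * ((eps i * x * emissionTime r i : ℝ) : ℂ)) *
      G ((R * (eps i * x)) • u) =
      Complex.exp (Complex.I * ((x * eps i ^ r : ℝ) : ℂ)) * G ((R * eps i * x) • u) := by
    intro x
    rw [mul_assoc R, ← eps_mul_emissionTime, mul_left_comm x, mul_assoc]
  simp only [e2, c]
  push_cast
  ring

lemma IsShellWave.l2Inner_mode (h : IsShellWave G) (hR : 0 < R) (r : ℝ) (i l : ℕ) (m : ℤ) :
    l2Inner volume (mode r i l m) (scaledWave G R) =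
      (((Real.log 2) ^ (-(1 / 2) : ℝ) : ℝ) : ℂ) *
        l2Inner surface (fun u : UnitSphere => ((sphericalHarmonic l m u : ℝ) : ℂ))
          (fun u => shellIntegral G (eps i ^ r) (R * eps i) u) := by
  rw [l2Inner, integral_polar (integrable_conj_mul (memLp_mode r i l m) (h.memLp_scaledWave hR)),
    l2Inner, ← integral_const_mul]
  refine integral_congr_ae (ae_of_all _ fun u => ?_)
  simp only [radial_integral_mode r i l m G R (norm_unitSphere u), Complex.conj_ofReal]

lemma IsShellWave.exists_norm_shellIntegral_le (h : IsShellWave G) :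
    ∃ C, 0 ≤ C ∧ ∀ θ ρ u, 0 < ρ → ‖u‖ = 1 →
      ‖shellIntegral G θ ρ u‖ ≤ C * (ρ / (1 + ρ / 2) ^ 2) := by
  obtain ⟨C, hC⟩ := h.exists_decay
  have hC0 : 0 ≤ C := by simpa using (norm_nonneg _).trans (hC 0)
  refine ⟨C, hC0, fun θ ρ u hρ hu => ?_⟩
  rw [shellIntegral, norm_mul, Complex.norm_real, Real.norm_of_nonneg hρ.le, mul_div_left_comm]
  refine mul_le_mul_of_nonneg_left ?_ hρ.le
  have hpos : 0 ≤ C / (1 + ρ / 2) ^ 2 := by positivity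
  refine (intervalIntegral.norm_integral_le_of_norm_le_const (C := C / (1 + ρ / 2) ^ 2)
    fun x hx => ?_).trans ?_
  · rw [Set.uIoc_of_le (by norm_num)] at hx
    rw [norm_mul, norm_exp_I_mul_ofReal, one_mul]
    have hx0 : 0 < x := lt_trans (by norm_num) hx.1
    refine (hC _).trans ?_
    rw [smul_unit_norm hu (mul_pos hρ hx0)]
    have := hx.1
    gcongr
    nlinarith
  · norm_num
    linarith

/-- Integration by parts in the frequency: the coefficients are small for rapid oscillations. -/
lemma IsShellWave.exists_norm_shellIntegral_le_inv (h : IsShellWave G) :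
    ∃ C, 0 ≤ C ∧ ∀ θ ρ u, 0 < θ → 0 < ρ → ‖u‖ = 1 → ‖shellIntegral G θ ρ u‖ ≤ C * θ⁻¹ := by
  obtain ⟨C, hC⟩ := h.exists_decay
  obtain ⟨D, G', hG'⟩ := h.exists_deriv
  have hC0 : 0 ≤ C := by simpa using (norm_nonneg _).trans (hC 0)
  obtain ⟨u₁, hu₁⟩ : ∃ u : Momentum, ‖u‖ = 1 := ⟨_, norm_sphericalPoint 0 0⟩
  have hD0 : 0 ≤ D := by
    have := (norm_nonneg _).trans ((hG' u₁ hu₁).2 1 one_pos).2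
    rwa [le_div_iff₀ (by positivity), zero_mul] at this
  refine ⟨2 * C + 2 * D, by positivity, fun θ ρ u hθ hρ hu => ?_⟩
  obtain ⟨hcont, hder⟩ := hG' u hu
  have hIθ : Complex.I * (θ : ℂ) ≠ 0 := mul_ne_zero Complex.I_ne_zero (by exact_mod_cast hθ.ne')
  set v : ℝ → ℂ := fun x => Complex.exp (Complex.I * ((x * θ : ℝ) : ℂ)) / (Complex.I * θ) with hv
  have hvn : ∀ x, ‖v x‖ = θ⁻¹ := by
    intro x
    simp only [hv]
    rw [norm_div, norm_exp_I_mul_ofReal, norm_mul, Complex.norm_I, one_mul, Complex.norm_real,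
      Real.norm_of_nonneg hθ.le, one_div]
  have hxpos : ∀ x ∈ Set.uIcc (1 / 2 : ℝ) 1, 1 / 2 ≤ x := by
    intro x hx
    rw [Set.uIcc_of_le (by norm_num)] at hx
    exact hx.1
  have hdv : ∀ x ∈ Set.uIcc (1 / 2 : ℝ) 1,
      HasDerivAt v (Complex.exp (Complex.I * ((x * θ : ℝ) : ℂ))) x := by
    intro x _
    have h1 : HasDerivAt (fun x : ℝ => Complex.I * ((x * θ : ℝ) : ℂ)) (Complex.I * (θ : ℂ)) x := by
      have := ((hasDerivAt_id x).mul_const θ).ofReal_comp.const_mul Complex.I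
      simpa using this
    exact (h1.cexp.div_const (Complex.I * θ)).congr_deriv (mul_div_cancel_right₀ _ hIθ)
  have hdG : ∀ x ∈ Set.uIcc (1 / 2 : ℝ) 1,
      HasDerivAt (fun x : ℝ => G ((ρ * x) • u)) ((ρ : ℂ) * G' u (ρ * x)) x := by
    intro x hx
    have hx0 : 0 < x := lt_of_lt_of_le (by norm_num) (hxpos x hx)
    have := (hder (ρ * x) (mul_pos hρ hx0)).1.scomp x ((hasDerivAt_id x).const_mul ρ)
    simpa [Function.comp_def] using this
  have hibp := intervalIntegral.integral_mul_deriv_eq_deriv_mul hdG hdv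
    (by apply Continuous.intervalIntegrable; fun_prop)
    (by apply Continuous.intervalIntegrable; fun_prop)
  -- the powers of the scale are absorbed by the decay of the wave and its derivative
  have hρ1 : ρ / (1 + ρ / 2) ^ 2 ≤ 1 := by
    rw [div_le_one (by positivity)]; nlinarith [sq_nonneg ρ]
  have hρ2 : ρ ^ 2 / (1 + ρ / 2) ^ 2 ≤ 4 := by
    rw [div_le_iff₀ (by positivity)]; nlinarith
  have hGb : ∀ x, 1 / 2 ≤ x → ‖G ((ρ * x) • u)‖ ≤ C / (1 + ρ / 2) ^ 2 := by
    intro x hx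
    have hx0 : 0 < x := lt_of_lt_of_le (by norm_num) hx
    refine (hC _).trans ?_
    rw [smul_unit_norm hu (mul_pos hρ hx0)]
    gcongr
    nlinarith
  have hG'b : ‖∫ x in (1 / 2 : ℝ)..1, (ρ : ℂ) * G' u (ρ * x) * v x‖ ≤
      ρ * (D / (1 + ρ / 2) ^ 2) * θ⁻¹ * |1 - 1 / 2| := by
    refine intervalIntegral.norm_integral_le_of_norm_le_const fun x hx => ?_
    rw [Set.uIoc_of_le (by norm_num)] at hx
    have hx1 := hx.1
    have hx0 : 0 < x := lt_trans (by norm_num) hx1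
    rw [norm_mul, norm_mul, hvn, Complex.norm_real, Real.norm_of_nonneg hρ.le]
    refine mul_le_mul_of_nonneg_right (mul_le_mul_of_nonneg_left ?_ hρ.le) (by positivity)
    refine (hder (ρ * x) (mul_pos hρ hx0)).2.trans ?_
    gcongr
    nlinarith
  have hcomm : (∫ x in (1 / 2 : ℝ)..1,
      Complex.exp (Complex.I * ((x * θ : ℝ) : ℂ)) * G ((ρ * x) • u)) =
      ∫ x in (1 / 2 : ℝ)..1, G ((ρ * x) • u) * Complex.exp (Complex.I * ((x * θ : ℝ) : ℂ)) :=
    intervalIntegral.integral_congr fun x _ => mul_comm _ _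
  rw [shellIntegral, hcomm, hibp, norm_mul, Complex.norm_real, Real.norm_of_nonneg hρ.le]
  have ha : ‖G ((ρ * 1) • u) * v 1‖ ≤ C / (1 + ρ / 2) ^ 2 * θ⁻¹ := by
    rw [norm_mul, hvn]
    exact mul_le_mul_of_nonneg_right (hGb 1 (by norm_num)) (by positivity)
  have hb : ‖G ((ρ * (1 / 2)) • u) * v (1 / 2)‖ ≤ C / (1 + ρ / 2) ^ 2 * θ⁻¹ := by
    rw [norm_mul, hvn]
    exact mul_le_mul_of_nonneg_right (hGb _ le_rfl) (by positivity)
  rw [show |(1 : ℝ) - 1 / 2| = 1 / 2 by norm_num] at hG'b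
  calc ρ * ‖G ((ρ * 1) • u) * v 1 - G ((ρ * (1 / 2)) • u) * v (1 / 2) -
        ∫ x in (1 / 2 : ℝ)..1, (ρ : ℂ) * G' u (ρ * x) * v x‖
      ≤ ρ * (C / (1 + ρ / 2) ^ 2 * θ⁻¹ + C / (1 + ρ / 2) ^ 2 * θ⁻¹ +
          ρ * (D / (1 + ρ / 2) ^ 2) * θ⁻¹ * (1 / 2)) := by
        refine mul_le_mul_of_nonneg_left ?_ hρ.le
        exact (norm_sub_le _ _).trans (add_le_add ((norm_sub_le _ _).trans (add_le_add ha hb)) hG'b)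
    _ = (2 * C * (ρ / (1 + ρ / 2) ^ 2) + D * (ρ ^ 2 / (1 + ρ / 2) ^ 2) / 2) * θ⁻¹ := by ring
    _ ≤ (2 * C + 2 * D) * θ⁻¹ := by
        refine mul_le_mul_of_nonneg_right ?_ (by positivity)
        nlinarith [mul_le_mul_of_nonneg_left hρ1 hC0, mul_le_mul_of_nonneg_left hρ2 hD0]

lemma abs_squeezing_term_le {x : ℝ} (hx : 1 ≤ x) (z : ℂ) :
    |(x ^ 2 - 1) * z.re ^ 2 + (1 / x ^ 2 - 1) * z.im ^ 2| ≤ x ^ 2 * ‖z‖ ^ 2 := by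
  have hx2 : 1 ≤ x ^ 2 := one_le_pow₀ hx
  have hinv0 : 0 ≤ 1 / x ^ 2 := by positivity
  have hinv1 : 1 / x ^ 2 ≤ 1 := by rw [div_le_one (by positivity)]; exact hx2
  have h1 : |x ^ 2 - 1| ≤ x ^ 2 := by rw [abs_le]; constructor <;> linarith
  have h2 : |1 / x ^ 2 - 1| ≤ x ^ 2 := by rw [abs_le]; constructor <;> linarith
  rw [← Complex.normSq_eq_norm_sq, Complex.normSq_apply, mul_add, ← sq, ← sq]
  refine (abs_add_le _ _).trans (add_le_add ?_ ?_)
  · rw [abs_mul, abs_of_nonneg (sq_nonneg z.re)]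
    exact mul_le_mul_of_nonneg_right h1 (sq_nonneg _)
  · rw [abs_mul, abs_of_nonneg (sq_nonneg z.im)]
    exact mul_le_mul_of_nonneg_right h2 (sq_nonneg _)

/-- Bessel's inequality on the sphere, uniform in the number of modes of the shell. -/
lemma sum_norm_sq_l2Inner_sphericalHarmonic_le {J : UnitSphere → ℂ} (hJ : Continuous J) {M : ℝ}
    (hM : ∀ u, ‖J u‖ ≤ M) (i : ℕ) :
    ∑ b ∈ shellIndex i, ‖l2Inner surface
      (fun u : UnitSphere => ((sphericalHarmonic b.1 b.2 u : ℝ) : ℂ)) J‖ ^ 2 ≤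
      surface.real Set.univ * M ^ 2 := by
  have hmem : MemLp J 2 surface := MemLp.of_bound hJ.aestronglyMeasurable M (ae_of_all _ hM)
  refine ((isOrthonormal_sphericalHarmonic i).bessel hmem).trans ?_
  have := integral_mono (integrable_norm_sq hmem) (integrable_const (M ^ 2))
    fun u => pow_le_pow_left₀ (norm_nonneg (J u)) (hM u) 2
  rwa [integral_const, smul_eq_mul] at this

lemma IsShellWave.norm_sq_l2Inner_mode {R : ℝ} (h : IsShellWave G) (hR : 0 < R) (r : ℝ) (i l : ℕ)
    (m : ℤ) : ‖l2Inner volume (mode r i l m) (scaledWave G R)‖ ^ 2 =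
      ((Real.log 2) ^ (-(1 / 2) : ℝ)) ^ 2 * ‖l2Inner surface
        (fun u : UnitSphere => ((sphericalHarmonic l m u : ℝ) : ℂ))
        (fun u => shellIntegral G (eps i ^ r) (R * eps i) u)‖ ^ 2 := by
  rw [h.l2Inner_mode hR, norm_mul, Complex.norm_real, mul_pow, Real.norm_eq_abs, sq_abs]

lemma abs_shellTerm_le (r : ℝ) (F : Momentum → ℂ) {i : ℕ} (hi : 1 ≤ i) :
    |shellTerm r F i| ≤
      (i : ℝ) ^ 2 * ∑ b ∈ shellIndex i, ‖l2Inner volume (mode r i b.1 b.2) F‖ ^ 2 := by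
  rw [shellTerm, Finset.mul_sum]
  exact (Finset.abs_sum_le_sum_abs _ _).trans (Finset.sum_le_sum fun b _ =>
      abs_squeezing_term_le (by exact_mod_cast hi) _)

/-- By Bessel's inequality on the sphere, only the factor `i²` of the squeezing depends on the
shell, although the number of its modes grows with `i`. -/
lemma IsShellWave.exists_abs_shellTerm_le (h : IsShellWave G) :
    ∃ K, ∀ R r i M, 0 < R → 1 ≤ i →
      (∀ u, ‖u‖ = 1 → ‖shellIntegral G (eps i ^ r) (R * eps i) u‖ ≤ M) →
      |shellTerm r (scaledWave G R) i| ≤ K * ((i : ℝ) ^ 2 * M ^ 2) := by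
  refine ⟨((Real.log 2) ^ (-(1 / 2) : ℝ)) ^ 2 * surface.real Set.univ,
    fun R r i M hR hi hM => (abs_shellTerm_le r _ hi).trans ?_⟩
  have hbessel := sum_norm_sq_l2Inner_sphericalHarmonic_le
    (continuous_shellIntegral h.continuous (R * eps i) continuous_const continuous_subtype_val)
    (fun u => hM u (norm_unitSphere u)) i
  simp only [h.norm_sq_l2Inner_mode hR, ← Finset.mul_sum]
  rw [mul_left_comm, mul_assoc, mul_left_comm (surface.real _)]
  exact mul_le_mul_of_nonneg_left (mul_le_mul_of_nonneg_left hbessel (sq_nonneg _)) (sq_nonneg _)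

end Shells

/-! ### The scaling limit -/

section Limits

variable {f : Smearing} {G : Momentum → ℂ} {R : ℝ}

lemma eps_add_one (i : ℕ) : eps (i + 1) = (1 / 2) ^ i := by
  rw [eps_eq, pow_succ]; ring

lemma summable_succ_sq_mul_pow {q : ℝ} (h0 : 0 < q) (h1 : q < 1) :
    Summable fun i : ℕ => ((i + 1 : ℕ) : ℝ) ^ 2 * q ^ i := by
  have h := (summable_nat_add_iff 1).2
    (summable_pow_mul_geometric_of_norm_lt_one 2 (r := q) (by rwa [Real.norm_of_nonneg h0.le]))
  refine (h.mul_right q⁻¹).congr fun i => ?_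
  rw [pow_succ q]
  field_simp

lemma sum_Icc_one_eq_sum_range (s : ℕ → ℝ) (n : ℕ) :
    ∑ i ∈ Finset.Icc 1 n, s i = ∑ i ∈ Finset.range n, s (i + 1) := by
  induction n with
  | zero => simp
  | succ n ih => rw [Finset.sum_Icc_succ_top (by omega), ih, Finset.sum_range_succ]

/-- The bound that follows from the decay of the wave; it is small if the frequencies of the shell
are far from `1 / R` on either side. -/
lemma IsShellWave.exists_abs_shellTerm_le_scale (h : IsShellWave G) :
    ∃ K, ∀ R r i, 0 < R → |shellTerm r (scaledWave G R) (i + 1)| ≤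
      K * (((i + 1 : ℕ) : ℝ) ^ 2 * (R * eps (i + 1) / (1 + R * eps (i + 1) / 2) ^ 2) ^ 2) := by
  obtain ⟨K, hK⟩ := h.exists_abs_shellTerm_le
  obtain ⟨C, -, hC⟩ := h.exists_norm_shellIntegral_le
  refine ⟨K * C ^ 2, fun R r i hR => ?_⟩
  refine (hK R r (i + 1) _ hR (by omega) fun u hu =>
    hC (eps (i + 1) ^ r) _ u (mul_pos hR (eps_pos _)) hu).trans_eq ?_
  ring

/-- The bound that follows from the emission times. It is uniform in the scale and summable over the
shells if `r < 0`. -/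
lemma IsShellWave.exists_abs_shellTerm_le_time (h : IsShellWave G) :
    ∃ K, ∀ R r i, 0 < R → |shellTerm r (scaledWave G R) (i + 1)| ≤
      K * (((i + 1 : ℕ) : ℝ) ^ 2 * ((1 / 2 : ℝ) ^ (-(2 * r))) ^ i) := by
  obtain ⟨K, hK⟩ := h.exists_abs_shellTerm_le
  obtain ⟨C, -, hC⟩ := h.exists_norm_shellIntegral_le_inv
  refine ⟨K * C ^ 2, fun R r i hR => ?_⟩
  refine (hK R r (i + 1) _ hR (by omega) fun u hu =>
    hC (eps (i + 1) ^ r) _ u (Real.rpow_pos_of_pos (eps_pos _) r)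
      (mul_pos hR (eps_pos _)) hu).trans_eq ?_
  have e : ((eps (i + 1) ^ r)⁻¹) ^ 2 = ((1 / 2 : ℝ) ^ (-(2 * r))) ^ i := by
    rw [eps_add_one, ← Real.rpow_neg (by positivity), ← Real.rpow_natCast _ 2,
      ← Real.rpow_natCast (1 / 2 : ℝ) i, ← Real.rpow_natCast _ i, ← Real.rpow_mul (by positivity),
      ← Real.rpow_mul (by positivity), ← Real.rpow_mul (by positivity)]
    congr 1
    push_cast
    ring
  rw [← e]
  ring

lemma IsShellWave.summable_shellTerm (h : IsShellWave G) (r : ℝ) (hR : 0 < R) :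
    Summable fun i => shellTerm r (scaledWave G R) (i + 1) := by
  obtain ⟨K, hK⟩ := h.exists_abs_shellTerm_le_scale
  refine Summable.of_norm_bounded
    (((summable_succ_sq_mul_pow (q := 1 / 4) (by norm_num) (by norm_num)).mul_left
      (R ^ 2)).mul_left |K|) fun i => ?_
  rw [Real.norm_eq_abs]
  refine (hK R r i hR).trans ((mul_le_mul_of_nonneg_right (le_abs_self K) (by positivity)).trans
    (mul_le_mul_of_nonneg_left ?_ (abs_nonneg K)))
  have hρ : 0 < R * eps (i + 1) := mul_pos hR (eps_pos _)
  have h1 : R * eps (i + 1) / (1 + R * eps (i + 1) / 2) ^ 2 ≤ R * eps (i + 1) :=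
    div_le_self hρ.le (one_le_pow₀ (by linarith))
  calc ((i + 1 : ℕ) : ℝ) ^ 2 * (R * eps (i + 1) / (1 + R * eps (i + 1) / 2) ^ 2) ^ 2
      ≤ ((i + 1 : ℕ) : ℝ) ^ 2 * (R * eps (i + 1)) ^ 2 := by gcongr
    _ = R ^ 2 * (((i + 1 : ℕ) : ℝ) ^ 2 * (1 / 4) ^ i) := by
      rw [eps_add_one, mul_pow, ← pow_mul, mul_comm i 2, pow_mul]
      norm_num
      ring

/-- The fluctuations of the scaled field in the state `ω_r`, times two. -/
def fluctuation (r : ℝ) (G : Momentum → ℂ) (R : ℝ) : ℝ :=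
  (∫ k, ‖G k‖ ^ 2 / ‖k‖) + ∑' i, shellTerm r (scaledWave G R) (i + 1)

lemma scaledField_eq (f : Smearing) (hR : 0 < R) :
    scaledField R f = segalField (scaledWave f.onShell R) := by
  rw [scaledField, field, oneParticle_scaled f hR]

lemma tendsto_expectationSq (hf : f.IsTest) (r : ℝ) (hR : 0 < R) :
    Tendsto (fun n : ℕ => expectationSq (squeezed r n) (scaledField R f)) atTop
      (𝓝 (ENNReal.ofReal (1 / 2 * fluctuation r f.onShell R))) := by
  have h := isShellWave_onShell hf
  simp only [scaledField_eq f hR, expectationSq_squeezed r _ (h.memLp_scaledWave hR),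
    sum_Icc_one_eq_sum_range, l2Sq_scaledWave f.onShell hR]
  exact ENNReal.tendsto_ofReal (((h.summable_shellTerm r hR).hasSum.tendsto_sum_nat.const_add
    _).const_mul _)

lemma stateSq_scaledField (hf : f.IsTest) (r : ℝ) (hR : 0 < R) :
    stateSq r (scaledField R f) = ENNReal.ofReal (1 / 2 * fluctuation r f.onShell R) :=
  (tendsto_expectationSq hf r hR).limUnder_eq

lemma squeezed_zero (r : ℝ) : squeezed r 0 = vacuum := by
  funext N k
  rw [squeezed, tsum_eq_single 0]
  · simp
  · rintro (_ | j) hj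
    · exact absurd rfl hj
    · rw [Function.iterate_succ_apply', pairCreation]
      simp

lemma expectationSq_vacuum (hf : f.IsTest) (hR : 0 < R) :
    expectationSq vacuum (scaledField R f) = vacuumFluctuation f := by
  rw [← squeezed_zero 0, scaledField_eq f hR,
    expectationSq_squeezed 0 0 ((isShellWave_onShell hf).memLp_scaledWave hR),
    l2Sq_scaledWave f.onShell hR, vacuumFluctuation_eq hf]
  simp

/-- For `r < 0` the fluctuations approach those in the vacuum: the contributions of the shells are
dominated, uniformly in the scale, by a convergent series. -/
lemma IsShellWave.tendsto_fluctuation (h : IsShellWave G) {r : ℝ} (hr : r < 0) :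
    Tendsto (fluctuation r G) atTop (𝓝 (∫ k, ‖G k‖ ^ 2 / ‖k‖)) := by
  obtain ⟨K, hK⟩ := h.exists_abs_shellTerm_le_scale
  obtain ⟨D, hD⟩ := h.exists_abs_shellTerm_le_time
  have hq0 : (0 : ℝ) < (1 / 2 : ℝ) ^ (-(2 * r)) := Real.rpow_pos_of_pos (by norm_num) _
  have hq1 : (1 / 2 : ℝ) ^ (-(2 * r)) < 1 :=
    Real.rpow_lt_one (by norm_num) (by norm_num) (by linarith)
  have hlim : Tendsto (fun R => ∑' i, shellTerm r (scaledWave G R) (i + 1)) atTop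
      (𝓝 (∑' _ : ℕ, (0 : ℝ))) := by
    refine tendsto_tsum_of_dominated_convergence ((summable_succ_sq_mul_pow hq0 hq1).mul_left D)
      (fun i => ?_) ?_
    · have h4 : ∀ ρ : ℝ, 0 < ρ → ρ / (1 + ρ / 2) ^ 2 ≤ 4 * ρ⁻¹ := by
        intro ρ hρ
        rw [div_le_iff₀ (by positivity), ← div_eq_mul_inv, div_mul_eq_mul_div,
          le_div_iff₀ hρ]
        nlinarith
      have hinv : Tendsto (fun R : ℝ => |K| * (((i + 1 : ℕ) : ℝ) ^ 2 *
          (4 * (R * eps (i + 1))⁻¹) ^ 2)) atTop (𝓝 (|K| * (((i + 1 : ℕ) : ℝ) ^ 2 *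
          (4 * 0) ^ 2))) :=
        ((((tendsto_inv_atTop_zero.comp (tendsto_id.atTop_mul_const (eps_pos (i + 1)))).const_mul
          4).pow 2).const_mul _).const_mul _
      rw [show |K| * (((i + 1 : ℕ) : ℝ) ^ 2 * (4 * 0) ^ 2) = 0 by ring] at hinv
      refine squeeze_zero_norm' ?_ hinv
      filter_upwards [eventually_gt_atTop 0] with R hR
      rw [Real.norm_eq_abs]
      have hρ : 0 < R * eps (i + 1) := mul_pos hR (eps_pos _)
      refine (hK R r i hR).trans ((mul_le_mul_of_nonneg_right (le_abs_self K)
        (by positivity)).trans (mul_le_mul_of_nonneg_left ?_ (abs_nonneg K)))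
      have := h4 _ hρ
      gcongr
    · filter_upwards [eventually_gt_atTop 0] with R hR i
      exact hD R r i hR
  have := hlim.const_add (∫ k, ‖G k‖ ^ 2 / ‖k‖)
  rw [tsum_zero, add_zero] at this
  exact this

/-- A single mode bounds the fluctuations from below, because the decrease of the fluctuations by
the other modes is compensated by the vacuum term. -/
lemma sq_mul_re_sq_le (r : ℝ) {F : Momentum → ℂ} (hF : MemLp F 2 volume) {i n : ℕ} (hi : 1 ≤ i)
    (hin : i ≤ n) {b : Σ _ : ℕ, ℤ} (hb : b ∈ shellIndex i) :
    (i : ℝ) ^ 2 * (l2Inner volume (mode r i b.1 b.2) F).re ^ 2 ≤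
      l2Sq volume F + ∑ j ∈ Finset.Icc 1 n, shellTerm r F j := by
  have hbessel := (isOrthonormal_modeFamily r n).bessel hF
  rw [modeIndex, Finset.sum_sigma] at hbessel
  simp only [modeFamily] at hbessel
  set c : ℕ → (Σ _ : ℕ, ℤ) → ℂ := fun j b => l2Inner volume (mode r j b.1 b.2) F
  set t : ℕ → (Σ _ : ℕ, ℤ) → ℝ := fun j b => (j : ℝ) ^ 2 * (c j b).re ^ 2 +
    1 / (j : ℝ) ^ 2 * (c j b).im ^ 2
  have ht : ∀ j b, 0 ≤ t j b := fun j b => by positivity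
  have hsum : ∑ j ∈ Finset.Icc 1 n, ∑ b ∈ shellIndex j, ‖c j b‖ ^ 2 +
      ∑ j ∈ Finset.Icc 1 n, shellTerm r F j =
      ∑ j ∈ Finset.Icc 1 n, ∑ b ∈ shellIndex j, t j b := by
    rw [← Finset.sum_add_distrib]
    refine Finset.sum_congr rfl fun j _ => ?_
    rw [shellTerm, ← Finset.sum_add_distrib]
    refine Finset.sum_congr rfl fun b _ => ?_
    rw [← Complex.normSq_eq_norm_sq, Complex.normSq_apply]
    simp only [t, c]
    ring
  calc (i : ℝ) ^ 2 * (c i b).re ^ 2 ≤ t i b := le_add_of_nonneg_right (by positivity)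
    _ ≤ ∑ b ∈ shellIndex i, t i b := Finset.single_le_sum (fun b _ => ht i b) hb
    _ ≤ ∑ j ∈ Finset.Icc 1 n, ∑ b ∈ shellIndex j, t j b :=
      Finset.single_le_sum (f := fun j => ∑ b ∈ shellIndex j, t j b)
        (fun j _ => Finset.sum_nonneg fun b _ => ht j b) (Finset.mem_Icc.2 ⟨hi, hin⟩)
    _ ≤ l2Sq volume F + ∑ j ∈ Finset.Icc 1 n, shellTerm r F j := by
      rw [← hsum]; gcongr

lemma le_stateSq (hf : f.IsTest) (r : ℝ) (hR : 0 < R) {i : ℕ} (hi : 1 ≤ i) {b : Σ _ : ℕ, ℤ}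
    (hb : b ∈ shellIndex i) :
    ENNReal.ofReal (1 / 2 * ((i : ℝ) ^ 2 *
      (l2Inner volume (mode r i b.1 b.2) (scaledWave f.onShell R)).re ^ 2)) ≤
      stateSq r (scaledField R f) := by
  have h := (isShellWave_onShell hf).memLp_scaledWave hR
  have hlim := tendsto_expectationSq hf r hR
  rw [← stateSq_scaledField hf r hR] at hlim
  refine ge_of_tendsto hlim ?_
  filter_upwards [eventually_ge_atTop i] with n hn
  rw [scaledField_eq f hR, expectationSq_squeezed r n h]
  exact ENNReal.ofReal_le_ofReal (mul_le_mul_of_nonneg_left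
    (sq_mul_re_sq_le r h hi hn hb) (by norm_num))

lemma tendsto_eps_rpow {r : ℝ} (hr : 0 ≤ r) :
    ∃ θ : ℝ, 0 ≤ θ ∧ θ ≤ 1 ∧ Tendsto (fun n : ℕ => eps (n + 1) ^ r) atTop (𝓝 θ) := by
  rcases hr.eq_or_lt with rfl | hr
  · exact ⟨1, zero_le_one, le_rfl, by simp⟩
  · refine ⟨0, le_rfl, zero_le_one, ?_⟩
    have h1 : Tendsto (fun n : ℕ => eps (n + 1)) atTop (𝓝 0) := by
      simp only [eps_add_one]
      exact tendsto_pow_atTop_nhds_zero_of_lt_one (by norm_num) (by norm_num)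
    have h2 := (Real.continuousAt_rpow_const 0 r (Or.inr hr.le)).tendsto.comp h1
    rwa [Real.zero_rpow hr.ne'] at h2

/-- For `r ≥ 0` there are scales along which a fixed angular momentum has a coefficient in the
`n`-th shell whose real part has a nonzero limit. -/
lemma IsShellWave.exists_tendsto_re_l2Inner_mode (h : IsShellWave G) (hG : ∃ k, (G k).re ≠ 0)
    {r : ℝ} (hr : 0 ≤ r) : ∃ ρ > 0, ∃ (l : ℕ) (m : ℤ) (c : ℝ), m.natAbs ≤ l ∧ c ≠ 0 ∧
      Tendsto (fun n : ℕ => (l2Inner volume (mode r (n + 1) l m)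
        (scaledWave G (ρ / eps (n + 1)))).re) atTop (𝓝 c) := by
  obtain ⟨θ, h0, h1, hθ⟩ := tendsto_eps_rpow hr
  obtain ⟨ρ, hρ, u₀, hu₀, hne⟩ := h.exists_average_ne_zero hG θ h0 h1
  have hsphere : Continuous fun u : UnitSphere => (shellIntegral G θ ρ u).re :=
    Complex.continuous_re.comp
      (continuous_shellIntegral h.continuous ρ continuous_const continuous_subtype_val)
  have hne' : (shellIntegral G θ ρ u₀).re ≠ 0 := by
    rw [shellIntegral, Complex.re_ofReal_mul]
    exact mul_ne_zero hρ.ne' hne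
  obtain ⟨l, m, hlm, hint⟩ := exists_integral_sphericalHarmonic_ne_zero hsphere
    (u₀ := ⟨u₀, mem_sphere_zero_iff_norm.2 hu₀⟩) hne'
  have hlog : 0 < (Real.log 2) ^ (-(1 / 2) : ℝ) := Real.rpow_pos_of_pos log_two_pos _
  have hre : ∀ θ : ℝ, (l2Inner surface (fun u : UnitSphere => ((sphericalHarmonic l m u : ℝ) : ℂ))
      (fun u => shellIntegral G θ ρ u)).re =
      ∫ u : UnitSphere, sphericalHarmonic l m u * (shellIntegral G θ ρ u).re ∂surface := by
    intro θ
    have hc : Continuous fun u : UnitSphere =>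
        ((sphericalHarmonic l m u : ℝ) : ℂ) * shellIntegral G θ ρ u :=
      (Complex.continuous_ofReal.comp
        ((continuous_sphericalHarmonic l m).comp continuous_subtype_val)).mul
        (continuous_shellIntegral h.continuous ρ continuous_const continuous_subtype_val)
    have hi : Integrable (fun u : UnitSphere =>
        ((sphericalHarmonic l m u : ℝ) : ℂ) * shellIntegral G θ ρ u) surface :=
      hc.integrable_of_hasCompactSupport (HasCompactSupport.of_compactSpace _)
    have := Complex.reCLM.integral_comp_comm hi
    simp only [l2Inner, Complex.conj_ofReal]
    rw [← Complex.reCLM_apply, ← this]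
    simp only [Complex.reCLM_apply, Complex.re_ofReal_mul]
  have hcont : Continuous fun θ : ℝ =>
      ∫ u : UnitSphere, sphericalHarmonic l m u * (shellIntegral G θ ρ u).re ∂surface := by
    have hjoint : Continuous fun p : ℝ × UnitSphere =>
        sphericalHarmonic l m p.2 * (shellIntegral G p.1 ρ p.2).re :=
      ((continuous_sphericalHarmonic l m).comp (continuous_subtype_val.comp continuous_snd)).mul
        (Complex.continuous_re.comp (continuous_shellIntegral h.continuous ρ continuous_fst
          (continuous_subtype_val.comp continuous_snd)))
    have := continuous_parametric_integral_of_continuous (μ := surface)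
      (f := fun (θ : ℝ) (u : UnitSphere) =>
        sphericalHarmonic l m u * (shellIntegral G θ ρ u).re) hjoint isCompact_univ
    simpa only [Measure.restrict_univ] using this
  refine ⟨ρ, hρ, l, m, (Real.log 2) ^ (-(1 / 2) : ℝ) * ∫ u : UnitSphere,
    sphericalHarmonic l m u * (shellIntegral G θ ρ u).re ∂surface, hlm,
    mul_ne_zero hlog.ne' hint, ?_⟩
  have hlim := ((hcont.tendsto θ).comp hθ).const_mul ((Real.log 2) ^ (-(1 / 2) : ℝ))
  refine hlim.congr fun n => ?_
  have he := eps_pos (n + 1)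
  rw [h.l2Inner_mode (div_pos hρ he), div_mul_cancel₀ _ he.ne', Complex.re_ofReal_mul, hre]
  rfl

/-- At the scales `ρ / ε_{n+1}`, the mode of the shell `n + 1` that contributes a nonvanishing real
part is amplified by `(n + 1)²`. -/
lemma exists_tendsto_stateSq_top (hf : f.IsTest) (hG : ∃ k, (f.onShell k).re ≠ 0) {r : ℝ}
    (hr : 0 ≤ r) : ∃ R : ℕ → ℝ, Tendsto R atTop atTop ∧
      Tendsto (fun n : ℕ => stateSq r (scaledField (R n) f)) atTop (𝓝 ⊤) := by
  obtain ⟨ρ, hρ, l, m, c, hlm, hc, hlim⟩ :=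
    (isShellWave_onShell hf).exists_tendsto_re_l2Inner_mode hG hr
  refine ⟨fun n => ρ / eps (n + 1), ?_, ?_⟩
  · simp only [eps_add_one, one_div, inv_pow, div_inv_eq_mul]
    exact (tendsto_pow_atTop_atTop_of_one_lt one_lt_two).const_mul_atTop hρ
  · have hn : Tendsto (fun n : ℕ => ((n + 1 : ℕ) : ℝ) ^ 2) atTop atTop :=
      (tendsto_pow_atTop two_ne_zero).comp
        (tendsto_natCast_atTop_atTop.comp (tendsto_add_atTop_nat 1))
    have h1 := ENNReal.tendsto_ofReal_atTop.comp ((hn.atTop_mul_pos (by positivity :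
      (0 : ℝ) < c ^ 2) (hlim.pow 2)).const_mul_atTop (by norm_num : (0 : ℝ) < 1 / 2))
    refine tendsto_nhds_top_mono h1 ?_
    -- the shell `n + 1` contains the modes with `l ≤ n + 1` only
    filter_upwards [eventually_ge_atTop l] with n hn
    refine le_stateSq hf r (div_pos hρ (eps_pos _)) (b := ⟨l, m⟩) (by omega) ?_
    simp only [shellIndex, Finset.mem_sigma, Finset.mem_range, Finset.mem_Icc]
    omega

end Limits

end InfraredPhase

end

open InfraredPhase in
theorem mainTheorem6 :
    -- the vectors defining the states lie in Fock space and are nonzero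
    (∀ (r : ℝ) (n : ℕ), normSq (squeezed r n) ≠ 0 ∧ normSq (squeezed r n) ≠ ⊤) ∧
    ∀ f : Smearing, f.IsTest →
      (f.support ⊆ spacelikeComplement ∨ f.support ⊆ forwardCone) →
      -- the limit defining the state exists and is finite at the square of the scaled field
      (∀ r R : ℝ, 0 < R →
        Tendsto (fun n : ℕ => expectationSq (squeezed r n) (scaledField R f)) atTop
          (𝓝 (stateSq r (scaledField R f))) ∧
        stateSq r (scaledField R f) ≠ ⊤) ∧
      -- the fluctuations in the vacuum
      (vacuumFluctuation f ≠ ⊤ ∧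
        ∀ R : ℝ, 0 < R → expectationSq vacuum (scaledField R f) = vacuumFluctuation f) ∧
      -- the ordered phase
      (∀ r : ℝ, r < 0 →
        Tendsto (fun R : ℝ => stateSq r (scaledField R f)) atTop (𝓝 (vacuumFluctuation f))) ∧
      -- the disordered phase and the critical point
      ((∃ k : Momentum, (f.onShell k).re ≠ 0) →
        ∀ r : ℝ, 0 ≤ r →
          ∃ R : ℕ → ℝ, Tendsto R atTop atTop ∧
            Tendsto (fun n : ℕ => stateSq r (scaledField (R n) f)) atTop (𝓝 ⊤)) := by
  refine ⟨fun r n => ?_, fun f hf _ => ⟨fun r R hR => ?_, ⟨?_, fun R hR => ?_⟩, fun r hr => ?_,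
    fun hG r hr => exists_tendsto_stateSq_top hf hG hr⟩⟩
  · rw [squeezed_eq]
    exact ⟨normSq_squeezedVector_ne_zero (isOrthonormal_modeFamily r n),
      normSq_squeezedVector_ne_top (isOrthonormal_modeFamily r n) squeezing_sq_lt_one⟩
  · rw [stateSq_scaledField hf r hR]
    exact ⟨tendsto_expectationSq hf r hR, ENNReal.ofReal_ne_top⟩
  · rw [vacuumFluctuation_eq hf]
    exact ENNReal.ofReal_ne_top
  · exact expectationSq_vacuum hf hR
  · rw [vacuumFluctuation_eq hf]
    refine (ENNReal.tendsto_ofReal (((isShellWave_onShell hf).tendsto_fluctuation hr).const_mul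
      (1 / 2))).congr' ?_
    filter_upwards [eventually_gt_atTop 0] with R hR
    exact (stateSq_scaledField hf r hR).symm
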